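/- Let $d\in\mathbb N$ and write $z=(q,p)\in\mathbb R^{2d}$. For $\varepsilon>0$ and a symbol $a:\mathbb R^{2d}\to\mathbb R$, the Weyl quantization of $a$ is $$({\rm op}^{\rm We}(a)\psi)(q)=(2\pi\varepsilon)^{-d}\int_{\mathbb R^d}\Big(\int_{\mathbb R^d} a\big(\tfrac{q+y}{2},p\big)\,e^{i(q-y)\cdot p/\varepsilon}\,\psi(y)\,dy\Big)dp$$ (for Schwartz symbols $a$ and $\psi\in L^2(\mathbb R^d)$ the order of integration is immaterial), and the Anti-Wick quantization is ${\rm op}^{\rm AW}(a)={\rm op}^{\rm We}(a*G_{\varepsilon/2})$ with $G_{\varepsilon/2}(z)=(\pi\varepsilon)^{-d}e^{-|z|^2/\varepsilon}$. Let $J=\begin{pmatrix}0&{\rm Id}\\-{\rm Id}&0\end{pmatrix}\in\mathbb R^{2d\times 2d}$, let $\{a,b\}=J\nabla a\cdot\nabla b$ be the Poisson bracket, $D^2a$ the Hessian and $\Delta$ the Laplacian on $\mathbb R^{2d}$. Let $b:\mathbb R^{2d}\to\mathbb R$ be smooth of subquadratic growth, i.e. $\partial^\gamma b$ is bounded for every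 multi-index $|\gamma|\ge 2$, and let $c:\mathbb R^{2d}\to\mathbb R$ be a Schwartz function. Then, for every $\varepsilon>0$, ${\rm op}^{\rm We}(b)$ and ${\rm op}^{\rm AW}(c)$ map the Schwartz space $\mathcal S(\mathbb R^d)$ into itself, the operator $\frac{i}{\varepsilon}[{\rm op}^{\rm We}(b),{\rm op}^{\rm AW}(c)]$ with domain $\mathcal S(\mathbb R^d)$ is essentially self-adjoint in $L^2(\mathbb R^d)$, and $\{b-\frac\varepsilon4\Delta b,c\}-\frac\varepsilon2{\rm tr}(J\,D^2b\,D^2c)$ is a Schwartz function. Moreover, there exists a family of real-valued Schwartz functions $\chi_2^\varepsilon(b,c):\mathbb R^{2d}\to\mathbb R$, $\varepsilon>0$, with $$\sup_{\varepsilon>0}\|{\rm op}^{\rm We}(\chi_2^\varepsilon(b,c))\|_{\mathcal L(L^2(\mathbb R^d))}<\infty$$ such that for all $\varepsilon>0$, as operators on $\mathcal S(\mathbb R^d)$, $$\frac{i}{\varepsilon}\big[{\rm op}^{\rm We}(b),{\rm op}^{\rm AW}(c)\big]={\rm op}^{\rm AW}\Big(\{b-\tfrac\varepsilon4\Delta b,c\}-\tfrac\varepsilon2\,{\rm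 tr}(J\,D^2b\,D^2c)\Big)+\varepsilon^2\,{\rm op}^{\rm We}(\chi_2^\varepsilon(b,c)).$$ -/

import Mathlib

open MeasureTheory SchwartzMap
open scoped ContDiff Gradient Laplacian InnerProductSpace ENNReal

noncomputable section

/-- Position space `ℝ^d` with the Euclidean norm. -/
abbrev Position (d : ℕ) : Type := EuclideanSpace ℝ (Fin d)

/-- Phase space `ℝ^{2d}` with the Euclidean norm; the left summand indexes the positions `q`,
the right summand the momenta `p`. -/
abbrev Phase (d : ℕ) : Type := EuclideanSpace ℝ (Fin d ⊕ Fin d)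

/-- The Hilbert space `L²(ℝ^d)` of complex-valued functions. -/
abbrev L2 (d : ℕ) : Type := Lp ℂ 2 (volume : Measure (Position d))

section

variable {d : ℕ}

/-- The phase space point `(q, p)`. -/
def phasePt (q p : Position d) : Phase d := WithLp.toLp 2 (Sum.elim q.ofLp p.ofLp)

/-- Smooth functions of subquadratic growth: all partial derivatives of order at least two
are bounded. -/
structure IsSmoothSubquadratic (b : Phase d → ℝ) : Prop where
  smooth : ContDiff ℝ ∞ b
  bounded : ∀ n : ℕ, 2 ≤ n → ∃ C : ℝ, ∀ z, ‖iteratedFDeriv ℝ n b z‖ ≤ C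

/-- The Weyl quantization of a symbol `a`, applied to `ψ`,
`(2πε)^{-d} ∫ (∫ a((q+y)/2, p) e^{i(q-y)·p/ε} ψ(y) dy) dp`.
If `a` is a Schwartz function and `ψ` is in `L²`, the double integral converges absolutely, so the
order of integration is immaterial. If `a` is smooth with polynomially bounded
derivatives and `ψ` is a Schwartz function, the inner integral converges absolutely and is rapidly
decreasing in `p`, and this is the usual value of the oscillatory integral. -/
def opWeyl (ε : ℝ) (a : Phase d → ℝ) (ψ : Position d → ℂ) : Position d → ℂ := fun q =>
  (((2 * Real.pi * ε) ^ d)⁻¹ : ℝ) *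
    ∫ p : Position d, ∫ y : Position d,
      (a (phasePt ((1 / 2 : ℝ) • (q + y)) p) : ℂ) *
        Complex.exp (Complex.I * ((⟪q - y, p⟫_ℝ / ε : ℝ) : ℂ)) * ψ y

/-- The centred phase space Gaussian `G_{ε/2}` with covariance `(ε/2) Id`. -/
def phaseGaussian (ε : ℝ) : Phase d → ℝ := fun z =>
  ((Real.pi * ε) ^ d)⁻¹ * Real.exp (-‖z‖ ^ 2 / ε)

/-- The Anti-Wick quantization: the Weyl quantization of the convolution `a * G_{ε/2}`. -/
def opAntiWick (ε : ℝ) (a : Phase d → ℝ) (ψ : Position d → ℂ) : Position d → ℂ :=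
  opWeyl ε (MeasureTheory.convolution a (phaseGaussian ε) (ContinuousLinearMap.mul ℝ ℝ) volume) ψ

/-- `(i/ε)[P, Q]` for two operators `P`, `Q` acting on functions. -/
def scaledCommutator (ε : ℝ) (P Q : (Position d → ℂ) → (Position d → ℂ))
    (ψ : Position d → ℂ) : Position d → ℂ := fun q =>
  (Complex.I / (ε : ℂ)) * (P (Q ψ) q - Q (P ψ) q)

/-- The matrix `J = (0, Id; -Id, 0)`. -/
def symplJ (d : ℕ) : Matrix (Fin d ⊕ Fin d) (Fin d ⊕ Fin d) ℝ := Matrix.fromBlocks 0 1 (-1) 0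

/-- The Poisson bracket `{a, b} = J∇a · ∇b`. -/
def poisson (a b : Phase d → ℝ) : Phase d → ℝ := fun z =>
  dotProduct ((symplJ d).mulVec (∇ a z).ofLp) (∇ b z).ofLp

/-- The Hessian matrix `D²a(z)`. -/
def hessian (a : Phase d → ℝ) (z : Phase d) : Matrix (Fin d ⊕ Fin d) (Fin d ⊕ Fin d) ℝ :=
  Matrix.of fun j k => iteratedFDeriv ℝ 2 a z
    ![EuclideanSpace.single j (1 : ℝ), EuclideanSpace.single k (1 : ℝ)]

/-- The symbol `{b - (ε/4)Δb, c} - (ε/2) tr(J D²b D²c)`. -/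
def correctedBracket (ε : ℝ) (b c : Phase d → ℝ) : Phase d → ℝ := fun z =>
  poisson (fun w => b w - ε / 4 * Laplacian.laplacian b w) c z
    - ε / 2 * (symplJ d * hessian b z * hessian c z).trace

/-- The operator `Q` maps the Schwartz space `𝓢(ℝ^d)` into itself. -/
def MapsSchwartz (Q : (Position d → ℂ) → (Position d → ℂ)) : Prop :=
  ∀ ψ : 𝓢(Position d, ℂ), ∃ φ : 𝓢(Position d, ℂ), ∀ q, φ q = Q ψ q

/-- An unbounded operator is essentially self-adjoint if it is densely defined and closable with
self-adjoint closure. -/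
def IsEssentiallySelfAdjoint {H : Type*} [NormedAddCommGroup H] [InnerProductSpace ℂ H]
    [CompleteSpace H] (T : H →ₗ.[ℂ] H) : Prop :=
  Dense (T.domain : Set H) ∧ T.IsClosable ∧ IsSelfAdjoint T.closure

/-- The Schwartz space, as a subspace of `L²(ℝ^d)`. -/
def schwartzInL2 (d : ℕ) : Submodule ℂ (L2 d) :=
  LinearMap.range (SchwartzMap.toLpCLM (E := Position d) ℂ ℂ 2 volume).toLinearMap

/-- `Q` with domain `𝓢(ℝ^d)` is an essentially self-adjoint operator in `L²(ℝ^d)`. -/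
def IsEssSelfAdjointOnSchwartz (Q : (Position d → ℂ) → (Position d → ℂ)) : Prop :=
  ∃ T : L2 d →ₗ.[ℂ] L2 d, T.domain = schwartzInL2 d ∧
    (∀ (ψ : 𝓢(Position d, ℂ)) (h : ψ.toLp 2 volume ∈ T.domain),
      (T ⟨ψ.toLp 2 volume, h⟩ : Position d → ℂ) =ᵐ[volume] Q ψ) ∧
    IsEssentiallySelfAdjoint T

/-- `Q` is a bounded operator on `L²(ℝ^d)` with `‖Q‖ ≤ M`. -/
def IsL2BoundedBy (Q : (Position d → ℂ) → (Position d → ℂ)) (M : ℝ) : Prop :=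
  ∃ T : L2 d →L[ℂ] L2 d, (∀ ψ : L2 d, (T ψ : Position d → ℂ) =ᵐ[volume] Q ψ) ∧ ‖T‖ ≤ M

end

end

/-! Put h = 2πε. The Weyl quantization of the character exp(2πi ζ·z) is the phase space translation
`opTrans`. Composing op(b) with it on the right or on the left multiplies b by the character and
shifts its argument by -(h/2)Jζ or +(h/2)Jζ; these are exact identities (`opC_opTrans`,
`opTrans_opC`). Since op(f) is a superposition of translations whose density is the Fourier
transform f̂, the operator (i/ε)[op(b), op(f)] is the Weyl quantization of (i/ε) ∫ exp(2πi ζ·z)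
f̂(ζ) (b(z - πεJζ) - b(z + πεJζ)) dζ (`opC_comp_left`, `opC_comp_right`, `opC_commSymbol`). This
symbol is Schwartz and real, so the commutator extends to a bounded self-adjoint operator, and the
restriction of such an operator to a dense subspace is essentially self-adjoint.

In the Taylor expansion of the difference of the two values of b, the orders zero and two cancel,
order one produces {b,f}, and order three contributes ε² times an integral controlled by the bounded
derivative D³b (`commSymbol_eq`). For the Anti-Wick operator, f is a Gaussian average of c, so f = c
+ (ε/4)Δc + O(ε²). Compare {b,f} with the Gaussian average of a candidate symbol {b,c} - εE: the
terms of order ε agree exactly when E = (Δ{b,c} - {b,Δc})/4, and the Leibniz rule `lap_poisson`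
rewrites this as {Δb,c}/4 + tr(J D²b D²c)/2 (`correctedBracket_eq`, `poisson_heat`).

The bound uniform in ε rests on Schur's test for the integral kernel. It controls the operator norm
by d+1 derivatives of the symbol with decay of order d+1, and the constant depends neither on h nor
on a dilation of the symbol (`weyl_L2_bound`). For ε ≤ 1 the remainder symbols are bounded in the
Schwartz space (`schwartzB_commRem`). For ε ≥ 1 no expansion is used: after rescaling phase space by
√ε, each term of the remainder is bounded on its own (`symB_commRem_dilated`).

The oscillatory integrals are controlled by the exchange of smoothness and decay under a partial
Fourier transform (`pft_symB`). Fubini's theorem is applied in the momentum variable only after the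
position integral has produced decay (`oscillatory_integral_swap`). -/

noncomputable section

set_option linter.unusedSectionVars false

/-! ### Polynomial weights and symbol classes with uniform bounds over families -/

section SymbolClasses

/-- The weight `(1 + ‖x‖)^m`. -/
def jb {X : Type} [NormedAddCommGroup X] (m : ℤ) (x : X) : ℝ := (1 + ‖x‖) ^ m

section Weights

variable {X : Type} [NormedAddCommGroup X]

lemma jb_pos (m : ℤ) (x : X) : 0 < jb m x := by unfold jb; positivity

lemma jb_nonneg (m : ℤ) (x : X) : 0 ≤ jb m x := (jb_pos m x).le

lemma jb_zero (x : X) : jb 0 x = 1 := by simp [jb]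

lemma jb_add (m k : ℤ) (x : X) : jb (m + k) x = jb m x * jb k x := by
  unfold jb; exact zpow_add₀ (by positivity) _ _

lemma jb_mono {m k : ℤ} (h : m ≤ k) (x : X) : jb m x ≤ jb k x :=
  zpow_le_zpow_right₀ (by linarith [norm_nonneg x]) h

lemma one_le_jb {m : ℤ} (h : 0 ≤ m) (x : X) : 1 ≤ jb m x := by
  rw [← jb_zero x]; exact jb_mono h x

lemma jb_neg (m : ℤ) (x : X) : jb (-m) x = (jb m x)⁻¹ := by simp [jb]

lemma jb_natCast (m : ℕ) (x : X) : jb (m : ℤ) x = (1 + ‖x‖) ^ m := by simp [jb]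

lemma norm_pow_le_jb (m : ℕ) (x : X) : ‖x‖ ^ m ≤ jb (m : ℤ) x := by
  rw [jb_natCast]; gcongr; linarith

lemma continuous_jb (m : ℤ) : Continuous (jb m : X → ℝ) := by
  unfold jb
  exact Continuous.zpow₀ (by fun_prop) m fun x => Or.inl (by positivity)

lemma jb_le_of_norm_le {Y : Type} [NormedAddCommGroup Y] {m : ℤ} (hm : 0 ≤ m) {x : X} {y : Y}
    (h : ‖x‖ ≤ ‖y‖) : jb m x ≤ jb m y := by
  unfold jb
  exact zpow_le_zpow_left₀ hm (by positivity) (by linarith)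

lemma jb_comp_le {Y : Type} [NormedAddCommGroup Y] {m : ℤ} (hm : 0 ≤ m) {x : X} {y : Y} {K : ℝ}
    (h : 1 + ‖x‖ ≤ K * (1 + ‖y‖)) : jb m x ≤ K ^ m * jb m y := by
  unfold jb
  rw [← mul_zpow]
  exact zpow_le_zpow_left₀ hm (by positivity) h

lemma jb_add_le_mul {m : ℤ} (hm : 0 ≤ m) (x y : X) : jb m (x + y) ≤ jb m x * jb m y := by
  unfold jb
  rw [← mul_zpow]
  refine zpow_le_zpow_left₀ hm (by positivity) ?_
  nlinarith [norm_add_le x y, norm_nonneg x, norm_nonneg y,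
    mul_nonneg (norm_nonneg x) (norm_nonneg y)]

/-- Weights are positive, so inequalities can be inverted. Estimates for decay thus reduce to
estimates for growth. -/
lemma jb_neg_le {m : ℤ} (x : X) {Y : Type} [NormedAddCommGroup Y] {y : Y} {K : ℝ}
    (h : jb m x ≤ K * jb m y) : jb (-m) y ≤ K * jb (-m) x := by
  rw [jb_neg, jb_neg, ← div_eq_mul_inv, inv_eq_one_div, div_le_div_iff₀ (jb_pos _ _) (jb_pos _ _)]
  linarith

/-- Peetre's inequality: write x = (x + y) - y, use submultiplicativity of the growing weight, and
invert. -/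
lemma jb_neg_add_le {m : ℤ} (hm : 0 ≤ m) (x y : X) : jb (-m) (x + y) ≤ jb (-m) x * jb m y := by
  have h := jb_add_le_mul hm (x + y) (-y)
  simp only [add_neg_cancel_right] at h
  have h2 : jb m (-y) = jb m y := by simp [jb]
  rw [h2, mul_comm] at h
  rw [mul_comm]
  exact jb_neg_le x h

lemma integrable_jb [NormedSpace ℝ X] [FiniteDimensional ℝ X] [MeasurableSpace X] [BorelSpace X]
    {μ : Measure X} [μ.IsAddHaarMeasure] {m : ℤ} (hm : (Module.finrank ℝ X : ℤ) < m) :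
    Integrable (fun x : X => jb (-m) x) μ := by
  have := integrable_one_add_norm (E := X) (μ := μ) (r := (m : ℝ)) (by exact_mod_cast hm)
  refine this.congr (Filter.Eventually.of_forall fun x => ?_)
  simp only [jb]
  rw [← Real.rpow_intCast]
  simp

end Weights

variable {ι : Type} {X Y E F G : Type}
  [NormedAddCommGroup X] [NormedSpace ℝ X] [NormedAddCommGroup Y] [NormedSpace ℝ Y]
  [NormedAddCommGroup E] [NormedSpace ℝ E] [NormedAddCommGroup F] [NormedSpace ℝ F]
  [NormedAddCommGroup G] [NormedSpace ℝ G]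

/-- A family of `C^n` functions whose derivatives up to order `n` are bounded by a multiple of the
weight `w`, uniformly over the family. -/
def SymB (n : ℕ) (w : X → ℝ) (f : ι → X → E) : Prop :=
  (∀ i, ContDiff ℝ n (f i)) ∧
    ∃ C, 0 ≤ C ∧ ∀ i, ∀ k ≤ n, ∀ x, ‖iteratedFDeriv ℝ k (f i) x‖ ≤ C * w x

namespace SymB

variable {n : ℕ} {w w' : X → ℝ} {f g : ι → X → E}

lemma mono (hf : SymB n w f) {K : ℝ} (hK : 0 ≤ K) (hw : ∀ x, w x ≤ K * w' x) : SymB n w' f := by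
  obtain ⟨h1, C, hC, h2⟩ := hf
  refine ⟨h1, C * K, by positivity, fun i k hk x => (h2 i k hk x).trans ?_⟩
  rw [mul_assoc]
  exact mul_le_mul_of_nonneg_left (hw x) hC

lemma mono' (hf : SymB n w f) (hw : ∀ x, w x ≤ w' x) : SymB n w' f :=
  hf.mono zero_le_one (by simpa using hw)

lemma of_le (hf : SymB n w f) {m : ℕ} (h : m ≤ n) : SymB m w f := by
  obtain ⟨h1, C, hC, h2⟩ := hf
  exact ⟨fun i => (h1 i).of_le (by exact_mod_cast h), C, hC, fun i k hk x => h2 i k (hk.trans h) x⟩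

lemma bound (hf : SymB n w f) : ∃ C, 0 ≤ C ∧ ∀ i x, ‖f i x‖ ≤ C * w x := by
  obtain ⟨_, C, hC, h2⟩ := hf
  exact ⟨C, hC, fun i x => by simpa using h2 i 0 (Nat.zero_le _) x⟩

lemma reindex (hf : SymB n w f) {κ : Type} (σ : κ → ι) : SymB n w (fun j => f (σ j)) := by
  obtain ⟨h1, C, hC, h2⟩ := hf
  exact ⟨fun i => h1 _, C, hC, fun i => h2 _⟩

lemma fderiv (hf : SymB (n + 1) w f) : SymB n w (fun i => fderiv ℝ (f i)) := by
  obtain ⟨h1, C, hC, h2⟩ := hf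
  refine ⟨fun i => (h1 i).fderiv_right (m := n) (by norm_cast), C, hC, fun i k hk x => ?_⟩
  rw [norm_iteratedFDeriv_fderiv]
  exact h2 i (k + 1) (by omega) x

/-- The induction step for regularity: once a derivative is identified as an object of the same
kind, a bound of order zero propagates to every order. -/
lemma of_fderiv (h0 : SymB 0 w f) (hd : ∀ i, Differentiable ℝ (f i))
    (hf : SymB n w (fun i => _root_.fderiv ℝ (f i))) : SymB (n + 1) w f := by
  obtain ⟨C0, hC0, h0⟩ := h0.bound
  obtain ⟨h1, C, hC, h2⟩ := hf
  refine ⟨fun i => ?_, max C0 C, by positivity, fun i k hk x => ?_⟩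
  · have := (contDiff_succ_iff_fderiv (𝕜 := ℝ) (f := f i) (n := n)).2
      ⟨hd i, by simp, h1 i⟩
    exact_mod_cast this
  -- The weight has no prescribed sign. Where it is negative, nonnegativity of norms forces `C0` and
  -- `C` to vanish, so passing to the maximum is harmless there too.
  · have hw : ∀ D, 0 ≤ D → ∀ t, 0 ≤ t → t ≤ D * w x → D ≤ max C0 C → t ≤ max C0 C * w x := by
      intro D hD t ht h h'
      rcases le_or_gt 0 (w x) with h3 | h3
      · exact h.trans (mul_le_mul_of_nonneg_right h' h3)
      · have : D * w x ≤ 0 := mul_nonpos_of_nonneg_of_nonpos hD h3.le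
        have ht0 : D * w x = 0 := le_antisymm this (ht.trans h)
        rcases mul_eq_zero.1 ht0 with h4 | h4
        · have a1 := h0 i x
          have a2 := h2 i 0 (by omega) x
          have b1 : 0 ≤ C0 * w x := (norm_nonneg _).trans a1
          have b2 : 0 ≤ C * w x := (norm_nonneg _).trans a2
          have c1 : C0 = 0 := by nlinarith
          have c2 : C = 0 := by nlinarith
          simp [c1, c2]; nlinarith
        · exact absurd h4 h3.ne
    cases k with
    | zero => exact hw C0 hC0 _ (norm_nonneg _) (by simpa using h0 i x) (le_max_left _ _)
    | succ k =>
      rw [← norm_iteratedFDeriv_fderiv]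
      exact hw C hC _ (norm_nonneg _) (h2 i k (by omega) x) (le_max_right _ _)

lemma of_bound (hc : ∀ i, Continuous (f i)) (C : ℝ) (hC : 0 ≤ C)
    (h : ∀ i x, ‖f i x‖ ≤ C * w x) : SymB 0 w f := by
  refine ⟨fun i => by simpa using (contDiff_zero (𝕜 := ℝ)).2 (hc i), C, hC, fun i k hk x => ?_⟩
  obtain rfl : k = 0 := by omega
  simpa using h i x

lemma add (hf : SymB n w f) (hg : SymB n w g) : SymB n w (fun i x => f i x + g i x) := by
  obtain ⟨h1, C, hC, h2⟩ := hf
  obtain ⟨h1', C', hC', h2'⟩ := hg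
  refine ⟨fun i => (h1 i).add (h1' i), C + C', by positivity, fun i k hk x => ?_⟩
  have hk' : ((k : ℕ) : WithTop ℕ∞) ≤ n := by exact_mod_cast hk
  have : iteratedFDeriv ℝ k (fun x => f i x + g i x) x =
      iteratedFDeriv ℝ k (f i) x + iteratedFDeriv ℝ k (g i) x :=
    iteratedFDeriv_add_apply ((h1 i).of_le hk').contDiffAt ((h1' i).of_le hk').contDiffAt
  rw [this, add_mul]
  exact (norm_add_le _ _).trans (add_le_add (h2 i k hk x) (h2' i k hk x))

lemma clm (hf : SymB n w f) (L : ι → E →L[ℝ] F) {K : ℝ} (hK : 0 ≤ K) (hL : ∀ i, ‖L i‖ ≤ K) :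
    SymB n w (fun i x => L i (f i x)) := by
  obtain ⟨h1, C, hC, h2⟩ := hf
  refine ⟨fun i => (L i).contDiff.comp (h1 i), K * C, by positivity, fun i k hk x => ?_⟩
  have hk' : ((k : ℕ) : WithTop ℕ∞) ≤ n := by exact_mod_cast hk
  have := (L i).norm_iteratedFDeriv_comp_left (x := x) (h1 i).contDiffAt hk'
  refine this.trans ?_
  rw [mul_assoc]
  exact mul_le_mul (hL i) (h2 i k hk x) (norm_nonneg _) hK

lemma clm_const (hf : SymB n w f) (L : E →L[ℝ] F) : SymB n w (fun i x => L (f i x)) :=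
  hf.clm (fun _ => L) (norm_nonneg L) fun _ => le_rfl

lemma const_smul (hf : SymB n w f) (c : ι → ℝ) {K : ℝ} (hK : 0 ≤ K) (hc : ∀ i, |c i| ≤ K) :
    SymB n w (fun i x => c i • f i x) := by
  refine hf.clm (fun i => c i • ContinuousLinearMap.id ℝ E) hK fun i => ?_
  refine (norm_smul_le (c i) (ContinuousLinearMap.id ℝ E)).trans ?_
  have := ContinuousLinearMap.norm_id_le (𝕜 := ℝ) (E := E)
  calc ‖c i‖ * ‖ContinuousLinearMap.id ℝ E‖ ≤ K * 1 := by
        gcongr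
        exact hc i
    _ = K := mul_one K

lemma neg (hf : SymB n w f) : SymB n w (fun i x => - f i x) := by
  simpa using hf.const_smul (fun _ => -1) zero_le_one (by simp)

lemma sub (hf : SymB n w f) (hg : SymB n w g) : SymB n w (fun i x => f i x - g i x) := by
  simpa [sub_eq_add_neg] using hf.add hg.neg

lemma zero : SymB n w (fun (_ : ι) (_ : X) => (0 : E)) :=
  ⟨fun _ => contDiff_const, 0, le_rfl, fun i k hk x => by
    have : iteratedFDeriv ℝ k (fun _ : X => (0 : E)) = 0 := iteratedFDeriv_fun_zero
    simp [this]⟩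

lemma sum {κ : Type} (s : Finset κ) {f : κ → ι → X → E}
    (hf : ∀ j ∈ s, SymB n w (f j)) : SymB n w (fun i x => ∑ j ∈ s, f j i x) := by
  classical
  induction s using Finset.induction_on with
  | empty => simpa using zero
  | insert a s ha ih =>
    simp only [Finset.sum_insert ha]
    exact (hf a (by simp)).add (ih fun j hj => hf j (by simp [hj]))

/-- Leibniz rule. The binomial coefficients add up to at most `2 ^ n`. -/
lemma bilin (B : E →L[ℝ] F →L[ℝ] G) {f : ι → X → E} {g : ι → X → F} {w w' : X → ℝ}
    (hf : SymB n w f) (hg : SymB n w' g) : SymB n (fun x => w x * w' x)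
      (fun i x => B (f i x) (g i x)) := by
  obtain ⟨h1, C, hC, h2⟩ := hf
  obtain ⟨h1', C', hC', h2'⟩ := hg
  refine ⟨fun i => B.isBoundedBilinearMap.contDiff.comp ((h1 i).prodMk (h1' i)),
    ‖B‖ * (2 ^ n * (C * C')), by positivity, fun i k hk x => ?_⟩
  have hk' : ((k : ℕ) : WithTop ℕ∞) ≤ n := by exact_mod_cast hk
  refine (B.norm_iteratedFDeriv_le_of_bilinear (h1 i) (h1' i) x hk').trans ?_
  rw [mul_assoc, mul_assoc]
  refine mul_le_mul_of_nonneg_left ?_ (norm_nonneg B)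
  have hc : 0 ≤ C * w x := (norm_nonneg _).trans (h2 i 0 (by omega) x)
  have hc' : 0 ≤ C' * w' x := (norm_nonneg _).trans (h2' i 0 (by omega) x)
  calc _ ≤ ∑ j ∈ Finset.range (k + 1), (k.choose j : ℝ) * ((C * w x) * (C' * w' x)) := by
        refine Finset.sum_le_sum fun j hj => ?_
        rw [mul_assoc]
        gcongr
        · exact h2 i j (by simp at hj; omega) x
        · exact h2' i (k - j) (by omega) x
    _ = 2 ^ k * ((C * w x) * (C' * w' x)) := by
        rw [← Finset.sum_mul]; norm_cast; rw [Nat.sum_range_choose]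
    _ ≤ 2 ^ n * ((C * w x) * (C' * w' x)) := by
        gcongr; norm_num
    _ = _ := by ring

/-- Chain rule for affine substitutions. Translations leave derivatives unchanged and the linear
part costs a power of its norm, so only a uniform bound on that norm and the comparison of weights
are needed. -/
lemma comp_affine {f : ι → X → E} {w : X → ℝ} {w' : Y → ℝ} (hf : SymB n w f)
    (L : ι → Y →L[ℝ] X) (c : ι → X) {K : ℝ} (hL : ∀ i, ‖L i‖ ≤ K) {K' : ℝ} (hK' : 0 ≤ K')
    (hw : ∀ i y, w (L i y + c i) ≤ K' * w' y) :
    SymB n w' (fun i y => f i (L i y + c i)) := by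
  obtain ⟨h1, C, hC, h2⟩ := hf
  refine ⟨fun i => (h1 i).comp ((L i).contDiff.add contDiff_const),
    max 1 K ^ n * (C * K'), by positivity, fun i k hk y => ?_⟩
  have hk' : ((k : ℕ) : WithTop ℕ∞) ≤ n := by exact_mod_cast hk
  have hsm : ContDiff ℝ n (fun x => f i (x + c i)) := (h1 i).comp (contDiff_id.add contDiff_const)
  have e1 := (L i).iteratedFDeriv_comp_right hsm y hk'
  have e2 : (fun y => f i (L i y + c i)) = (fun x => f i (x + c i)) ∘ (L i) := rfl
  change ‖iteratedFDeriv ℝ k (fun y => f i (L i y + c i)) y‖ ≤ _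
  rw [e2, e1]
  refine (ContinuousMultilinearMap.norm_compContinuousLinearMap_le _ _).trans ?_
  rw [iteratedFDeriv_comp_add_right]
  simp only [Finset.prod_const, Finset.card_univ, Fintype.card_fin]
  have hb := h2 i k hk (L i y + c i)
  have h3 : 0 ≤ C * (K' * w' y) :=
    ((norm_nonneg _).trans hb).trans (mul_le_mul_of_nonneg_left (hw i y) hC)
  calc _ ≤ (C * (K' * w' y)) * max 1 K ^ k := by
        gcongr
        · exact hb.trans (mul_le_mul_of_nonneg_left (hw i y) hC)
        · exact (hL i).trans (le_max_right _ _)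
    _ ≤ (C * (K' * w' y)) * max 1 K ^ n := by
        gcongr
        exact le_max_left _ _
    _ = _ := by ring

lemma const {c : ι → E} {K : ℝ} (hK : 0 ≤ K) (hc : ∀ i, ‖c i‖ ≤ K) :
    SymB n (fun _ : X => (1 : ℝ)) (fun i (_ : X) => c i) := by
  refine ⟨fun _ => contDiff_const, K, hK, fun i k hk x => ?_⟩
  cases k with
  | zero => simpa using hc i
  | succ k => 
    have : iteratedFDeriv ℝ (k + 1) (fun _ : X => c i) = 0 :=
      iteratedFDeriv_const_of_ne (by omega) _
    rw [this]; simpa using hK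

lemma linear (L : ι → X →L[ℝ] E) {K : ℝ} (hK : 0 ≤ K) (hL : ∀ i, ‖L i‖ ≤ K) :
    SymB n (jb 1) (fun i x => L i x) := by
  have h0 : SymB 0 (jb 1) (fun i x => L i x) := by
    refine of_bound (fun i => (L i).continuous) K hK fun i x => ?_
    refine ((L i).le_opNorm x).trans ?_
    have := hL i
    have h : ‖x‖ ≤ jb 1 x := by simpa using norm_pow_le_jb 1 x
    gcongr
  cases n with
  | zero => exact h0
  | succ n =>
    refine of_fderiv h0 (fun i => (L i).differentiable) ?_
    have : (fun i => _root_.fderiv ℝ (fun x => L i x)) = fun i _ => L i := by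
      ext1 i; ext1 x; exact (L i).fderiv
    rw [this]
    exact (const hK hL).mono' fun x => one_le_jb (by norm_num) x

end SymB

/-- A smooth function all of whose derivatives are bounded by multiples of `(1 + ‖x‖)^m`. -/
def OfOrder (m : ℤ) (f : ι → X → E) : Prop := ∀ n, SymB n (jb m) f

/-- A family of functions that is bounded in the Schwartz space. -/
def SchwartzB (f : ι → X → E) : Prop := ∀ m : ℤ, OfOrder m f

lemma SchwartzB.of_neg {f : ι → X → E} (h : ∀ m n : ℕ, SymB n (jb (-(m : ℤ))) f) :
    SchwartzB f := fun m n =>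
  (h m.natAbs n).mono' fun x => jb_mono (by omega) x

lemma schwartzB_coe (f : 𝓢(X, E)) : SchwartzB (fun (_ : ι) => (f : X → E)) := by
  refine SchwartzB.of_neg fun m n => ⟨fun i => f.smooth n, ?_⟩
  refine ⟨2 ^ m * (Finset.Iic (m, n)).sup (fun m => SchwartzMap.seminorm ℝ m.1 m.2) f,
    by positivity, fun i k hk x => ?_⟩
  have := SchwartzMap.one_add_le_sup_seminorm_apply (𝕜 := ℝ) (m := (m, n)) (k := m) (n := k)
    le_rfl hk f x
  rw [jb_neg, ← div_eq_mul_inv, le_div_iff₀ (jb_pos _ _), jb_natCast, mul_comm]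
  exact this

/-- The Schwartz function with a given underlying function. -/
def SchwartzB.toSchwartz {f : X → E} (h : SchwartzB (fun (_ : Unit) => f)) : 𝓢(X, E) where
  toFun := f
  smooth' := contDiff_infty.2 fun n => (h 0 n).1 ()
  decay' := fun k n => by
    obtain ⟨_, C, hC, h2⟩ := h (-(k : ℤ)) n
    refine ⟨C, fun x => ?_⟩
    have := h2 () n le_rfl x
    rw [jb_neg, ← div_eq_mul_inv, le_div_iff₀ (jb_pos _ _)] at this
    have h3 := norm_pow_le_jb k x
    calc _ ≤ jb (k : ℤ) x * ‖iteratedFDeriv ℝ n f x‖ := by gcongr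
      _ ≤ C := by linarith

lemma SchwartzB.reindex {f : ι → X → E} (hf : SchwartzB f) {κ : Type} (σ : κ → ι) :
    SchwartzB (fun j => f (σ j)) := fun m n => (hf m n).reindex σ

lemma OfOrder.bilin (B : E →L[ℝ] F →L[ℝ] G) {f : ι → X → E} {g : ι → X → F} {m k : ℤ}
    (hf : OfOrder m f) (hg : OfOrder k g) : OfOrder (m + k) (fun i x => B (f i x) (g i x)) :=
  fun n => ((hf n).bilin B (hg n)).mono' fun x => (jb_add m k x).ge

/-- The growth of the first factor is paid for by using the order `k - m` of the rapidly decreasing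
one. -/
lemma SchwartzB.bilin (B : E →L[ℝ] F →L[ℝ] G) {f : ι → X → E} {g : ι → X → F} {m : ℤ}
    (hf : OfOrder m f) (hg : SchwartzB g) : SchwartzB (fun i x => B (f i x) (g i x)) :=
  fun k => by simpa using hf.bilin B (hg (k - m))

end SymbolClasses

/-! ### Partial Fourier transforms: exchanging smoothness and decay -/

section PartialFourier

open scoped FourierTransform

variable {ι : Type} {X Y E : Type}
  [NormedAddCommGroup X] [NormedSpace ℝ X]
  [NormedAddCommGroup Y] [InnerProductSpace ℝ Y] [FiniteDimensional ℝ Y] [MeasurableSpace Y]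
  [BorelSpace Y]
  [NormedAddCommGroup E] [NormedSpace ℂ E]

lemma norm_iteratedFDeriv_mk_right_le {Y E : Type} [NormedAddCommGroup Y] [NormedSpace ℝ Y]
    [NormedAddCommGroup E] [NormedSpace ℝ E] {n k : ℕ} {f : X × Y → E} (hf : ContDiff ℝ n f)
    (hk : k ≤ n) (x : X) (y : Y) :
    ‖iteratedFDeriv ℝ k (fun y => f (x, y)) y‖ ≤ ‖iteratedFDeriv ℝ k f (x, y)‖ := by
  have hk' : ((k : ℕ) : WithTop ℕ∞) ≤ n := by exact_mod_cast hk
  have hsm : ContDiff ℝ n (fun p => f (p + (x, 0))) :=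
    hf.comp (contDiff_id.add contDiff_const)
  have e1 := (ContinuousLinearMap.inr ℝ X Y).iteratedFDeriv_comp_right hsm y hk'
  have e2 : (fun y => f (x, y)) = (fun p => f (p + (x, 0))) ∘ (ContinuousLinearMap.inr ℝ X Y) := by
    ext y; simp
  rw [e2, e1, iteratedFDeriv_comp_add_right]
  refine (ContinuousMultilinearMap.norm_compContinuousLinearMap_le _ _).trans ?_
  simp only [Finset.prod_const, Finset.card_univ, Fintype.card_fin,
    ContinuousLinearMap.inr_apply, Prod.mk_add_mk, zero_add, add_zero]
  refine mul_le_of_le_one_right (norm_nonneg _) (pow_le_one₀ (norm_nonneg _) ?_)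
  exact ContinuousLinearMap.norm_inr_le_one _ _ _

/-- The Fourier transform in the second variable. -/
def pft (f : X × Y → E) (p : X × Y) : E := 𝓕 (fun y => f (p.1, y)) p.2

/-- The function whose partial Fourier transform is the derivative of the partial Fourier
transform of `f`. -/
def pftDeriv (f : X × Y → E) (p : X × Y) : X × Y →L[ℝ] E :=
  (fderiv ℝ f p).comp ((ContinuousLinearMap.inl ℝ X Y).comp (ContinuousLinearMap.fst ℝ X Y)) +
    ((innerSL ℝ p.2).comp (ContinuousLinearMap.snd ℝ X Y)).smulRight
      ((-(2 * Real.pi * Complex.I) : ℂ) • f p)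

lemma pft_apply (f : X × Y → E) (p : X × Y) :
    pft f p = ∫ y, ((Real.fourierChar (-⟪y, p.2⟫_ℝ) : Circle) : ℂ) • f (p.1, y) := by
  rw [pft, Real.fourier_eq]
  rfl

lemma continuous_pft {f : X × Y → E} (hf : Continuous f) {w : X → ℝ} (hw : Continuous w)
    {μ : Y → ℝ} (hμ : Integrable μ) (h : ∀ x y, ‖f (x, y)‖ ≤ w x * μ y) :
    Continuous (pft f) := by
  have e : pft f = fun p => ∫ y, ((Real.fourierChar (-⟪y, p.2⟫_ℝ) : Circle) : ℂ) • f (p.1, y) :=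
    funext (pft_apply f)
  rw [e]
  refine continuous_iff_continuousAt.2 fun p => ?_
  refine continuousAt_of_dominated (bound := fun y => (|w p.1| + 1) * |μ y|) ?_ ?_ ?_ ?_
  · exact Filter.Eventually.of_forall fun q => by
      refine Continuous.aestronglyMeasurable ?_
      have := Real.continuous_fourierChar
      fun_prop
  · have : ∀ᶠ q : X × Y in nhds p, |w q.1| < |w p.1| + 1 :=
      (hw.comp continuous_fst).abs.continuousAt.eventually_lt continuousAt_const
        (lt_add_one _)
    filter_upwards [this] with q hq
    refine Filter.Eventually.of_forall fun y => ?_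
    rw [norm_smul, Circle.norm_coe, one_mul]
    refine (h _ _).trans ((le_abs_self _).trans ?_)
    rw [abs_mul]
    gcongr
  · exact hμ.abs.const_mul _
  · refine Filter.Eventually.of_forall fun y => Continuous.continuousAt ?_
    have := Real.continuous_fourierChar
    fun_prop

/-- Differentiation in the parameter passes to `f`; differentiation in the frequency brings down a
factor -2πi y. That factor costs one power of decay, hence the exponent `m + 1`. -/
lemma hasFDerivAt_pft {f : X × Y → E} (hf : ContDiff ℝ 1 f) {w : X → ℝ} (hw : Continuous w)
    {m : ℤ} (hm : (Module.finrank ℝ Y : ℤ) < m) (h0 : ∀ p, ‖f p‖ ≤ w p.1 * jb (-(m + 1)) p.2)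
    (h1 : ∀ p, ‖fderiv ℝ f p‖ ≤ w p.1 * jb (-(m + 1)) p.2) (p : X × Y) :
    HasFDerivAt (pft f) (pft (pftDeriv f) p) p := by
  have e : pft f = fun p => ∫ y, ((Real.fourierChar (-⟪y, p.2⟫_ℝ) : Circle) : ℂ) • f (p.1, y) :=
    funext (pft_apply f)
  have hc := Real.continuous_fourierChar
  have hf0 := hf.continuous
  have hf1 := hf.continuous_fderiv one_ne_zero
  have hw0 : ∀ x, 0 ≤ w x := fun x => by
    have := (norm_nonneg _).trans (h0 (x, 0))
    exact nonneg_of_mul_nonneg_left this (jb_pos _ _)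
  have hder : Continuous (pftDeriv f) := by
    have a : Continuous fun p : X × Y => (fderiv ℝ f p).comp
        ((ContinuousLinearMap.inl ℝ X Y).comp (ContinuousLinearMap.fst ℝ X Y)) :=
      hf1.clm_comp continuous_const
    have b : Continuous fun p : X × Y => ((innerSL ℝ p.2).comp (ContinuousLinearMap.snd ℝ X Y)) :=
      ((innerSL ℝ).continuous.comp continuous_snd).clm_comp continuous_const
    have c : Continuous fun p : X × Y => ((-(2 * Real.pi * Complex.I) : ℂ) • f p) :=
      hf0.const_smul _
    exact a.add (((ContinuousLinearMap.smulRightL ℝ (X × Y) E).continuous₂).comp (b.prodMk c))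
  have hb : ∀ q : X × Y, ‖pftDeriv f q‖ ≤ (1 + 2 * Real.pi) * (w q.1 * jb (-m) q.2) := by
    intro q
    have hj : jb (-(m + 1)) q.2 * jb 1 q.2 = jb (-m) q.2 := by rw [← jb_add]; congr 1; ring
    rw [pftDeriv, add_mul]
    refine (norm_add_le (_ : X × Y →L[ℝ] E) _).trans ?_
    refine add_le_add ?_ ?_
    · refine (ContinuousLinearMap.opNorm_comp_le _ _).trans ?_
      have h2 : ‖(ContinuousLinearMap.inl ℝ X Y).comp (ContinuousLinearMap.fst ℝ X Y)‖ ≤ 1 := by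
        refine (ContinuousLinearMap.opNorm_comp_le _ _).trans ?_
        exact mul_le_one₀ (ContinuousLinearMap.norm_inl_le_one _ _ _) (norm_nonneg _)
          (ContinuousLinearMap.norm_fst_le _ _ _)
      calc _ ≤ ‖fderiv ℝ f q‖ * 1 := by gcongr
        _ ≤ w q.1 * jb (-(m + 1)) q.2 := by simpa using h1 q
        _ ≤ 1 * (w q.1 * jb (-m) q.2) := by
          rw [one_mul]
          exact mul_le_mul_of_nonneg_left (jb_mono (by omega) _) (hw0 _)
    · rw [ContinuousLinearMap.norm_smulRight_apply, norm_smul]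
      have h2 : ‖(innerSL ℝ q.2).comp (ContinuousLinearMap.snd ℝ X Y)‖ ≤ jb 1 q.2 := by
        refine (ContinuousLinearMap.opNorm_comp_le _ _).trans ?_
        calc _ ≤ ‖innerSL ℝ q.2‖ * 1 := by
              gcongr; exact ContinuousLinearMap.norm_snd_le _ _ _
          _ = ‖q.2‖ := by rw [mul_one, innerSL_apply_norm]
          _ ≤ _ := by simpa using norm_pow_le_jb 1 q.2
      have h3 : ‖(-(2 * Real.pi * Complex.I) : ℂ)‖ = 2 * Real.pi := by
        simp [abs_of_pos Real.pi_pos]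
      rw [h3, ← hj]
      calc _ ≤ jb 1 q.2 * (2 * Real.pi * (w q.1 * jb (-(m + 1)) q.2)) := by
            gcongr
            · exact (jb_pos _ _).le
            · exact h0 q
        _ = _ := by ring
  rw [e, pft_apply]
  have hs : {q : X × Y | w q.1 < w p.1 + 1} ∈ nhds p :=
    (hw.comp continuous_fst).continuousAt.eventually_lt continuousAt_const (lt_add_one _)
  refine hasFDerivAt_integral_of_dominated_of_fderiv_le
    (F := fun q y => ((Real.fourierChar (-⟪y, q.2⟫_ℝ) : Circle) : ℂ) • f (q.1, y))
    (F' := fun q y => ((Real.fourierChar (-⟪y, q.2⟫_ℝ) : Circle) : ℂ) • pftDeriv f (q.1, y))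
    (bound := fun y => (1 + 2 * Real.pi) * ((w p.1 + 1) * jb (-m) y)) hs ?_ ?_ ?_ ?_ ?_ ?_
  · exact Filter.Eventually.of_forall fun q => Continuous.aestronglyMeasurable (by fun_prop)
  · refine Integrable.mono' ((integrable_jb (m := m + 1) (by omega)).const_mul (w p.1))
      (Continuous.aestronglyMeasurable (by fun_prop)) (Filter.Eventually.of_forall fun y => ?_)
    rw [norm_smul, Circle.norm_coe, one_mul]
    exact h0 (p.1, y)
  · exact Continuous.aestronglyMeasurable (by fun_prop)
  · refine Filter.Eventually.of_forall fun y q hq => ?_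
    rw [norm_smul, Circle.norm_coe, one_mul]
    refine (hb (q.1, y)).trans ?_
    have := jb_pos (-m) y
    have : w q.1 ≤ w p.1 + 1 := le_of_lt hq
    have := Real.pi_pos
    gcongr
  · exact ((integrable_jb hm).const_mul _).const_mul _
  · refine Filter.Eventually.of_forall fun y q _ => ?_
    have d1 : HasFDerivAt (fun q : X × Y => ((Real.fourierChar (-⟪y, q.2⟫_ℝ) : Circle) : ℂ))
        _ q := (Real.hasFDerivAt_fourierChar_neg_bilinear_right (innerSL ℝ) y q.2).comp q
          hasFDerivAt_snd
    have d2 : HasFDerivAt (fun q : X × Y => f (q.1, y)) _ q :=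
      ((hf.differentiable one_ne_zero (q.1, y)).hasFDerivAt).comp q
        (hasFDerivAt_fst.prodMk (hasFDerivAt_const y q))
    refine (d1.smul d2).congr_fderiv ?_
    ext v
    · simp [pftDeriv]
    · simp only [innerSL_apply_apply, pftDeriv, RCLike.real_smul_eq_coe_smul (K := ℂ), smul_smul,
        ContinuousLinearMap.comp_apply, add_apply,
        ContinuousLinearMap.smulRight_apply, smul_apply,
        ContinuousLinearMap.inr_apply, ContinuousLinearMap.coe_snd', ContinuousLinearMap.coe_fst',
        ContinuousLinearMap.prod_apply, zero_apply,
        ContinuousLinearMap.inl_apply, Complex.ofRealCLM_apply, smul_add]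
      simp only [map_zero, smul_zero, zero_add, Prod.mk_zero_zero]
      congr 1
      simp only [smul_eq_mul]
      ring_nf
      rfl

lemma pftDeriv_symB {n : ℕ} {w : X → ℝ} {m : ℤ} {f : ι → X × Y → E}
    (hf : SymB (n + 1) (fun p : X × Y => w p.1 * jb (-(m + 1)) p.2) f) (hw : ∀ x, 0 ≤ w x) :
    SymB n (fun p : X × Y => w p.1 * jb (-m) p.2) (fun i => pftDeriv (f i)) := by
  have hj : ∀ y : Y, jb 1 y * jb (-(m + 1)) y = jb (-m) y := fun y => by
    rw [← jb_add]; congr 1; ring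
  have hlin : SymB n (fun p : X × Y => jb 1 p.2) (fun (_ : ι) (p : X × Y) => p.2) := by
    have := (SymB.linear (n := n) (ι := ι) (X := Y) (fun _ => ContinuousLinearMap.id ℝ Y)
      (zero_le_one) (fun _ => ContinuousLinearMap.norm_id_le))
    have h2 := this.comp_affine (Y := X × Y) (fun _ => ContinuousLinearMap.snd ℝ X Y) (fun _ => 0)
      (w' := fun p => jb 1 p.2) (fun _ => ContinuousLinearMap.norm_snd_le _ _ _) zero_le_one
      (by simp)
    simpa using h2
  have h1 : SymB n (fun p : X × Y => w p.1 * jb (-m) p.2) (fun i p => (fderiv ℝ (f i) p).comp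
      ((ContinuousLinearMap.inl ℝ X Y).comp (ContinuousLinearMap.fst ℝ X Y))) := by
    have := hf.fderiv.clm_const ((ContinuousLinearMap.compL ℝ (X × Y) (X × Y) E).flip
      ((ContinuousLinearMap.inl ℝ X Y).comp (ContinuousLinearMap.fst ℝ X Y)))
    refine SymB.mono' this fun p => ?_
    have := jb_mono (show -(m + 1) ≤ -m by omega) p.2
    exact mul_le_mul_of_nonneg_left this (hw _)
  have h2 : SymB n (fun p : X × Y => w p.1 * jb (-m) p.2)
      (fun i p => ((innerSL ℝ p.2).comp (ContinuousLinearMap.snd ℝ X Y)).smulRight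
      ((-(2 * Real.pi * Complex.I) : ℂ) • f i p)) := by
    have a := hlin.clm_const (((ContinuousLinearMap.compL ℝ (X × Y) Y ℝ).flip
      (ContinuousLinearMap.snd ℝ X Y)).comp (innerSL ℝ))
    have b := (hf.of_le (Nat.le_succ n)).clm_const
      (((-(2 * Real.pi * Complex.I) : ℂ) • ContinuousLinearMap.id ℂ E).restrictScalars ℝ)
    refine (a.bilin (ContinuousLinearMap.smulRightL ℝ (X × Y) E) b).mono' fun p => ?_
    rw [← hj]
    exact le_of_eq (by ring)
  exact h1.add h2

/-- Each integrable derivative in `y` gives one power of decay in the frequency. The estimates with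
zero and with `N` derivatives are added to pass from the norm to one plus the norm. -/
lemma pft_bound {N : ℕ} {w : X → ℝ} {m : ℤ} (hm : (Module.finrank ℝ Y : ℤ) < m)
    {f : ι → X × Y → E} (hf : SymB N (fun p : X × Y => w p.1 * jb (-m) p.2) f) :
    ∃ C, 0 ≤ C ∧ ∀ i p, ‖pft (f i) p‖ ≤ C * (w p.1 * jb (-(N : ℤ)) p.2) := by
  obtain ⟨h1, C, hC, h2⟩ := hf
  have hint := integrable_jb (X := Y) (μ := volume) hm
  set I := ∫ y : Y, jb (-m) y with hI
  have hI0 : 0 ≤ I := integral_nonneg fun y => jb_nonneg _ _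
  refine ⟨2 ^ N * (C * I + (2 ^ N * ((N + 1) * (C * I)))), by positivity, fun i p => ?_⟩
  have hsm : ContDiff ℝ N (fun y => f i (p.1, y)) := (h1 i).comp (contDiff_prodMk_right p.1)
  have hle : ∀ k ≤ N, ∀ y, ‖iteratedFDeriv ℝ k (fun y => f i (p.1, y)) y‖ ≤
      C * w p.1 * jb (-m) y := fun k hk y => by
    have := (norm_iteratedFDeriv_mk_right_le (h1 i) hk p.1 y).trans (h2 i k hk _)
    linarith
  have hcont : ∀ k ≤ N, Continuous fun y => iteratedFDeriv ℝ k (fun y => f i (p.1, y)) y :=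
    fun k hk => hsm.continuous_iteratedFDeriv (by exact_mod_cast hk)
  have hintk : ∀ k ≤ N, Integrable fun y => ‖iteratedFDeriv ℝ k (fun y => f i (p.1, y)) y‖ := by
    intro k hk
    refine Integrable.mono' (hint.const_mul (C * w p.1)) (hcont k hk).norm.aestronglyMeasurable
      (Filter.Eventually.of_forall fun y => ?_)
    rw [norm_norm]
    exact hle k hk y
  have hIk : ∀ k ≤ N, ∫ y, ‖iteratedFDeriv ℝ k (fun y => f i (p.1, y)) y‖ ≤ C * w p.1 * I := by
    intro k hk
    rw [hI, ← integral_const_mul]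
    exact integral_mono (hintk k hk) (hint.const_mul _) (hle k hk)
  have key : ∀ n ≤ N, ‖p.2‖ ^ n * ‖pft (f i) p‖ ≤ 2 ^ n * ((n + 1) * (C * w p.1 * I)) := by
    intro n hn
    have := Real.pow_mul_norm_iteratedFDeriv_fourier_le (K := 0) (N := (n : ℕ∞))
      (f := fun y => f i (p.1, y)) (hsm.of_le (by exact_mod_cast hn)) (fun k l hk hl => by
        obtain rfl : k = 0 := by simpa using hk
        simpa using hintk l ((by exact_mod_cast hl : l ≤ n).trans hn)) (k := 0) (n := n) le_rfl
        le_rfl p.2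
    simp only [norm_iteratedFDeriv_zero, pow_zero, one_mul, zero_add,
      Finset.range_one, Finset.singleton_product, Finset.sum_map, Function.Embedding.coeFn_mk,
      Nat.cast_zero, mul_zero] at this
    refine this.trans ?_
    gcongr
    calc _ ≤ ∑ _j ∈ Finset.range (n + 1), C * w p.1 * I :=
          Finset.sum_le_sum fun j hj => hIk j (by simp at hj; omega)
      _ = _ := by simp
  have k0 := key 0 (Nat.zero_le _)
  have kN := key N le_rfl
  simp only [pow_zero, one_mul, Nat.cast_zero, zero_add] at k0
  rw [jb_neg, jb_natCast, ← mul_assoc, ← div_eq_mul_inv, le_div_iff₀ (by positivity)]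
  have hpow : (1 + ‖p.2‖) ^ N ≤ 2 ^ N * (1 + ‖p.2‖ ^ N) := by
    rcases le_total ‖p.2‖ 1 with h | h
    · calc (1 + ‖p.2‖) ^ N ≤ 2 ^ N := by gcongr; linarith
        _ ≤ _ := le_mul_of_one_le_right (by positivity) (by linarith [pow_nonneg (norm_nonneg p.2) N])
    · calc (1 + ‖p.2‖) ^ N ≤ (2 * ‖p.2‖) ^ N := by gcongr; linarith
        _ = 2 ^ N * ‖p.2‖ ^ N := mul_pow _ _ _
        _ ≤ _ := by gcongr; linarith
  calc _ ≤ ‖pft (f i) p‖ * (2 ^ N * (1 + ‖p.2‖ ^ N)) := by gcongr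
    _ = 2 ^ N * (‖pft (f i) p‖ + ‖p.2‖ ^ N * ‖pft (f i) p‖) := by ring
    _ ≤ 2 ^ N * (C * w p.1 * I + 2 ^ N * ((N + 1) * (C * w p.1 * I))) := by gcongr
    _ = _ := by ring

/-- The partial Fourier transform exchanges regularity and decay in the second variable. -/
theorem pft_symB (k N : ℕ) {w : X → ℝ} (hw : Continuous w) (hw0 : ∀ x, 0 ≤ w x) {m : ℤ}
    (hm : (Module.finrank ℝ Y : ℤ) < m) {f : ι → X × Y → E}
    (hf : SymB (k + N) (fun p : X × Y => w p.1 * jb (-(m + k)) p.2) f) :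
    SymB k (fun p : X × Y => w p.1 * jb (-(N : ℤ)) p.2) (fun i => pft (f i)) := by
  -- Stated for every target space, because the induction replaces `f` by `pftDeriv f`, whose values
  -- are linear maps.
  have base : ∀ {E : Type} [NormedAddCommGroup E] [NormedSpace ℂ E] (f : ι → X × Y → E),
      SymB N (fun p : X × Y => w p.1 * jb (-m) p.2) f →
      SymB 0 (fun p : X × Y => w p.1 * jb (-(N : ℤ)) p.2) (fun i => pft (f i)) := by
    intro E _ _ f hf
    obtain ⟨C, hC, h⟩ := pft_bound hm hf
    refine SymB.of_bound (fun i => ?_) C hC h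
    obtain ⟨D, hD, h'⟩ := hf.bound
    exact continuous_pft (hf.1 i).continuous (w := fun x => D * w x) (by fun_prop)
      (integrable_jb hm) fun x y => (h' i (x, y)).trans_eq (by ring)
  induction k generalizing E with
  | zero => exact base f (by simpa using hf)
  | succ k ih =>
    have hj : ∀ p : X × Y, w p.1 * jb (-(m + (k + 1 : ℕ))) p.2 ≤ w p.1 * jb (-(m + 1)) p.2 :=
      fun p => mul_le_mul_of_nonneg_left (jb_mono (by push_cast; omega) _) (hw0 _)
    have hd : ∀ i p, HasFDerivAt (pft (f i)) (pft (pftDeriv (f i)) p) p := by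
      intro i p
      obtain ⟨h1, C, hC, h2⟩ := hf
      refine hasFDerivAt_pft ((h1 i).of_le (by norm_cast; omega))
        (w := fun x => C * w x) (by fun_prop) hm (fun p => ?_) (fun p => ?_) p
      · have := h2 i 0 (by omega) p
        rw [norm_iteratedFDeriv_zero] at this
        rw [mul_assoc]
        exact this.trans (mul_le_mul_of_nonneg_left (hj p) hC)
      · have := h2 i 1 (by omega) p
        rw [norm_iteratedFDeriv_one] at this
        rw [mul_assoc]
        exact this.trans (mul_le_mul_of_nonneg_left (hj p) hC)
    refine SymB.of_fderiv (base f ((hf.of_le (by omega)).mono' fun p => ?_))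
      (fun i p => (hd i p).differentiableAt) ?_
    · exact mul_le_mul_of_nonneg_left (jb_mono (by omega) _) (hw0 _)
    · have e : (fun i => fderiv ℝ (pft (f i))) = fun i => pft (pftDeriv (f i)) :=
        funext fun i => funext fun p => (hd i p).fderiv
      rw [e]
      refine ih (E := X × Y →L[ℝ] E) (pftDeriv_symB (m := m + k) ?_ hw0)
      refine SymB.mono' (hf.of_le (by omega)) fun p => le_of_eq ?_
      push_cast
      rw [add_assoc]

end PartialFourier

/-! ### Integrals depending on a parameter -/

section ParametricIntegral

variable {ι X Y E : Type}
  [NormedAddCommGroup X] [NormedSpace ℝ X]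
  [NormedAddCommGroup Y] [NormedSpace ℝ Y] [MeasurableSpace Y] [BorelSpace Y]
  [SecondCountableTopology Y] [NormedAddCommGroup E] [NormedSpace ℝ E]

lemma integrable_of_weight_bound {ν : Measure Y} {S : Set Y} (hS : ∀ᵐ y ∂ν, y ∈ S) {μ : Y → ℝ}
    (hμ : Integrable μ ν) {f : Y → E} (hf : Continuous f) {C : ℝ}
    (h : ∀ y ∈ S, ‖f y‖ ≤ C * μ y) : Integrable f ν :=
  (hμ.const_mul C).mono' hf.aestronglyMeasurable (hS.mono h)

/-- Differentiation under the integral sign, for jointly `C^1` integrands. -/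
lemma hasFDerivAt_integral_param {ν : Measure Y} {S : Set Y} (hS : ∀ᵐ y ∂ν, y ∈ S) {μ : Y → ℝ}
    (hμ : Integrable μ ν) {w : X → ℝ} (hw : Continuous w) {f : Y → X → E}
    (hf : ContDiff ℝ 1 (fun p : Y × X => f p.1 p.2))
    (h0 : ∀ y ∈ S, ∀ x, ‖f y x‖ ≤ w x * μ y) (h1 : ∀ y ∈ S, ∀ x, ‖fderiv ℝ (f y) x‖ ≤ w x * μ y)
    (x : X) : HasFDerivAt (fun x => ∫ y, f y x ∂ν) (∫ y, fderiv ℝ (f y) x ∂ν) x := by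
  have hc := hf.continuous
  have hd : Continuous fun p : Y × X => fderiv ℝ (f p.1) p.2 := by
    have : ContDiff ℝ 0 fun p : Y × X => fderiv ℝ (f p.1) p.2 :=
      ContDiff.fderiv (f := fun (p : Y × X) (x : X) => f p.1 x)
        (hf.comp (contDiff_fst.fst.prodMk contDiff_snd)) contDiff_snd (by norm_num)
    exact this.continuous
  have hs : {q : X | w q < |w x| + 1} ∈ nhds x :=
    hw.continuousAt.eventually_lt continuousAt_const ((le_abs_self _).trans_lt (lt_add_one _))
  refine hasFDerivAt_integral_of_dominated_of_fderiv_le (F := fun x y => f y x)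
    (F' := fun x y => fderiv ℝ (f y) x) (bound := fun y => (|w x| + 1) * |μ y|)
    (Filter.inter_mem hs (Filter.inter_mem hs (continuous_neg.comp hw |>.continuousAt.eventually_lt
      continuousAt_const ((neg_le_abs (w x)).trans_lt (lt_add_one _))))) ?_ ?_ ?_ ?_ ?_ ?_
  · exact Filter.Eventually.of_forall fun q => Continuous.aestronglyMeasurable (by fun_prop)
  · exact integrable_of_weight_bound hS hμ (by fun_prop) fun y hy => h0 y hy x
  · exact Continuous.aestronglyMeasurable (hd.comp (Continuous.prodMk_left x))
  · filter_upwards [hS] with y hy q hq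
    refine (h1 y hy q).trans ((le_abs_self _).trans ?_)
    rw [abs_mul]
    have : |w q| ≤ |w x| + 1 := abs_le.2 ⟨by have := hq.2.2; simp at this; linarith, hq.1.le⟩
    gcongr
  · exact hμ.abs.const_mul _
  · refine Filter.Eventually.of_forall fun y q _ => ?_
    have : ContDiff ℝ 1 (f y) := hf.comp (contDiff_prodMk_right y)
    exact (this.differentiable one_ne_zero q).hasFDerivAt

lemma contDiff_fderiv_param {n : ℕ} {f : Y → X → E}
    (hf : ContDiff ℝ (n + 1 : ℕ) (fun p : Y × X => f p.1 p.2)) :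
    ContDiff ℝ n fun p : Y × X => fderiv ℝ (f p.1) p.2 :=
  ContDiff.fderiv (f := fun (p : Y × X) (x : X) => f p.1 x)
    (hf.comp (contDiff_fst.fst.prodMk contDiff_snd)) contDiff_snd (by norm_cast)

/-- All derivatives are dominated by a weight in `x` times one fixed integrable function of `y`, so
differentiation under the integral can be iterated. The full-measure set `S` serves the Taylor
remainder, whose bounds hold only for parameters in the unit interval. -/
theorem symB_integral {n : ℕ} {ν : Measure Y} {S : Set Y} (hS : ∀ᵐ y ∂ν, y ∈ S) {μ : Y → ℝ}
    (hμ : Integrable μ ν) (hμ0 : ∀ y, 0 ≤ μ y) {w : X → ℝ} (hw : Continuous w)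
    {f : ι → Y → X → E}
    (hf : ∀ i, ContDiff ℝ n (fun p : Y × X => f i p.1 p.2)) {C : ℝ} (hC : 0 ≤ C)
    (h : ∀ i, ∀ y ∈ S, ∀ k ≤ n, ∀ x, ‖iteratedFDeriv ℝ k (f i y) x‖ ≤ C * w x * μ y) :
    SymB n w (fun i x => ∫ y, f i y x ∂ν) := by
  have hbd : ∀ i x, ‖∫ y, f i y x ∂ν‖ ≤ (C * ∫ y, μ y ∂ν) * w x := by
    intro i x
    have : ∀ᵐ y ∂ν, ‖f i y x‖ ≤ C * w x * μ y := hS.mono fun y hy => by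
      simpa using h i y hy 0 (Nat.zero_le _) x
    refine (norm_integral_le_of_norm_le (hμ.const_mul _) this).trans ?_
    rw [integral_const_mul]
    exact le_of_eq (by ring)
  have hI : 0 ≤ C * ∫ y, μ y ∂ν := mul_nonneg hC (integral_nonneg hμ0)
  induction n generalizing E with
  | zero =>
    refine SymB.of_bound (fun i => ?_) _ hI hbd
    refine continuous_iff_continuousAt.2 fun x => ?_
    have hc := (hf i).continuous
    refine continuousAt_of_dominated (bound := fun y => C * (w x + 1) * μ y) ?_ ?_ ?_ ?_
    · exact Filter.Eventually.of_forall fun q => Continuous.aestronglyMeasurable (by fun_prop)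
    · have : ∀ᶠ q in nhds x, w q < w x + 1 :=
        hw.continuousAt.eventually_lt continuousAt_const (lt_add_one _)
      filter_upwards [this] with q hq
      filter_upwards [hS] with y hy
      have h3 := h i y hy 0 le_rfl q
      rw [norm_iteratedFDeriv_zero] at h3
      refine h3.trans ?_
      have := hμ0 y
      gcongr
    · exact hμ.const_mul _
    · exact Filter.Eventually.of_forall fun y => Continuous.continuousAt (by fun_prop)
  | succ n ih =>
    have hd : ∀ i x, HasFDerivAt (fun x => ∫ y, f i y x ∂ν) (∫ y, fderiv ℝ (f i y) x ∂ν) x := by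
      intro i x
      refine hasFDerivAt_integral_param hS hμ (w := fun x => C * w x) (by fun_prop)
        ((hf i).of_le (by norm_cast; omega)) (fun y hy x => ?_) (fun y hy x => ?_) x
      · simpa using h i y hy 0 (Nat.zero_le _) x
      · simpa using h i y hy 1 (by omega) x
    have hc : ∀ i, Continuous fun x => ∫ y, f i y x ∂ν := fun i =>
      continuous_iff_continuousAt.2 fun x => (hd i x).continuousAt
    refine SymB.of_fderiv (SymB.of_bound hc _ hI hbd) (fun i x => (hd i x).differentiableAt) ?_
    have e : (fun i => fderiv ℝ fun x => ∫ y, f i y x ∂ν) =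
        fun i x => ∫ y, fderiv ℝ (f i y) x ∂ν :=
      funext fun i => funext fun x => (hd i x).fderiv
    rw [e]
    have hk : ∀ i, ∀ y ∈ S, ∀ k ≤ n, ∀ x, ‖iteratedFDeriv ℝ k (fderiv ℝ (f i y)) x‖ ≤
        C * w x * μ y := fun i y hy k hk x => by
      rw [norm_iteratedFDeriv_fderiv]
      exact h i y hy (k + 1) (by omega) x
    refine ih (f := fun i y x => fderiv ℝ (f i y) x) (fun i => contDiff_fderiv_param (hf i)) hk ?_
    intro i x
    have : ∀ᵐ y ∂ν, ‖fderiv ℝ (f i y) x‖ ≤ C * w x * μ y := hS.mono fun y hy => by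
      simpa using hk i y hy 0 (Nat.zero_le _) x
    refine (norm_integral_le_of_norm_le (hμ.const_mul _) this).trans ?_
    rw [integral_const_mul]
    exact le_of_eq (by ring)

end ParametricIntegral

/-! ### Positions, momenta and the symplectic map -/

section PhaseSpace

variable {d : ℕ}

/-- The position component of a phase space point. -/
def posL (d : ℕ) : Phase d →L[ℝ] Position d :=
  LinearMap.toContinuousLinearMap
    { toFun := fun z => WithLp.toLp 2 fun i => z (Sum.inl i)
      map_add' := fun _ _ => rfl
      map_smul' := fun _ _ => rfl }

/-- The momentum component of a phase space point. -/
def momL (d : ℕ) : Phase d →L[ℝ] Position d :=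
  LinearMap.toContinuousLinearMap
    { toFun := fun z => WithLp.toLp 2 fun i => z (Sum.inr i)
      map_add' := fun _ _ => rfl
      map_smul' := fun _ _ => rfl }

/-- `phasePt` as a continuous linear map. -/
def phaseL (d : ℕ) : Position d × Position d →L[ℝ] Phase d :=
  LinearMap.toContinuousLinearMap
    { toFun := fun x => phasePt x.1 x.2
      map_add' := fun x y => by ext i; rcases i with i | i <;> simp [phasePt]
      map_smul' := fun c x => by ext i; rcases i with i | i <;> simp [phasePt] }

@[simp] lemma phaseL_apply (x : Position d × Position d) : phaseL d x = phasePt x.1 x.2 := rfl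

lemma posL_apply (z : Phase d) (i : Fin d) : posL d z i = z (Sum.inl i) := rfl

lemma momL_apply (z : Phase d) (i : Fin d) : momL d z i = z (Sum.inr i) := rfl

@[simp] lemma posL_phasePt (q p : Position d) : posL d (phasePt q p) = q := rfl

@[simp] lemma momL_phasePt (q p : Position d) : momL d (phasePt q p) = p := rfl

lemma inner_phase (z w : Phase d) :
    ⟪z, w⟫_ℝ = ⟪posL d z, posL d w⟫_ℝ + ⟪momL d z, momL d w⟫_ℝ := by
  simp [PiLp.inner_apply, posL_apply, momL_apply]

lemma norm_sq_phase (z : Phase d) : ‖z‖ ^ 2 = ‖posL d z‖ ^ 2 + ‖momL d z‖ ^ 2 := by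
  rw [← real_inner_self_eq_norm_sq, inner_phase, real_inner_self_eq_norm_sq,
    real_inner_self_eq_norm_sq]

lemma norm_posL_le (z : Phase d) : ‖posL d z‖ ≤ ‖z‖ := by
  have := norm_sq_phase z
  nlinarith [norm_nonneg z, norm_nonneg (posL d z), sq_nonneg ‖momL d z‖]

lemma norm_momL_le (z : Phase d) : ‖momL d z‖ ≤ ‖z‖ := by
  have := norm_sq_phase z
  nlinarith [norm_nonneg z, norm_nonneg (momL d z), sq_nonneg ‖posL d z‖]

lemma norm_phasePt_le (q p : Position d) : ‖phasePt q p‖ ≤ ‖q‖ + ‖p‖ := by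
  have := norm_sq_phase (phasePt q p)
  simp only [posL_phasePt, momL_phasePt] at this
  nlinarith [norm_nonneg (phasePt q p), norm_nonneg q, norm_nonneg p,
    mul_nonneg (norm_nonneg q) (norm_nonneg p)]

/-- The linear map `J`. -/
def symJ (d : ℕ) : Phase d →L[ℝ] Phase d := (phaseL d).comp ((momL d).prod (-posL d))

lemma symJ_apply (z : Phase d) : symJ d z = phasePt (momL d z) (-posL d z) := rfl

lemma jb_phasePt_le {m : ℤ} (hm : 0 ≤ m) (q p : Position d) :
    jb m (phasePt q p) ≤ jb m q * jb m p := by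
  have h1 : jb m (phasePt q p) ≤ 1 ^ m * (jb m q * jb m p) := by
    unfold jb
    rw [← mul_zpow, ← mul_zpow]
    refine zpow_le_zpow_left₀ hm (by positivity) ?_
    nlinarith [norm_phasePt_le q p, norm_nonneg q, norm_nonneg p,
      mul_nonneg (norm_nonneg q) (norm_nonneg p)]
  simpa using h1

lemma finrank_phase : Module.finrank ℝ (Phase d) = 2 * d := by
  simp [two_mul]

end PhaseSpace

/-! ### Unitary characters of the real line -/

section Characters

/-- The character `t ↦ exp (2πit)`. -/
def ech (t : ℝ) : ℂ := (Real.fourierChar t : Circle)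

lemma ech_add (s t : ℝ) : ech (s + t) = ech s * ech t := by
  simp [ech, AddChar.map_add_eq_mul]

@[simp] lemma norm_ech (t : ℝ) : ‖ech t‖ = 1 := Circle.norm_coe _

@[fun_prop] lemma continuous_ech : Continuous ech :=
  continuous_subtype_val.comp Real.continuous_fourierChar

lemma ech_eq_exp (t : ℝ) : ech t = Complex.exp (2 * Real.pi * t * Complex.I) := by
  rw [ech, Real.fourierChar_apply]
  push_cast
  rfl

lemma conj_ech (t : ℝ) : (starRingEnd ℂ) (ech t) = ech (-t) := by
  rw [ech_eq_exp, ech_eq_exp, ← Complex.exp_conj]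
  simp [Complex.conj_ofNat]

lemma pft_eq_integral {X Y E : Type} [NormedAddCommGroup Y]
    [InnerProductSpace ℝ Y] [FiniteDimensional ℝ Y] [MeasurableSpace Y] [BorelSpace Y]
    [NormedAddCommGroup X] [NormedSpace ℝ X]
    [NormedAddCommGroup E] [NormedSpace ℂ E] (f : X × Y → E) (x : X) (ξ : Y) :
    pft f (x, ξ) = ∫ y, ech (-⟪y, ξ⟫_ℝ) • f (x, y) := pft_apply f (x, ξ)

end Characters

/-! ### Weyl quantization of complex symbols and phase space translations -/

section OpC

variable {d : ℕ}

/-- Weyl quantization of complex symbols, in terms of `h = 2πε`. -/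
def opC (h : ℝ) (a : Phase d → ℂ) (ψ : Position d → ℂ) : Position d → ℂ := fun q =>
  ((h ^ d)⁻¹ : ℝ) * ∫ p : Position d, ∫ y : Position d,
    a (phasePt ((1 / 2 : ℝ) • (q + y)) p) * ech (h⁻¹ * ⟪q - y, p⟫_ℝ) * ψ y

/-- With h = 2πε the phase takes the form exp(2πi t), which is the normalisation of the Fourier
transform used below. -/
lemma opWeyl_eq_opC {ε : ℝ} (a : Phase d → ℝ) (ψ : Position d → ℂ) :
    opWeyl ε a ψ = opC (2 * Real.pi * ε) (fun z => (a z : ℂ)) ψ := by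
  ext q
  unfold opWeyl opC
  congr 1
  refine integral_congr_ae (Filter.Eventually.of_forall fun p => ?_)
  refine integral_congr_ae (Filter.Eventually.of_forall fun y => ?_)
  have hpi : (Real.pi : ℂ) ≠ 0 := by exact_mod_cast Real.pi_ne_zero
  simp only [ech_eq_exp]
  congr 3
  push_cast
  rw [mul_inv, mul_inv]
  field_simp

/-- The amplitude `a((q + y) / 2, p) ψ(y)` of the Weyl quantization, at `((q, p), y)`. -/
def weylAmp (a : Phase d → ℂ) (ψ : Position d → ℂ) (x : (Position d × Position d) × Position d) :
    ℂ := a (phasePt ((1 / 2 : ℝ) • (x.1.1 + x.2)) x.1.2) * ψ x.2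

/-- The inner integral in the Weyl quantization, without the phase depending on `q`. -/
def weylInner (h : ℝ) (a : Phase d → ℂ) (ψ : Position d → ℂ) (x : Position d × Position d) : ℂ :=
  pft (weylAmp a ψ) (x, h⁻¹ • x.2)

lemma inner_integral_eq (h : ℝ) (a : Phase d → ℂ) (ψ : Position d → ℂ) (q p : Position d) :
    ∫ y : Position d, a (phasePt ((1 / 2 : ℝ) • (q + y)) p) * ech (h⁻¹ * ⟪q - y, p⟫_ℝ) * ψ y =
      ech (h⁻¹ * ⟪q, p⟫_ℝ) * weylInner h a ψ (q, p) := by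
  rw [weylInner, pft_eq_integral, ← integral_const_mul]
  refine integral_congr_ae (Filter.Eventually.of_forall fun y => ?_)
  have e : ech (h⁻¹ * ⟪q - y, p⟫_ℝ) = ech (h⁻¹ * ⟪q, p⟫_ℝ) * ech (-(h⁻¹ * ⟪y, p⟫_ℝ)) := by
    rw [← ech_add, inner_sub_left]; congr 1; ring
  simp only [weylAmp, inner_smul_right, smul_eq_mul, e]
  ring

/-- Weyl quantization is two partial Fourier transforms in succession, in `y` and then in `p`. Its
mapping properties are thereby reduced to `pft_symB`. -/
lemma opC_eq (h : ℝ) (a : Phase d → ℂ) (ψ : Position d → ℂ) (q : Position d) :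
    opC h a ψ q = ((h ^ d)⁻¹ : ℝ) * pft (weylInner h a ψ) (q, -(h⁻¹ • q)) := by
  unfold opC
  simp only [inner_integral_eq]
  rw [pft_eq_integral]
  congr 1
  refine integral_congr_ae (Filter.Eventually.of_forall fun p => ?_)
  simp [inner_smul_right, real_inner_comm]

lemma opC_const_mul (h : ℝ) (c : ℂ) (a : Phase d → ℂ) (ψ : Position d → ℂ) (q : Position d) :
    opC h (fun z => c * a z) ψ q = c * opC h a ψ q := by
  simp only [opC, mul_assoc, integral_const_mul]
  ring

/-- The Weyl quantization of `z ↦ exp (2πi ζ·z)`. -/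
def opTrans (h : ℝ) (ζ : Phase d) (ψ : Position d → ℂ) : Position d → ℂ := fun y =>
  ech ⟪posL d ζ, y + (h / 2) • momL d ζ⟫_ℝ * ψ (y + h • momL d ζ)

/-- Shift `p` by half of h times the position part of `ζ`, and `y` by h times its momentum part. The
phases then recombine into the character. Translation invariance of the integral needs no
integrability, so nothing is assumed of `b` or `ψ`. -/
lemma opC_opTrans {h : ℝ} (hh : h ≠ 0) (b : Phase d → ℂ) (ζ : Phase d) (ψ : Position d → ℂ)
    (q : Position d) :
    opC h b (opTrans h ζ ψ) q =
      opC h (fun z => ech ⟪ζ, z⟫_ℝ * b (z - (h / 2) • symJ d ζ)) ψ q := by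
  unfold opC
  congr 1
  rw [← integral_add_right_eq_self _ ((h / 2) • posL d ζ)]
  refine integral_congr_ae (Filter.Eventually.of_forall fun p => ?_)
  simp only
  rw [← integral_sub_right_eq_self _ (h • momL d ζ)]
  refine integral_congr_ae (Filter.Eventually.of_forall fun y => ?_)
  simp only [opTrans]
  have e1 : phasePt ((1 / 2 : ℝ) • (q + (y - h • momL d ζ))) (p + (h / 2) • posL d ζ) =
      phasePt ((1 / 2 : ℝ) • (q + y)) p - (h / 2) • symJ d ζ := by
    rw [symJ_apply]
    ext i; rcases i with i | i <;> simp [phasePt] <;> ring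
  rw [e1, sub_add_cancel]
  have e2 : ech (h⁻¹ * ⟪q - (y - h • momL d ζ), p + (h / 2) • posL d ζ⟫_ℝ) *
      ech ⟪posL d ζ, y - h • momL d ζ + (h / 2) • momL d ζ⟫_ℝ =
      ech ⟪ζ, phasePt ((1 / 2 : ℝ) • (q + y)) p⟫_ℝ * ech (h⁻¹ * ⟪q - y, p⟫_ℝ) := by
    rw [← ech_add, ← ech_add]
    congr 1
    rw [inner_phase]
    have c1 : ⟪q, posL d ζ⟫_ℝ = ⟪posL d ζ, q⟫_ℝ := real_inner_comm _ _
    have c2 : ⟪y, posL d ζ⟫_ℝ = ⟪posL d ζ, y⟫_ℝ := real_inner_comm _ _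
    have c3 : ⟪momL d ζ, posL d ζ⟫_ℝ = ⟪posL d ζ, momL d ζ⟫_ℝ := real_inner_comm _ _
    simp only [posL_phasePt, momL_phasePt, inner_add_right, inner_sub_left,
      inner_sub_right, inner_smul_left, inner_smul_right, RCLike.conj_to_real, c1, c2, c3]
    field_simp
    ring
  linear_combination (b (phasePt ((1 / 2 : ℝ) • (q + y)) p - (h / 2) • symJ d ζ) * ψ y) * e2

/-- Here only `p` is shifted, in the opposite direction. The resulting change of sign in the shift
of `b` is the source of the commutator. -/
lemma opTrans_opC {h : ℝ} (hh : h ≠ 0) (b : Phase d → ℂ) (ζ : Phase d) (ψ : Position d → ℂ)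
    (q : Position d) :
    opTrans h ζ (opC h b ψ) q =
      opC h (fun z => ech ⟪ζ, z⟫_ℝ * b (z + (h / 2) • symJ d ζ)) ψ q := by
  unfold opTrans opC
  rw [mul_left_comm]
  congr 1
  rw [← integral_sub_right_eq_self _ ((h / 2) • posL d ζ), ← integral_const_mul]
  refine integral_congr_ae (Filter.Eventually.of_forall fun p => ?_)
  simp only
  rw [← integral_const_mul]
  refine integral_congr_ae (Filter.Eventually.of_forall fun y => ?_)
  simp only
  have e1 : phasePt ((1 / 2 : ℝ) • (q + h • momL d ζ + y)) (p - (h / 2) • posL d ζ) =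
      phasePt ((1 / 2 : ℝ) • (q + y)) p + (h / 2) • symJ d ζ := by
    rw [symJ_apply]
    ext i; rcases i with i | i <;> simp [phasePt] <;> ring
  rw [e1]
  have e2 : ech ⟪posL d ζ, q + (h / 2) • momL d ζ⟫_ℝ *
      ech (h⁻¹ * ⟪q + h • momL d ζ - y, p - (h / 2) • posL d ζ⟫_ℝ) =
      ech ⟪ζ, phasePt ((1 / 2 : ℝ) • (q + y)) p⟫_ℝ * ech (h⁻¹ * ⟪q - y, p⟫_ℝ) := by
    rw [← ech_add, ← ech_add]
    congr 1
    rw [inner_phase]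
    have c1 : ⟪q, posL d ζ⟫_ℝ = ⟪posL d ζ, q⟫_ℝ := real_inner_comm _ _
    have c2 : ⟪y, posL d ζ⟫_ℝ = ⟪posL d ζ, y⟫_ℝ := real_inner_comm _ _
    have c3 : ⟪momL d ζ, posL d ζ⟫_ℝ = ⟪posL d ζ, momL d ζ⟫_ℝ := real_inner_comm _ _
    simp only [posL_phasePt, momL_phasePt, inner_add_left, inner_add_right, inner_sub_left,
      inner_sub_right, inner_smul_left, inner_smul_right, RCLike.conj_to_real, c1, c2, c3]
    field_simp
    ring
  linear_combination (b (phasePt ((1 / 2 : ℝ) • (q + y)) p + (h / 2) • symJ d ζ) * ψ y) * e2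

end OpC

/-! ### Weights under linear maps and dilations -/

section Scaling

variable {X Y : Type} [NormedAddCommGroup X] [NormedSpace ℝ X] [NormedAddCommGroup Y]
  [NormedSpace ℝ Y]

lemma jb_clm_le (L : X →L[ℝ] Y) {m : ℤ} (hm : 0 ≤ m) :
    ∃ K, 0 ≤ K ∧ ∀ x, jb m (L x) ≤ K * jb m x := by
  refine ⟨(max 1 ‖L‖) ^ m, by positivity, fun x => jb_comp_le hm ?_⟩
  have := L.le_opNorm x
  nlinarith [le_max_left 1 ‖L‖, le_max_right 1 ‖L‖, norm_nonneg x,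
    mul_le_mul_of_nonneg_right (le_max_right 1 ‖L‖) (norm_nonneg x)]

lemma jb_neg_smul_le {κ : ℝ} (hκ : κ ≠ 0) {m : ℤ} (hm : 0 ≤ m) :
    ∃ K, 0 ≤ K ∧ ∀ x : X, jb (-m) (κ • x) ≤ K * jb (-m) x := by
  obtain ⟨K, hK, h⟩ := jb_clm_le (κ⁻¹ • ContinuousLinearMap.id ℝ X) hm
  refine ⟨K, hK, fun x => jb_neg_le _ ?_⟩
  simpa [smul_smul, hκ] using h (κ • x)

end Scaling

/-! ### Weyl quantization on the Schwartz space -/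

section WeylSchwartz

variable {ι : Type} {d : ℕ}

/-- The affine map `((q, p), y) ↦ ((q + y) / 2, p)`. -/
def midL (d : ℕ) : (Position d × Position d) × Position d →L[ℝ] Phase d :=
  (phaseL d).comp (ContinuousLinearMap.prod
    ((1 / 2 : ℝ) • ((ContinuousLinearMap.fst ℝ (Position d) (Position d)).comp
      (ContinuousLinearMap.fst ℝ (Position d × Position d) (Position d)) +
      ContinuousLinearMap.snd ℝ (Position d × Position d) (Position d)))
    ((ContinuousLinearMap.snd ℝ (Position d) (Position d)).comp
      (ContinuousLinearMap.fst ℝ (Position d × Position d) (Position d))))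

lemma midL_apply (x : (Position d × Position d) × Position d) :
    midL d x = phasePt ((1 / 2 : ℝ) • (x.1.1 + x.2)) x.1.2 := rfl

lemma jb_mid_le {m : ℤ} (hm : 0 ≤ m) (q p y : Position d) :
    jb m (phasePt ((1 / 2 : ℝ) • (q + y)) p) ≤ jb m q * jb m p * jb m y := by
  refine (jb_phasePt_le hm _ _).trans ?_
  have h1 : jb m ((1 / 2 : ℝ) • (q + y)) ≤ jb m (q + y) := by
    refine jb_le_of_norm_le hm ?_
    rw [norm_smul]
    have : ‖(1 / 2 : ℝ)‖ ≤ 1 := by norm_num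
    exact mul_le_of_le_one_left (norm_nonneg _) this
  calc _ ≤ (jb m q * jb m y) * jb m p := by
        gcongr
        · exact jb_nonneg _ _
        · exact h1.trans (jb_add_le_mul hm _ _)
    _ = _ := by ring

/-- The decay of `ψ` absorbs the growth of the symbol in `y` with any order `k` to spare; the growth
in `q` and `p` remains. -/
lemma weylAmp_symB {m : ℤ} (hm : 0 ≤ m) {a : Phase d → ℂ} (ha : OfOrder m (fun _ : Unit => a))
    {ψ : Position d → ℂ} (hψ : SchwartzB (fun _ : Unit => ψ)) (n : ℕ) (k : ℤ) :
    SymB n (fun x : (Position d × Position d) × Position d =>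
      (jb m x.1.1 * jb m x.1.2) * jb k x.2) (fun _ : Unit => weylAmp a ψ) := by
  have h1 : SymB n (fun x : (Position d × Position d) × Position d =>
      jb m x.1.1 * jb m x.1.2 * jb m x.2) (fun (_ : Unit) x => a (midL d x + 0)) :=
    (ha n).comp_affine (fun _ => midL d) (fun _ => 0) (fun _ => le_rfl) zero_le_one
      (fun _ x => by rw [one_mul, add_zero, midL_apply]; exact jb_mid_le hm _ _ _)
  have h2 : SymB n (fun x : (Position d × Position d) × Position d => jb (k - m) x.2)
      (fun (_ : Unit) x => ψ (ContinuousLinearMap.snd ℝ (Position d × Position d) _ x + 0)) :=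
    (hψ (k - m) n).comp_affine
      (fun _ => ContinuousLinearMap.snd ℝ (Position d × Position d) (Position d)) (fun _ => 0)
      (fun _ => le_rfl) zero_le_one (fun _ x => by simp)
  have h3 := h1.bilin (ContinuousLinearMap.mul ℝ ℂ) h2
  simp only [add_zero] at h3
  refine SymB.mono' (f := fun _ : Unit => weylAmp a ψ) h3 fun x => le_of_eq ?_
  rw [mul_assoc _ (jb m x.2), ← jb_add]
  congr 2; ring

/-- Smoothness in `y` becomes decay in `p`. Taking `m` further derivatives beats the growth of the
symbol in `p`. -/
lemma weylInner_symB {h : ℝ} (hh : h ≠ 0) {m : ℤ} (hm : 0 ≤ m) {a : Phase d → ℂ}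
    (ha : OfOrder m (fun _ : Unit => a))
    {ψ : Position d → ℂ} (hψ : SchwartzB (fun _ : Unit => ψ)) (n N : ℕ) :
    SymB n (fun x : Position d × Position d => jb m x.1 * jb (-(N : ℤ)) x.2)
      (fun _ : Unit => weylInner h a ψ) := by
  have hw : Continuous fun x : Position d × Position d => jb m x.1 * jb m x.2 :=
    ((continuous_jb m).comp continuous_fst).mul ((continuous_jb m).comp continuous_snd)
  have h1 := pft_symB (Y := Position d) n (N + m.toNat) hw
    (fun x => mul_nonneg (jb_nonneg _ _) (jb_nonneg _ _))
    (m := Module.finrank ℝ (Position d) + 1) (lt_add_one _) (weylAmp_symB hm ha hψ _ _)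
  obtain ⟨K, hK, hK'⟩ := jb_neg_smul_le (X := Position d) (inv_ne_zero hh)
    (m := ((N + m.toNat : ℕ) : ℤ)) (by positivity)
  have h2 := h1.comp_affine (fun _ => (ContinuousLinearMap.id ℝ (Position d × Position d)).prod
    (h⁻¹ • ContinuousLinearMap.snd ℝ (Position d) (Position d))) (fun _ => 0)
    (w' := fun x => jb m x.1 * jb (-(N : ℤ)) x.2) (fun _ => le_rfl) hK ?_
  · simp only [add_zero] at h2
    exact h2
  · rintro - ⟨q, p⟩
    simp only [ContinuousLinearMap.prod_apply, ContinuousLinearMap.id_apply, smul_apply,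
      ContinuousLinearMap.coe_snd', add_zero]
    calc _ ≤ jb m q * jb m p * (K * jb (-((N + m.toNat : ℕ) : ℤ)) p) :=
          mul_le_mul_of_nonneg_left (hK' p) (mul_nonneg (jb_nonneg _ _) (jb_nonneg _ _))
      _ = K * (jb m q * (jb m p * jb (-((N + m.toNat : ℕ) : ℤ)) p)) := by ring
      _ = _ := by
        rw [← jb_add]
        congr 3
        push_cast [Int.toNat_of_nonneg hm]
        ring

lemma integrable_weylInner {h : ℝ} (hh : h ≠ 0) {m : ℤ} (hm : 0 ≤ m) {a : Phase d → ℂ}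
    (ha : OfOrder m (fun _ : Unit => a))
    {ψ : Position d → ℂ} (hψ : SchwartzB (fun _ : Unit => ψ)) (q : Position d) :
    Integrable fun p => weylInner h a ψ (q, p) := by
  have := weylInner_symB hh hm ha hψ 0 (Module.finrank ℝ (Position d) + 1)
  obtain ⟨C, hC, h1⟩ := this.bound
  have hc := (this.1 ()).continuous
  refine ((integrable_jb (X := Position d) (μ := volume) (m := Module.finrank ℝ (Position d) + 1)
    (lt_add_one _)).const_mul (C * jb m q)).mono' (by fun_prop)
    (Filter.Eventually.of_forall fun p => ?_)
  have := h1 () (q, p)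
  push_cast at this
  linarith

/-- Weyl quantization of symbols with derivatives of a fixed polynomial growth maps the Schwartz
space to itself. -/
theorem opC_schwartz {h : ℝ} (hh : h ≠ 0) {m : ℤ} (hm : 0 ≤ m) {a : Phase d → ℂ}
    (ha : OfOrder m (fun _ : Unit => a))
    {ψ : Position d → ℂ} (hψ : SchwartzB (fun _ : Unit => ψ)) :
    SchwartzB (fun _ : Unit => opC h a ψ) := by
  refine SchwartzB.of_neg fun N n => ?_
  -- The second transform turns smoothness in `p` into decay in `q`, again with `m` extra orders to
  -- cancel the growth in `q`.
  have h1 := pft_symB (Y := Position d) n (N + m.toNat) (w := jb m) (X := Position d)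
    (continuous_jb m) (fun x => jb_nonneg _ _)
    (m := Module.finrank ℝ (Position d) + 1) (lt_add_one _)
    (f := fun _ : Unit => weylInner h a ψ) (by
      have := weylInner_symB hh hm ha hψ (n + (N + m.toNat))
        (Module.finrank ℝ (Position d) + 1 + n)
      exact_mod_cast this)
  obtain ⟨K, hK, hK'⟩ := jb_neg_smul_le (X := Position d) (neg_ne_zero.2 (inv_ne_zero hh))
    (m := ((N + m.toNat : ℕ) : ℤ)) (by positivity)
  have h2 := h1.comp_affine (fun _ => (ContinuousLinearMap.id ℝ (Position d)).prod
    ((-h⁻¹) • ContinuousLinearMap.id ℝ (Position d))) (fun _ => 0)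
    (w' := jb (-(N : ℤ))) (fun _ => le_rfl) hK ?_
  · have h3 := h2.clm_const (ContinuousLinearMap.mul ℝ ℂ (((h ^ d)⁻¹ : ℝ) : ℂ))
    simp only [add_zero, ContinuousLinearMap.prod_apply, ContinuousLinearMap.id_apply, smul_apply,
      ContinuousLinearMap.mul_apply'] at h3
    have e : opC h a ψ = fun x => (((h ^ d)⁻¹ : ℝ) : ℂ) * pft (weylInner h a ψ) (x, -h⁻¹ • x) := by
      ext q
      rw [opC_eq, neg_smul]
    rw [e]
    exact h3
  · intro _ q
    simp only [ContinuousLinearMap.prod_apply, ContinuousLinearMap.id_apply, smul_apply,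
      add_zero]
    calc _ ≤ jb m q * (K * jb (-((N + m.toNat : ℕ) : ℤ)) q) :=
          mul_le_mul_of_nonneg_left (hK' q) (jb_nonneg _ _)
      _ = K * (jb m q * jb (-((N + m.toNat : ℕ) : ℤ)) q) := by ring
      _ = _ := by
        rw [← jb_add]
        congr 2
        push_cast [Int.toNat_of_nonneg hm]
        ring

lemma opC_eq_integral_inner (h : ℝ) (a : Phase d → ℂ) (ψ : Position d → ℂ) (q : Position d) :
    opC h a ψ q = ((h ^ d)⁻¹ : ℝ) * ∫ p, ech (h⁻¹ * ⟪q, p⟫_ℝ) * weylInner h a ψ (q, p) := by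
  unfold opC
  simp only [inner_integral_eq]

lemma integrable_weylAmp {m : ℤ} (hm : 0 ≤ m) {a : Phase d → ℂ}
    (ha : OfOrder m (fun _ : Unit => a))
    {ψ : Position d → ℂ} (hψ : SchwartzB (fun _ : Unit => ψ)) (x : Position d × Position d) :
    Integrable fun y => weylAmp a ψ (x, y) := by
  have := weylAmp_symB hm ha hψ 0 (-(Module.finrank ℝ (Position d) + 1 : ℤ))
  obtain ⟨C, hC, h1⟩ := this.bound
  have hc := (this.1 ()).continuous
  refine ((integrable_jb (X := Position d) (μ := volume) (m := Module.finrank ℝ (Position d) + 1)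
    (lt_add_one _)).const_mul (C * (jb m x.1 * jb m x.2))).mono' (by fun_prop)
    (Filter.Eventually.of_forall fun p => ?_)
  have := h1 () (x, p)
  push_cast at this
  linarith

/-- Additivity of an iterated integral needs integrability at each level: in `y` from the decay of
`ψ`, in `p` from the decay created by the inner integral. -/
lemma opC_add {h : ℝ} (hh : h ≠ 0) {m m' : ℤ} (hm : 0 ≤ m) (hm' : 0 ≤ m') {a b : Phase d → ℂ}
    (ha : OfOrder m (fun _ : Unit => a)) (hb : OfOrder m' (fun _ : Unit => b))
    {ψ : Position d → ℂ} (hψ : SchwartzB (fun _ : Unit => ψ)) (q : Position d) :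
    opC h (fun z => a z + b z) ψ q = opC h a ψ q + opC h b ψ q := by
  have e : ∀ x, weylInner h (fun z => a z + b z) ψ x = weylInner h a ψ x + weylInner h b ψ x := by
    intro x
    simp only [weylInner, pft_eq_integral]
    rw [← integral_add]
    · refine integral_congr_ae (Filter.Eventually.of_forall fun y => ?_)
      simp only [weylAmp, smul_eq_mul]
      ring
    · exact (integrable_weylAmp hm ha hψ x).bdd_mul (c := 1)
        (Continuous.aestronglyMeasurable (by fun_prop)) (by simp)
    · exact (integrable_weylAmp hm' hb hψ x).bdd_mul (c := 1)
        (Continuous.aestronglyMeasurable (by fun_prop)) (by simp)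
  simp only [opC_eq_integral_inner, e, mul_add]
  rw [integral_add, mul_add]
  · exact (integrable_weylInner hh hm ha hψ q).bdd_mul (c := 1)
      (Continuous.aestronglyMeasurable (by fun_prop)) (by simp)
  · exact (integrable_weylInner hh hm' hb hψ q).bdd_mul (c := 1)
      (Continuous.aestronglyMeasurable (by fun_prop)) (by simp)

end WeylSchwartz

/-! ### Fubini for oscillatory integrals -/

section Exchange

variable {d : ℕ} {Z : Type} [NormedAddCommGroup Z] [NormedSpace ℝ Z] [FiniteDimensional ℝ Z]
  [MeasureSpace Z] [BorelSpace Z] [(volume : Measure Z).IsAddHaarMeasure]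

/-- Exchange of an oscillatory double integral with an absolutely convergent integral. -/
theorem oscillatory_integral_swap {m : ℤ} (hm : 0 ≤ m)
    {f : (Position d × Z) × Position d → ℂ}
    (hf : ∀ n N : ℕ, SymB n (fun x : (Position d × Z) × Position d =>
      (jb m x.1.1 * jb (-(N : ℤ)) x.1.2) * jb (-(N : ℤ)) x.2) (fun _ : Unit => f))
    {u : Position d × Z → ℂ} (hu : Continuous u) (hu1 : ∀ x, ‖u x‖ = 1)
    {κ : ℝ} (hκ : κ ≠ 0) (θ : Z →L[ℝ] Position d) :
    (∫ p, ∫ y, ∫ ζ, u (p, ζ) * (ech (-⟪y, κ • p - θ ζ⟫_ℝ) * f ((p, ζ), y))) =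
      ∫ ζ, ∫ p, ∫ y, u (p, ζ) * (ech (-⟪y, κ • p - θ ζ⟫_ℝ) * f ((p, ζ), y)) ∧
    Integrable fun ζ => ∫ p, ∫ y, u (p, ζ) * (ech (-⟪y, κ • p - θ ζ⟫_ℝ) * f ((p, ζ), y)) := by
  have hfc : Continuous f := ((hf 0 0).1 ()).continuous
  set M : ℕ := Module.finrank ℝ (Position d) + 1 with hM
  set R : ℕ := Module.finrank ℝ Z + 1 with hR
  have iP := integrable_jb (X := Position d) (μ := volume) (m := (M : ℤ)) (by omega)
  have iZ := integrable_jb (X := Z) (μ := volume) (m := (R : ℤ)) (by omega)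
  -- For fixed `p` the integral over `y` and `ζ` converges absolutely, so the ordinary Fubini
  -- theorem applies.
  have step1 : ∀ p, ∫ y, ∫ ζ, u (p, ζ) * (ech (-⟪y, κ • p - θ ζ⟫_ℝ) * f ((p, ζ), y)) =
      ∫ ζ, ∫ y, u (p, ζ) * (ech (-⟪y, κ • p - θ ζ⟫_ℝ) * f ((p, ζ), y)) := by
    intro p
    refine integral_integral_swap ?_
    obtain ⟨C, hC, h1⟩ := (hf 0 (M + R)).bound
    refine ((iP.mul_prod iZ).const_mul (C * jb m p)).mono'
      (Continuous.aestronglyMeasurable (by simp only [Function.uncurry_def]; fun_prop))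
      (Filter.Eventually.of_forall fun x => ?_)
    simp only [Function.uncurry_def, norm_mul, hu1, norm_ech, one_mul]
    refine (h1 () _).trans ?_
    have e1 : jb (-((M + R : ℕ) : ℤ)) x.2 ≤ jb (-(R : ℤ)) x.2 := jb_mono (by omega) _
    have e2 : jb (-((M + R : ℕ) : ℤ)) x.1 ≤ jb (-(M : ℤ)) x.1 := jb_mono (by omega) _
    calc _ ≤ C * (jb m p * jb (-(R : ℤ)) x.2 * jb (-(M : ℤ)) x.1) := by
          have := jb_nonneg m p
          have := jb_nonneg (-((M + R : ℕ) : ℤ)) x.1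
          have := jb_nonneg (-(R : ℤ)) x.2
          gcongr
      _ = _ := by ring
  have inner : ∀ p ζ, ∫ y, u (p, ζ) * (ech (-⟪y, κ • p - θ ζ⟫_ℝ) * f ((p, ζ), y)) =
      u (p, ζ) * pft f ((p, ζ), κ • p - θ ζ) := by
    intro p ζ
    rw [integral_const_mul, pft_eq_integral]
    rfl
  simp only [step1, inner]
  -- Integrability in `p` appears only once `y` is integrated out. The partial transform decays in
  -- κp - θζ; by Peetre's inequality this is decay in `p` at the price of growth in `ζ`, which the
  -- rapid decay in `ζ` absorbs. The choice of `N` leaves an integrable power after the growth of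
  -- order `m` in `p`.
  have hint : Integrable (Function.uncurry fun (p : Position d) (ζ : Z) =>
      u (p, ζ) * pft f ((p, ζ), κ • p - θ ζ)) (volume.prod volume) := by
    set N : ℕ := M + m.toNat with hN
    have hw : Continuous fun x : Position d × Z => jb m x.1 * jb (-((M + N + R : ℕ) : ℤ)) x.2 :=
      ((continuous_jb m).comp continuous_fst).mul ((continuous_jb _).comp continuous_snd)
    have h1 := pft_symB (Y := Position d) 0 N hw
      (fun x => mul_nonneg (jb_nonneg _ _) (jb_nonneg _ _)) (m := M) (by omega)
      (f := fun _ : Unit => f) ((hf (0 + N) (M + N + R)).mono' fun x =>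
        mul_le_mul_of_nonneg_left (jb_mono (by push_cast; omega) _)
          (mul_nonneg (jb_nonneg _ _) (jb_nonneg _ _)))
    obtain ⟨C, hC, h2⟩ := h1.bound
    have hpc : Continuous (pft f) := (h1.1 ()).continuous
    obtain ⟨K, hK, hK'⟩ := jb_neg_smul_le (X := Position d) hκ (m := (N : ℤ)) (by positivity)
    obtain ⟨D, hD, hD'⟩ := jb_clm_le (-θ) (m := (N : ℤ)) (by positivity)
    refine ((iP.mul_prod iZ).const_mul (C * (K * D))).mono'
      (Continuous.aestronglyMeasurable (by simp only [Function.uncurry_def]; fun_prop))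
      (Filter.Eventually.of_forall fun x => ?_)
    obtain ⟨p, ζ⟩ := x
    simp only [Function.uncurry_apply_pair, norm_mul, hu1, one_mul]
    refine (h2 () _).trans ?_
    have e1 : jb (-(N : ℤ)) (κ • p - θ ζ) ≤ (K * jb (-(N : ℤ)) p) * (D * jb (N : ℤ) ζ) := by
      have := jb_neg_add_le (m := (N : ℤ)) (by positivity) (κ • p) ((-θ) ζ)
      rw [neg_apply, ← sub_eq_add_neg] at this
      refine this.trans (mul_le_mul (hK' p) ?_ (jb_nonneg _ _)
        (mul_nonneg hK (jb_nonneg _ _)))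
      simpa using hD' ζ
    have e2 : jb m p * jb (-(N : ℤ)) p = jb (-(M : ℤ)) p := by
      rw [← jb_add]; congr 1
      rw [hN]; push_cast [Int.toNat_of_nonneg hm]; ring
    have e3 : jb (-((M + N + R : ℕ) : ℤ)) ζ * jb (N : ℤ) ζ ≤ jb (-(R : ℤ)) ζ := by
      rw [← jb_add]; exact jb_mono (by push_cast; omega) _
    calc _ ≤ C * (jb m p * jb (-((M + N + R : ℕ) : ℤ)) ζ *
          ((K * jb (-(N : ℤ)) p) * (D * jb (N : ℤ) ζ))) := by
          have := jb_nonneg m p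
          have := jb_nonneg (-((M + N + R : ℕ) : ℤ)) ζ
          gcongr
      _ = C * (K * D) * ((jb m p * jb (-(N : ℤ)) p) *
          (jb (-((M + N + R : ℕ) : ℤ)) ζ * jb (N : ℤ) ζ)) := by ring
      _ ≤ C * (K * D) * (jb (-(M : ℤ)) p * jb (-(R : ℤ)) ζ) := by
          rw [e2]
          have := jb_nonneg (-(M : ℤ)) p
          gcongr
  exact ⟨integral_integral_swap hint, hint.integral_prod_right⟩

end Exchange

/-! ### Symbols given as superpositions of characters -/

section Superposition

variable {ι : Type} {d : ℕ}

/-- The superposition `z ↦ ∫ exp (2πi ζ·z) σ(z, ζ) dζ`. -/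
def symInt (σ : Phase d × Phase d → ℂ) (z : Phase d) : ℂ := ∫ ζ, ech ⟪ζ, z⟫_ℝ * σ (z, ζ)

lemma symInt_eq_pft (σ : Phase d × Phase d → ℂ) (z : Phase d) : symInt σ z = pft σ (z, -z) := by
  rw [symInt, pft_eq_integral]
  simp

/-- The superposition is a partial Fourier transform restricted to frequency -z, so `N` derivatives
in `ζ` lower the order in `z` by `N`. -/
lemma symInt_symB {k N : ℕ} {m : ℤ} {σ : ι → Phase d × Phase d → ℂ}
    (hσ : SymB (k + N) (fun x : Phase d × Phase d => jb m x.1 * jb (-((2 * d + 1 : ℕ) + k)) x.2) σ) :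
    SymB k (jb (m - N)) (fun i => symInt (σ i)) := by
  have h1 := pft_symB (Y := Phase d) k N (w := jb m) (continuous_jb m) (fun x => jb_nonneg _ _)
    (m := (2 * d + 1 : ℕ)) (by rw [finrank_phase]; push_cast; omega) hσ
  have h2 := h1.comp_affine (fun _ => (ContinuousLinearMap.id ℝ (Phase d)).prod
    (-ContinuousLinearMap.id ℝ (Phase d))) (fun _ => 0) (w' := jb (m - N)) (fun _ => le_rfl)
    zero_le_one ?_
  · simp only [add_zero, ContinuousLinearMap.prod_apply, ContinuousLinearMap.id_apply,
      neg_apply] at h2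
    have e : (fun i => symInt (σ i)) = fun i z => pft (σ i) (z, -z) :=
      funext fun i => funext fun z => symInt_eq_pft _ _
    rw [e]
    exact h2
  · intro _ z
    have : jb (-(N : ℤ)) (-z) = jb (-(N : ℤ)) z := by simp [jb]
    simp only [ContinuousLinearMap.prod_apply, ContinuousLinearMap.id_apply, neg_apply, add_zero,
      one_mul, this]
    rw [sub_eq_add_neg, jb_add]

/-- Amplitudes of order `m` in the first variable and rapidly decreasing in the second. -/
def Amp (m : ℤ) (σ : ι → Phase d × Phase d → ℂ) : Prop :=
  ∀ n : ℕ, ∀ k : ℤ, SymB n (fun x : Phase d × Phase d => jb m x.1 * jb k x.2) σ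

lemma Amp.schwartzB {m : ℤ} {σ : ι → Phase d × Phase d → ℂ} (hσ : Amp m σ) :
    SchwartzB (fun i => symInt (σ i)) := by
  refine SchwartzB.of_neg fun N n => ?_
  refine (symInt_symB (N := N + m.toNat) (k := n) (hσ _ _)).mono' fun z => jb_mono ?_ _
  push_cast
  omega

/-- The growth of the shifted factor splits between `z` and `ζ`, and the decay of `a` absorbs the
part in `ζ`. The differentiability order is fixed because the dilated symbols for large ε are
normalised separately for each `n`. -/
lemma symB_mul_shift {n : ℕ} {m k : ℤ} (hm : 0 ≤ m) {a : ι → Phase d → ℂ}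
    (ha : SymB n (jb (k - m)) a) {b : ι → Phase d → ℂ} (hb : SymB n (jb m) b) (c : ι → ℝ) {K : ℝ}
    (hK : 0 ≤ K) (hc : ∀ i, |c i| ≤ K) :
    SymB n (fun x : Phase d × Phase d => jb m x.1 * jb k x.2)
      (fun i (x : Phase d × Phase d) => a i x.2 * b i (x.1 + c i • symJ d x.2)) := by
  have h1 : SymB n (fun x : Phase d × Phase d => jb (k - m) x.2)
      (fun i (x : Phase d × Phase d) => a i (ContinuousLinearMap.snd ℝ (Phase d) (Phase d) x + 0)) :=
    ha.comp_affine (fun _ => ContinuousLinearMap.snd ℝ (Phase d) (Phase d))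
      (fun _ => 0) (fun _ => le_rfl) zero_le_one (fun _ x => by simp)
  obtain ⟨D, hD, hD'⟩ := jb_clm_le (X := Phase d) (Y := Phase d) (K • symJ d) hm
  have h2 : SymB n (fun x : Phase d × Phase d => jb m x.1 * jb m x.2)
      (fun i (x : Phase d × Phase d) => b i ((ContinuousLinearMap.fst ℝ (Phase d) (Phase d) +
        c i • (symJ d).comp (ContinuousLinearMap.snd ℝ (Phase d) (Phase d))) x + 0)) := by
    refine hb.comp_affine (fun i => ContinuousLinearMap.fst ℝ (Phase d) (Phase d) +
        c i • (symJ d).comp (ContinuousLinearMap.snd ℝ (Phase d) (Phase d))) (fun _ => 0)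
        (K := ‖ContinuousLinearMap.fst ℝ (Phase d) (Phase d)‖ + K *
          ‖(symJ d).comp (ContinuousLinearMap.snd ℝ (Phase d) (Phase d))‖) (fun i => ?_) hD ?_
    · refine (norm_add_le _ _).trans (add_le_add le_rfl ?_)
      rw [norm_smul]
      exact mul_le_mul_of_nonneg_right (hc i) (norm_nonneg _)
    · intro i x
      simp only [add_zero, add_apply, smul_apply, ContinuousLinearMap.coe_fst',
        ContinuousLinearMap.coe_snd', ContinuousLinearMap.comp_apply]
      refine (jb_add_le_mul hm _ _).trans ?_
      have e : jb m (c i • symJ d x.2) ≤ D * jb m x.2 := by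
        refine le_trans (jb_le_of_norm_le hm ?_) (hD' x.2)
        rw [smul_apply, norm_smul, norm_smul, Real.norm_eq_abs, Real.norm_eq_abs, abs_of_nonneg hK]
        exact mul_le_mul_of_nonneg_right (hc i) (norm_nonneg _)
      calc _ ≤ jb m x.1 * (D * jb m x.2) := mul_le_mul_of_nonneg_left e (jb_nonneg _ _)
        _ = _ := by ring
  have h3 := h1.bilin (ContinuousLinearMap.mul ℝ ℂ) h2
  simp only [add_zero] at h3
  refine SymB.mono' (f := fun i (x : Phase d × Phase d) => a i x.2 * b i (x.1 + c i • symJ d x.2))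
    h3 fun x => le_of_eq ?_
  rw [mul_comm (jb m x.1), ← mul_assoc, ← jb_add, mul_comm]
  congr 2; ring

lemma amp_mul_shift {m : ℤ} (hm : 0 ≤ m) {a : ι → Phase d → ℂ} (ha : SchwartzB a)
    {b : ι → Phase d → ℂ} (hb : OfOrder m b) (c : ι → ℝ) {K : ℝ} (hK : 0 ≤ K)
    (hc : ∀ i, |c i| ≤ K) :
    Amp m (fun i (x : Phase d × Phase d) => a i x.2 * b i (x.1 + c i • symJ d x.2)) :=
  fun n k => symB_mul_shift hm (ha (k - m) n) (hb n) c hK hc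

end Superposition

/-! ### The exact composition formula -/

section WeylCalculus

open scoped FourierTransform

variable {d : ℕ}

/-- Weyl quantization commutes with superpositions of symbols. -/
theorem opC_symInt (h : ℝ) (hh : h ≠ 0) {m : ℤ} (hm : 0 ≤ m) {σ : Phase d × Phase d → ℂ}
    (hσ : Amp m (fun _ : Unit => σ)) {ψ : Position d → ℂ} (hψ : SchwartzB (fun _ : Unit => ψ))
    (q : Position d) :
    opC h (symInt σ) ψ q = ∫ ζ, opC h (fun z => ech ⟪ζ, z⟫_ℝ * σ (z, ζ)) ψ q ∧
    Integrable fun ζ => opC h (fun z => ech ⟪ζ, z⟫_ℝ * σ (z, ζ)) ψ q := by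
  set f : (Position d × Phase d) × Position d → ℂ := fun x =>
    σ (phasePt ((1 / 2 : ℝ) • (q + x.2)) x.1.1, x.1.2) * ψ x.2 with hf
  -- This collects the part of the phase independent of `y`. The rest is linear in `y`, with
  -- frequency h⁻¹p minus half the position part of `ζ`.
  set u : Position d × Phase d → ℂ := fun x =>
    ech (⟪posL d x.2, (1 / 2 : ℝ) • q⟫_ℝ + ⟪momL d x.2, x.1⟫_ℝ + h⁻¹ * ⟪q, x.1⟫_ℝ) with hu
  have hf1 : ∀ n N : ℕ, SymB n (fun x : (Position d × Phase d) × Position d =>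
      (jb m x.1.1 * jb (-(N : ℤ)) x.1.2) * jb (-(N : ℤ)) x.2) (fun _ : Unit => f) := by
    intro n N
    let L : (Position d × Phase d) × Position d →L[ℝ] Phase d × Phase d :=
      ((phaseL d).comp (ContinuousLinearMap.prod
        ((1 / 2 : ℝ) • ContinuousLinearMap.snd ℝ (Position d × Phase d) (Position d))
        ((ContinuousLinearMap.fst ℝ (Position d) (Phase d)).comp
          (ContinuousLinearMap.fst ℝ (Position d × Phase d) (Position d))))).prod
        ((ContinuousLinearMap.snd ℝ (Position d) (Phase d)).comp
          (ContinuousLinearMap.fst ℝ (Position d × Phase d) (Position d)))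
    have hL : ∀ x, L x + (phasePt ((1 / 2 : ℝ) • q) 0, 0) =
        (phasePt ((1 / 2 : ℝ) • (q + x.2)) x.1.1, x.1.2) := by
      intro x
      refine Prod.ext ?_ ?_
      · ext i; rcases i with i | i <;> simp [L, phasePt]; ring
      · simp [L]
    have h1 : SymB n (fun x : (Position d × Phase d) × Position d =>
        jb m x.1.1 * jb (-(N : ℤ)) x.1.2 * jb m x.2)
        (fun (_ : Unit) x => σ (L x + (phasePt ((1 / 2 : ℝ) • q) 0, 0))) := by
      refine (hσ n (-(N : ℤ))).comp_affine (fun _ => L) (fun _ => (phasePt ((1 / 2 : ℝ) • q) 0, 0))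
        (fun _ => le_rfl) (K' := jb m q) (jb_nonneg _ _) (fun _ x => ?_)
      rw [hL]
      calc _ ≤ (jb m q * jb m x.1.1 * jb m x.2) * jb (-(N : ℤ)) x.1.2 :=
            mul_le_mul_of_nonneg_right (jb_mid_le hm _ _ _) (jb_nonneg _ _)
        _ = _ := by ring
    have h2 : SymB n (fun x : (Position d × Phase d) × Position d => jb (-(N : ℤ) - m) x.2)
        (fun (_ : Unit) x => ψ (ContinuousLinearMap.snd ℝ (Position d × Phase d) (Position d) x + 0)) :=
      (hψ (-(N : ℤ) - m) n).comp_affine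
        (fun _ => ContinuousLinearMap.snd ℝ (Position d × Phase d) (Position d)) (fun _ => 0)
        (fun _ => le_rfl) zero_le_one (fun _ x => by simp)
    have h3 := h1.bilin (ContinuousLinearMap.mul ℝ ℂ) h2
    simp only [add_zero, hL] at h3
    refine SymB.mono' (f := fun _ : Unit => f) h3 fun x => le_of_eq ?_
    rw [mul_assoc _ (jb m x.2), ← jb_add]
    congr 2; ring
  have hfc : Continuous f := ((hf1 0 0).1 ()).continuous
  have key : ∀ p y ζ, u (p, ζ) * (ech (-⟪y, h⁻¹ • p - ((1 / 2 : ℝ) • posL d) ζ⟫_ℝ) *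
      f ((p, ζ), y)) = (ech ⟪ζ, phasePt ((1 / 2 : ℝ) • (q + y)) p⟫_ℝ *
        σ (phasePt ((1 / 2 : ℝ) • (q + y)) p, ζ)) * ech (h⁻¹ * ⟪q - y, p⟫_ℝ) * ψ y := by
    intro p y ζ
    have e : u (p, ζ) * ech (-⟪y, h⁻¹ • p - ((1 / 2 : ℝ) • posL d) ζ⟫_ℝ) =
        ech ⟪ζ, phasePt ((1 / 2 : ℝ) • (q + y)) p⟫_ℝ * ech (h⁻¹ * ⟪q - y, p⟫_ℝ) := by
      rw [hu, ← ech_add, ← ech_add]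
      congr 1
      have c2 : ⟪y, posL d ζ⟫_ℝ = ⟪posL d ζ, y⟫_ℝ := real_inner_comm _ _
      simp only [inner_phase, posL_phasePt, momL_phasePt, smul_apply, inner_add_right,
        inner_sub_left, inner_sub_right, inner_smul_right, c2]
      ring
    simp only [hf]
    linear_combination (σ (phasePt ((1 / 2 : ℝ) • (q + y)) p, ζ) * ψ y) * e
  have hucont : Continuous u := by
    have h1 := (posL d).continuous
    have h2 := (momL d).continuous
    simp only [hu]
    fun_prop
  obtain ⟨s1, s2⟩ := oscillatory_integral_swap hm hf1 hucont (fun x => norm_ech _)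
    (inv_ne_zero hh) ((1 / 2 : ℝ) • posL d)
  simp only [key] at s1 s2
  constructor
  · simp only [opC, integral_const_mul]
    rw [← s1]
    congr 1
    refine integral_congr_ae (Filter.Eventually.of_forall fun p => ?_)
    refine integral_congr_ae (Filter.Eventually.of_forall fun y => ?_)
    simp only [symInt]
    rw [← integral_mul_const, ← integral_mul_const]
  · simp only [opC]
    exact s2.const_mul _

/-- Weyl quantization commutes with superpositions of phase space translations. -/
theorem opC_integral_opTrans (h : ℝ) (hh : h ≠ 0) {m : ℤ} (hm : 0 ≤ m) {b : Phase d → ℂ}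
    (hb : OfOrder m (fun _ : Unit => b)) {α : Phase d → ℂ} (hα : SchwartzB (fun _ : Unit => α))
    {ψ : Position d → ℂ} (hψ : SchwartzB (fun _ : Unit => ψ)) (q : Position d) :
    opC h b (fun y => ∫ ζ, α ζ * opTrans h ζ ψ y) q = ∫ ζ, α ζ * opC h b (opTrans h ζ ψ) q := by
  set f : (Position d × Phase d) × Position d → ℂ := fun x =>
    b (phasePt ((1 / 2 : ℝ) • (q + x.2)) x.1.1) * (α x.1.2 * ψ (x.2 + h • momL d x.1.2)) with hf
  set u : Position d × Phase d → ℂ := fun x =>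
    ech (⟪posL d x.2, (h / 2) • momL d x.2⟫_ℝ + h⁻¹ * ⟪q, x.1⟫_ℝ) with hu
  have hf1 : ∀ n N : ℕ, SymB n (fun x : (Position d × Phase d) × Position d =>
      (jb m x.1.1 * jb (-(N : ℤ)) x.1.2) * jb (-(N : ℤ)) x.2) (fun _ : Unit => f) := by
    intro n N
    let S := ContinuousLinearMap.snd ℝ (Position d × Phase d) (Position d)
    let T := ContinuousLinearMap.fst ℝ (Position d × Phase d) (Position d)
    let L : (Position d × Phase d) × Position d →L[ℝ] Phase d :=
      (phaseL d).comp (ContinuousLinearMap.prod ((1 / 2 : ℝ) • S)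
        ((ContinuousLinearMap.fst ℝ (Position d) (Phase d)).comp T))
    have hL : ∀ x, L x + phasePt ((1 / 2 : ℝ) • q) 0 =
        phasePt ((1 / 2 : ℝ) • (q + x.2)) x.1.1 := by
      intro x
      ext i; rcases i with i | i <;> simp [L, S, T, phasePt]; ring
    have h1 : SymB n (fun x : (Position d × Phase d) × Position d => jb m x.1.1 * jb m x.2)
        (fun (_ : Unit) x => b (L x + phasePt ((1 / 2 : ℝ) • q) 0)) := by
      refine (hb n).comp_affine (fun _ => L) (fun _ => phasePt ((1 / 2 : ℝ) • q) 0)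
        (fun _ => le_rfl) (K' := jb m q) (jb_nonneg _ _) (fun _ x => ?_)
      rw [hL]
      exact (jb_mid_le hm _ _ _).trans_eq (by ring)
    set M : ℤ := N + m with hM
    have hM0 : 0 ≤ M := by omega
    obtain ⟨D, hD, hD'⟩ := jb_clm_le (X := Phase d) (Y := Position d) (h • momL d) hM0
    have h2 : SymB n (fun x : (Position d × Phase d) × Position d =>
        jb (-M) x.2 * jb M x.1.2)
        (fun (_ : Unit) x => ψ ((S + (h • momL d).comp
          ((ContinuousLinearMap.snd ℝ (Position d) (Phase d)).comp T)) x + 0)) := by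
      refine (hψ (-M) n).comp_affine (fun _ => S + (h • momL d).comp
          ((ContinuousLinearMap.snd ℝ (Position d) (Phase d)).comp T)) (fun _ => 0)
        (fun _ => le_rfl) hD (fun _ x => ?_)
      rw [add_zero, add_apply]
      refine (jb_neg_add_le hM0 _ _).trans ?_
      calc _ ≤ jb (-M) x.2 * (D * jb M x.1.2) :=
            mul_le_mul_of_nonneg_left (hD' x.1.2) (jb_nonneg _ _)
        _ = _ := by ring
    have h3 : SymB n (fun x : (Position d × Phase d) × Position d => jb (-(N : ℤ) - M) x.1.2)
        (fun (_ : Unit) x => α (((ContinuousLinearMap.snd ℝ (Position d) (Phase d)).comp T) x + 0)) :=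
      (hα (-(N : ℤ) - M) n).comp_affine
        (fun _ => (ContinuousLinearMap.snd ℝ (Position d) (Phase d)).comp T) (fun _ => 0)
        (fun _ => le_rfl) zero_le_one (fun _ x => by simp [T])
    have h4 := h1.bilin (ContinuousLinearMap.mul ℝ ℂ) (h3.bilin (ContinuousLinearMap.mul ℝ ℂ) h2)
    simp only [add_zero, hL] at h4
    refine SymB.mono' (f := fun _ : Unit => f) h4 fun x => le_of_eq ?_
    have e1 : jb (-(N : ℤ) - M) x.1.2 * jb M x.1.2 = jb (-(N : ℤ)) x.1.2 := by
      rw [← jb_add]; congr 1; ring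
    have e2 : jb m x.2 * jb (-M) x.2 = jb (-(N : ℤ)) x.2 := by
      rw [← jb_add]; congr 1; omega
    rw [← e1, ← e2]
    ring
  have hfc : Continuous f := ((hf1 0 0).1 ()).continuous
  have key : ∀ p y ζ, u (p, ζ) * (ech (-⟪y, h⁻¹ • p - posL d ζ⟫_ℝ) *
      f ((p, ζ), y)) = b (phasePt ((1 / 2 : ℝ) • (q + y)) p) * ech (h⁻¹ * ⟪q - y, p⟫_ℝ) *
        (α ζ * opTrans h ζ ψ y) := by
    intro p y ζ
    have e : u (p, ζ) * ech (-⟪y, h⁻¹ • p - posL d ζ⟫_ℝ) =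
        ech (h⁻¹ * ⟪q - y, p⟫_ℝ) * ech ⟪posL d ζ, y + (h / 2) • momL d ζ⟫_ℝ := by
      rw [hu, ← ech_add, ← ech_add]
      congr 1
      have c2 : ⟪y, posL d ζ⟫_ℝ = ⟪posL d ζ, y⟫_ℝ := real_inner_comm _ _
      simp only [inner_add_right,
        inner_sub_left, inner_sub_right, inner_smul_right, c2]
      ring
    simp only [hf, opTrans]
    linear_combination (b (phasePt ((1 / 2 : ℝ) • (q + y)) p) * α ζ * ψ (y + h • momL d ζ)) * e
  have hucont : Continuous u := by
    have h1 := (posL d).continuous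
    have h2 := (momL d).continuous
    simp only [hu]
    fun_prop
  obtain ⟨s1, s2⟩ := oscillatory_integral_swap hm hf1 hucont (fun x => norm_ech _)
    (inv_ne_zero hh) (posL d)
  simp only [key] at s1 s2
  simp only [opC, ← integral_const_mul] at s1 ⊢
  simp only [integral_const_mul] at s1 ⊢
  rw [s1, ← integral_const_mul]
  refine integral_congr_ae (Filter.Eventually.of_forall fun ζ => ?_)
  simp only
  rw [mul_left_comm]
  congr 1
  rw [← integral_const_mul]
  refine integral_congr_ae (Filter.Eventually.of_forall fun p => ?_)
  simp only
  rw [← integral_const_mul]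
  refine integral_congr_ae (Filter.Eventually.of_forall fun y => ?_)
  simp only
  ring

/-- Fourier inversion after rescaling `p` by h; the Jacobian cancels the prefactor. -/
lemma opC_one {h : ℝ} (hh : 0 < h) {ψ : Position d → ℂ} (hψ : SchwartzB (fun _ : Unit => ψ)) :
    opC h (fun _ => 1) ψ = ψ := by
  ext q
  have e1 : ∀ p, weylInner h (fun _ => 1) ψ (q, p) = 𝓕 ψ (h⁻¹ • p) := fun p => by
    simp [weylInner, weylAmp, pft]
  rw [opC_eq_integral_inner]
  simp only [e1]
  have e2 := Measure.integral_comp_smul (volume : Measure (Position d))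
    (fun p => ech ⟪q, p⟫_ℝ * 𝓕 ψ p) h⁻¹
  simp only [inner_smul_right] at e2
  rw [e2]
  have e3 : 𝓕⁻ (𝓕 ψ) q = ψ q := by
    have := congrFun (congrArg (fun f : 𝓢(Position d, ℂ) => (f : Position d → ℂ))
      (FourierTransform.fourierInv_fourier_eq (F := 𝓢(Position d, ℂ)) hψ.toSchwartz)) q
    rw [SchwartzMap.fourierInv_coe, SchwartzMap.fourier_coe] at this
    exact this
  rw [Real.fourierInv_eq] at e3
  have e4 : ∫ p, ech ⟪q, p⟫_ℝ * 𝓕 ψ p = ψ q := by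
    rw [← e3]
    refine integral_congr_ae (Filter.Eventually.of_forall fun p => ?_)
    simp only [real_inner_comm p q]
    rfl
  rw [e4]
  have : (h ^ d : ℝ) ≠ 0 := by positivity
  simp only [finrank_euclideanSpace, Fintype.card_fin, inv_pow, inv_inv]
  rw [abs_of_pos (by positivity), Complex.real_smul, ← mul_assoc, ← Complex.ofReal_mul,
    inv_mul_cancel₀ this]
  simp

lemma ofOrder_one : OfOrder 0 (fun (_ : Unit) (_ : Phase d) => (1 : ℂ)) := fun n =>
  (SymB.const zero_le_one (fun _ => by simp)).mono' fun x => by simp [jb_zero]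

/-- Fourier inversion. -/
lemma symInt_fourier {a : Phase d → ℂ} (ha : SchwartzB (fun _ : Unit => a)) :
    symInt (fun x : Phase d × Phase d => 𝓕 a x.2) = a := by
  ext z
  have := congrFun (congrArg (fun f : 𝓢(Phase d, ℂ) => (f : Phase d → ℂ))
    (FourierTransform.fourierInv_fourier_eq (F := 𝓢(Phase d, ℂ)) ha.toSchwartz)) z
  rw [SchwartzMap.fourierInv_coe, SchwartzMap.fourier_coe] at this
  have h2 : 𝓕⁻ (𝓕 a) z = a z := this
  rw [← h2, Real.fourierInv_eq, symInt]
  rfl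

/-- The Fourier representation of the Weyl quantization of a Schwartz symbol. -/
lemma opC_eq_integral_opTrans {h : ℝ} (hh : 0 < h) {a : Phase d → ℂ}
    (ha : SchwartzB (fun _ : Unit => a)) {ψ : Position d → ℂ} (hψ : SchwartzB (fun _ : Unit => ψ))
    (q : Position d) :
    opC h a ψ q = ∫ ζ, 𝓕 a ζ * opTrans h ζ ψ q := by
  have hF : SchwartzB (fun _ : Unit => 𝓕 a) := schwartzB_coe (𝓕 ha.toSchwartz)
  have hamp := amp_mul_shift le_rfl hF ofOrder_one (fun _ => 0) le_rfl (by simp)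
  simp only [mul_one] at hamp
  have e := symInt_fourier ha
  have h1 := (opC_symInt h hh.ne' le_rfl hamp hψ q).1
  rw [e] at h1
  rw [h1]
  refine integral_congr_ae (Filter.Eventually.of_forall fun ζ => ?_)
  simp only
  have h2 := opC_opTrans hh.ne' (fun _ => 1) ζ ψ q
  -- Since op(1) is the identity, this exhibits the translation itself as the quantization of a
  -- character.
  have h3 := opTrans_opC hh.ne' (fun _ => 1) ζ ψ q
  rw [opC_one hh hψ] at h3
  simp only [mul_one] at h3
  rw [h3, ← opC_const_mul]
  congr 1
  ext z
  ring

/-- The Moyal product without expansion: write op(a) as a superposition of translations, take op(b)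
inside, absorb each translation into the symbol, and resum. -/
lemma opC_comp_left {h : ℝ} (hh : 0 < h) {m : ℤ} (hm : 0 ≤ m) {b : Phase d → ℂ}
    (hb : OfOrder m (fun _ : Unit => b)) {a : Phase d → ℂ}
    (ha : SchwartzB (fun _ : Unit => a)) {ψ : Position d → ℂ} (hψ : SchwartzB (fun _ : Unit => ψ))
    (q : Position d) :
    opC h b (opC h a ψ) q = opC h (symInt fun x => 𝓕 a x.2 * b (x.1 + (-(h / 2)) • symJ d x.2)) ψ q := by
  have hF : SchwartzB (fun _ : Unit => 𝓕 a) := schwartzB_coe (𝓕 ha.toSchwartz)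
  have e : opC h a ψ = fun y => ∫ ζ, 𝓕 a ζ * opTrans h ζ ψ y :=
    funext fun y => opC_eq_integral_opTrans hh ha hψ y
  rw [e, opC_integral_opTrans h hh.ne' hm hb hF hψ,
    (opC_symInt h hh.ne' hm (amp_mul_shift hm hF hb (fun _ => -(h / 2)) (abs_nonneg _)
      (fun _ => le_rfl)) hψ q).1]
  refine integral_congr_ae (Filter.Eventually.of_forall fun ζ => ?_)
  simp only
  rw [opC_opTrans hh.ne', ← opC_const_mul]
  congr 1
  ext z
  rw [neg_smul, ← sub_eq_add_neg]
  ring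

/-- In this order op(b)ψ is already Schwartz, so the representation of op(a) by translations applies
to it directly. -/
lemma opC_comp_right {h : ℝ} (hh : 0 < h) {m : ℤ} (hm : 0 ≤ m) {b : Phase d → ℂ}
    (hb : OfOrder m (fun _ : Unit => b)) {a : Phase d → ℂ}
    (ha : SchwartzB (fun _ : Unit => a)) {ψ : Position d → ℂ} (hψ : SchwartzB (fun _ : Unit => ψ))
    (q : Position d) :
    opC h a (opC h b ψ) q = opC h (symInt fun x => 𝓕 a x.2 * b (x.1 + (h / 2) • symJ d x.2)) ψ q := by
  have hF : SchwartzB (fun _ : Unit => 𝓕 a) := schwartzB_coe (𝓕 ha.toSchwartz)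
  rw [opC_eq_integral_opTrans hh ha (opC_schwartz hh.ne' hm hb hψ),
    (opC_symInt h hh.ne' hm (amp_mul_shift hm hF hb (fun _ => h / 2) (abs_nonneg _)
      (fun _ => le_rfl)) hψ q).1]
  refine integral_congr_ae (Filter.Eventually.of_forall fun ζ => ?_)
  simp only
  rw [opTrans_opC hh.ne', ← opC_const_mul]
  congr 1
  ext z
  ring

end WeylCalculus

/-! ### Schur's test and Hermitian kernels -/

section KernelOperators

variable {d : ℕ}

/-- Schur's test for a kernel dominated by a convolution kernel: both marginal integrals equal the
integral of `g`. -/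
lemma eLpNorm_integral_kernel_le {k : Position d → Position d → ℂ}
    {g : Position d → ℝ} (hgc : Continuous g) (hg : Integrable g)
    (hkg : ∀ q y, ‖k q y‖ ≤ g (y - q)) {ψ : Position d → ℂ} (hψ : AEStronglyMeasurable ψ) :
    eLpNorm (fun q => ∫ y, k q y * ψ y) 2 volume ≤
      ENNReal.ofReal (∫ y, g y) * eLpNorm ψ 2 volume := by
  have hg0 : ∀ y, 0 ≤ g y := fun y => by simpa using (norm_nonneg _).trans (hkg 0 y)
  set γ : Position d → ℝ≥0∞ := fun y => ENNReal.ofReal (g y) with hγ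
  have hγm : Measurable γ := hgc.measurable.ennreal_ofReal
  set M := ENNReal.ofReal (∫ y, g y) with hM
  have hMi : ∫⁻ y, γ y = M :=
    (ofReal_integral_eq_lintegral_ofReal hg (Filter.Eventually.of_forall hg0)).symm
  have hMq : ∀ q, ∫⁻ y, γ (y - q) = M := fun q => by
    rw [← hMi]; exact lintegral_sub_right_eq_self γ q
  have hMy : ∀ y, ∫⁻ q, γ (y - q) = M := fun y => by
    rw [← hMi]; exact lintegral_sub_left_eq_self γ y
  have hψm : AEMeasurable (fun y => ‖ψ y‖ₑ) := hψ.enorm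
  -- Cauchy-Schwarz after splitting γ|ψ| as the square root of γ times the square root of γ|ψ|².
  have pt : ∀ q, ‖∫ y, k q y * ψ y‖ₑ ^ (2 : ℝ) ≤ M * ∫⁻ y, γ (y - q) * ‖ψ y‖ₑ ^ (2 : ℝ) := by
    intro q
    have h1 : ‖∫ y, k q y * ψ y‖ₑ ≤
        ∫⁻ y, γ (y - q) ^ (1 / 2 : ℝ) * (γ (y - q) * ‖ψ y‖ₑ ^ (2 : ℝ)) ^ (1 / 2 : ℝ) := by
      refine (enorm_integral_le_lintegral_enorm _).trans (lintegral_mono fun y => ?_)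
      rw [ENNReal.mul_rpow_of_nonneg _ _ (by norm_num), ← mul_assoc,
        ← ENNReal.rpow_add_of_nonneg _ _ (by norm_num) (by norm_num), ← ENNReal.rpow_mul]
      norm_num
      gcongr
      rw [← ofReal_norm]
      exact ENNReal.ofReal_le_ofReal (hkg q y)
    have hm1 : AEMeasurable (fun y => γ (y - q)) := (hγm.comp (measurable_id.sub_const q)).aemeasurable
    have h2 : ∫⁻ y, γ (y - q) ^ (1 / 2 : ℝ) * (γ (y - q) * ‖ψ y‖ₑ ^ (2 : ℝ)) ^ (1 / 2 : ℝ) ≤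
        (∫⁻ y, γ (y - q)) ^ (1 / 2 : ℝ) * (∫⁻ y, γ (y - q) * ‖ψ y‖ₑ ^ (2 : ℝ)) ^ (1 / 2 : ℝ) :=
      ENNReal.lintegral_mul_norm_pow_le (μ := volume) hm1 (hm1.mul (hψm.pow_const 2))
      (p := 1 / 2) (q := 1 / 2) (by norm_num) (by norm_num) (by norm_num)
    rw [hMq q, ← ENNReal.mul_rpow_of_nonneg _ _ (by norm_num)] at h2
    have h3 := ENNReal.rpow_le_rpow (h1.trans h2) (z := 2) (by norm_num)
    rw [← ENNReal.rpow_mul] at h3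
    simpa using h3
  have tot : ∫⁻ q, ‖∫ y, k q y * ψ y‖ₑ ^ (2 : ℝ) ≤ M ^ (2 : ℝ) * ∫⁻ y, ‖ψ y‖ₑ ^ (2 : ℝ) := by
    calc _ ≤ ∫⁻ q, M * ∫⁻ y, γ (y - q) * ‖ψ y‖ₑ ^ (2 : ℝ) := lintegral_mono pt
      _ = M * ∫⁻ q, ∫⁻ y, γ (y - q) * ‖ψ y‖ₑ ^ (2 : ℝ) := by
          rw [lintegral_const_mul' _ _ ENNReal.ofReal_ne_top]
      _ = M * ∫⁻ y, ∫⁻ q, γ (y - q) * ‖ψ y‖ₑ ^ (2 : ℝ) := by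
          congr 1
          refine lintegral_lintegral_swap ?_
          refine AEMeasurable.mul ?_ ?_
          · exact (hγm.comp (measurable_snd.sub measurable_fst)).aemeasurable
          · exact (hψm.pow_const 2).comp_quasiMeasurePreserving
              Measure.quasiMeasurePreserving_snd
      _ = M * ∫⁻ y, M * ‖ψ y‖ₑ ^ (2 : ℝ) := by
          congr 1
          refine lintegral_congr fun y => ?_
          have hm : Measurable fun q => γ (y - q) := hγm.comp (measurable_const.sub measurable_id)
          rw [lintegral_mul_const _ hm, hMy y]
      _ = _ := by
          rw [lintegral_const_mul' _ _ ENNReal.ofReal_ne_top, ← mul_assoc]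
          congr 1
          rw [ENNReal.rpow_two, sq]
  rw [eLpNorm_eq_lintegral_rpow_enorm_toReal (by norm_num) (by norm_num),
    eLpNorm_eq_lintegral_rpow_enorm_toReal (by norm_num) (by norm_num)]
  simp only [ENNReal.toReal_ofNat]
  calc _ ≤ (M ^ (2 : ℝ) * ∫⁻ y, ‖ψ y‖ₑ ^ (2 : ℝ)) ^ (1 / 2 : ℝ) :=
        ENNReal.rpow_le_rpow tot (by norm_num)
    _ = _ := by
        rw [ENNReal.mul_rpow_of_nonneg _ _ (by norm_num), ← ENNReal.rpow_mul]
        norm_num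

/-- An integral operator with continuous kernel dominated by an integrable convolution kernel is
bounded on `L²`. -/
theorem exists_clm_of_kernel {k : Position d → Position d → ℂ}
    (hk : Continuous (Function.uncurry k)) (hk2 : ∀ q, MemLp (k q) 2)
    {g : Position d → ℝ} (hgc : Continuous g) (hg : Integrable g)
    (hkg : ∀ q y, ‖k q y‖ ≤ g (y - q)) :
    ∃ T : L2 d →L[ℂ] L2 d, (∀ ψ : L2 d, (T ψ : Position d → ℂ) =ᵐ[volume]
      fun q => ∫ y, k q y * ψ y) ∧ ‖T‖ ≤ ∫ y, g y := by
  have hg0 : ∀ y, 0 ≤ g y := fun y => by simpa using (norm_nonneg _).trans (hkg 0 y)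
  have hmem : ∀ ψ : L2 d, MemLp (fun q => ∫ y, k q y * ψ y) 2 := by
    intro ψ
    refine ⟨?_, ?_⟩
    · have : AEStronglyMeasurable (fun x : Position d × Position d => k x.1 x.2 * ψ x.2)
          (volume.prod volume) :=
        hk.aestronglyMeasurable.mul
          ((Lp.aestronglyMeasurable ψ).comp_quasiMeasurePreserving
            Measure.quasiMeasurePreserving_snd)
      exact this.integral_prod_right'
    · refine (eLpNorm_integral_kernel_le hgc hg hkg (Lp.aestronglyMeasurable ψ)).trans_lt ?_
      exact ENNReal.mul_lt_top ENNReal.ofReal_lt_top (Lp.memLp ψ).2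
  have hint : ∀ q (ψ : L2 d), Integrable fun y => k q y * ψ y := fun q ψ =>
    (hk2 q).integrable_mul (Lp.memLp ψ)
  let A : L2 d →ₗ[ℂ] L2 d :=
    { toFun := fun ψ => (hmem ψ).toLp
      map_add' := fun ψ φ => by
        rw [← MemLp.toLp_add]
        refine MemLp.toLp_congr _ _ (Filter.Eventually.of_forall fun q => ?_)
        simp only [Pi.add_apply]
        rw [← integral_add (hint q ψ) (hint q φ)]
        refine integral_congr_ae ?_
        filter_upwards [Lp.coeFn_add ψ φ] with y hy
        rw [hy, Pi.add_apply, mul_add]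
      map_smul' := fun c ψ => by
        rw [RingHom.id_apply, ← MemLp.toLp_const_smul]
        refine MemLp.toLp_congr _ _ (Filter.Eventually.of_forall fun q => ?_)
        simp only [Pi.smul_apply, smul_eq_mul]
        rw [← integral_const_mul]
        refine integral_congr_ae ?_
        filter_upwards [Lp.coeFn_smul c ψ] with y hy
        rw [hy, Pi.smul_apply, smul_eq_mul]
        ring }
  have hA : ∀ ψ, ‖A ψ‖ ≤ (∫ y, g y) * ‖ψ‖ := by
    intro ψ
    have h1 := eLpNorm_integral_kernel_le hgc hg hkg (Lp.aestronglyMeasurable ψ)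
    have h2 : ‖A ψ‖ = ENNReal.toReal (eLpNorm (fun q => ∫ y, k q y * ψ y) 2 volume) :=
      Lp.norm_toLp _ (hmem ψ)
    rw [h2, Lp.norm_def]
    refine (ENNReal.toReal_mono (ENNReal.mul_lt_top ENNReal.ofReal_lt_top (Lp.memLp ψ).2).ne
      h1).trans ?_
    rw [ENNReal.toReal_mul, ENNReal.toReal_ofReal (integral_nonneg hg0)]
  exact ⟨A.mkContinuous _ hA, fun ψ => (hmem ψ).coeFn_toLp,
    A.mkContinuous_norm_le (integral_nonneg hg0) _⟩

/-- On Schwartz functions a bounded kernel makes the double integral absolutely convergent, so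
symmetry is Fubini's theorem. Density and continuity extend it to all of L². -/
lemma isSelfAdjoint_of_kernel {k : Position d → Position d → ℂ}
    (hk : Continuous (Function.uncurry k)) {B : ℝ} (hB : ∀ q y, ‖k q y‖ ≤ B)
    (hsym : ∀ q y, (starRingEnd ℂ) (k q y) = k y q) {T : L2 d →L[ℂ] L2 d}
    (hT : ∀ ψ : L2 d, (T ψ : Position d → ℂ) =ᵐ[volume] fun q => ∫ y, k q y * ψ y) :
    IsSelfAdjoint T := by
  rw [ContinuousLinearMap.isSelfAdjoint_iff_isSymmetric]
  have hd := SchwartzMap.denseRange_toLpCLM (E := Position d) (F := ℂ) (p := 2) (by norm_num)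
    (μ := volume)
  intro ψ φ
  refine hd.induction_on₂ (p := fun ψ φ => ⟪T ψ, φ⟫_ℂ = ⟪ψ, T φ⟫_ℂ) ?_ ?_ ψ φ
  · exact isClosed_eq (by fun_prop) (by fun_prop)
  · intro f g
    simp only [SchwartzMap.toLpCLM_apply]
    rw [L2.inner_def, L2.inner_def]
    have e1 : ∫ q, ⟪(T (f.toLp 2 volume) : Position d → ℂ) q, (g.toLp 2 volume : Position d → ℂ) q⟫_ℂ =
        ∫ q, ∫ y, g q * ((starRingEnd ℂ) (k q y) * (starRingEnd ℂ) (f y)) := by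
      refine integral_congr_ae ?_
      filter_upwards [hT (f.toLp 2 volume), g.coeFn_toLp 2 volume] with q h1 h2
      rw [h1, h2, RCLike.inner_apply, integral_const_mul, ← integral_conj]
      congr 1
      refine integral_congr_ae ?_
      filter_upwards [f.coeFn_toLp 2 volume] with y h3
      rw [h3, map_mul]
    have e2 : ∫ q, ⟪(f.toLp 2 volume : Position d → ℂ) q, (T (g.toLp 2 volume) : Position d → ℂ) q⟫_ℂ =
        ∫ q, ∫ y, g y * ((starRingEnd ℂ) (k y q) * (starRingEnd ℂ) (f q)) := by
      refine integral_congr_ae ?_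
      filter_upwards [hT (g.toLp 2 volume), f.coeFn_toLp 2 volume] with q h1 h2
      rw [h1, h2, RCLike.inner_apply, ← integral_mul_const]
      refine integral_congr_ae ?_
      filter_upwards [g.coeFn_toLp 2 volume] with y h3
      rw [h3, hsym]
      ring
    rw [e1, e2]
    refine integral_integral_swap ?_
    have hk' : Continuous fun x : Position d × Position d => k x.1 x.2 := hk
    refine ((g.integrable.norm.mul_prod f.integrable.norm).const_mul B).mono'
      (Continuous.aestronglyMeasurable ?_) (Filter.Eventually.of_forall fun x => ?_)
    · simp only [Function.uncurry_def]
      have := Complex.continuous_conj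
      have := g.continuous
      have := f.continuous
      fun_prop
    · simp only [Function.uncurry_def, norm_mul, RCLike.norm_conj]
      have := hB x.1 x.2
      calc ‖g x.1‖ * (‖k x.1 x.2‖ * ‖f x.2‖) ≤ ‖g x.1‖ * (B * ‖f x.2‖) := by gcongr
        _ = _ := by ring

end KernelOperators

/-! ### Essential self-adjointness of restricted bounded operators -/

section EssentialSelfAdjointness

variable {H : Type*} [NormedAddCommGroup H] [InnerProductSpace ℂ H] [CompleteSpace H]

/-- The restriction of a bounded self-adjoint operator to a dense subspace is essentially
self-adjoint. -/
theorem isEssentiallySelfAdjoint_toPMap {B : H →L[ℂ] H} (hB : IsSelfAdjoint B)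
    {p : Submodule ℂ H} (hp : Dense (p : Set H)) :
    IsEssentiallySelfAdjoint (B.toLinearMap.toPMap p) := by
  have hgr : ∀ x y, (x, y) ∈ (B.toLinearMap.toPMap ⊤).graph ↔ B x = y := by
    intro x y
    simp
  have hcl : (B.toLinearMap.toPMap ⊤).IsClosed := by
    have : ((B.toLinearMap.toPMap ⊤).graph : Set (H × H)) = {x | B x.1 = x.2} := by
      ext ⟨x, y⟩; exact hgr x y
    unfold LinearPMap.IsClosed
    rw [this]
    exact isClosed_eq (by fun_prop) (by fun_prop)
  have hle : B.toLinearMap.toPMap p ≤ B.toLinearMap.toPMap ⊤ :=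
    ⟨le_top, fun x y hxy => congrArg B hxy⟩
  have hT : (B.toLinearMap.toPMap p).IsClosable := hcl.isClosable.leIsClosable hle
  have hclos : (B.toLinearMap.toPMap p).closure = B.toLinearMap.toPMap ⊤ := by
    refine LinearPMap.eq_of_eq_graph ?_
    rw [← hT.graph_closure_eq_closure_graph]
    refine le_antisymm ?_ ?_
    · exact Submodule.topologicalClosure_minimal _ (LinearPMap.le_graph_of_le hle) hcl
    -- Each point of the full graph is a limit of points over the dense subspace, by continuity of
    -- `B`.
    · rintro ⟨x, y⟩ hxy
      rw [hgr] at hxy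
      subst hxy
      have hx : x ∈ closure (p : Set H) := hp x
      rw [mem_closure_iff_seq_limit] at hx
      obtain ⟨u, hu, hux⟩ := hx
      refine mem_closure_of_tendsto (b := Filter.atTop) (f := fun n => (u n, B (u n)))
        (hux.prodMk_nhds ((B.continuous.tendsto x).comp hux))
        (Filter.Eventually.of_forall fun n => ?_)
      have := (B.toLinearMap.toPMap p).mem_graph ⟨u n, hu n⟩
      exact this
  refine ⟨hp, hT, ?_⟩
  rw [hclos, LinearPMap.isSelfAdjoint_def,
    ContinuousLinearMap.toPMap_adjoint_eq_adjoint_toPMap_of_dense B (by simp),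
    ContinuousLinearMap.isSelfAdjoint_iff'.1 hB]

end EssentialSelfAdjointness

/-! ### L² bounds for Weyl operators with Schwartz symbols -/

section WeylL2

variable {d : ℕ}

/-- The integral kernel of the Weyl quantization. -/
def weylKernel (h : ℝ) (s : Phase d → ℂ) (q y : Position d) : ℂ :=
  ((h ^ d)⁻¹ : ℝ) * pft (fun x => s (phaseL d x)) ((1 / 2 : ℝ) • (q + y), h⁻¹ • (y - q))

lemma weylKernel_eq (h : ℝ) (s : Phase d → ℂ) (q y : Position d) :
    weylKernel h s q y = ((h ^ d)⁻¹ : ℝ) * ∫ p, s (phasePt ((1 / 2 : ℝ) • (q + y)) p) *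
      ech (h⁻¹ * ⟪q - y, p⟫_ℝ) := by
  rw [weylKernel, pft_eq_integral]
  congr 1
  refine integral_congr_ae (Filter.Eventually.of_forall fun p => ?_)
  simp only [phaseL_apply, smul_eq_mul]
  rw [mul_comm]
  congr 2
  rw [inner_smul_right, ← neg_sub q y, inner_neg_right, real_inner_comm]
  ring

/-- Schur's test needs only boundedness in the midpoint variable, so all the decay is spent on the
momentum. -/
lemma SymB.comp_phaseL {ι : Type} {n : ℕ} {m : ℤ} (hm : 0 ≤ m) {a : ι → Phase d → ℂ}
    (ha : SymB n (jb (-m)) a) :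
    SymB n (fun x : Position d × Position d => (1 : ℝ) * jb (-m) x.2)
      (fun i x => a i (phaseL d x)) := by
  have h1 := ha.comp_affine (fun _ => phaseL d) (fun _ => 0)
    (w' := fun x : Position d × Position d => (1 : ℝ) * jb (-m) x.2) (fun _ => le_rfl)
    zero_le_one (fun _ x => by
      simp only [add_zero, phaseL_apply, one_mul]
      rw [jb_neg, jb_neg]
      have := jb_pos m x.2
      have h2 : jb m x.2 ≤ jb m (phasePt x.1 x.2) := jb_le_of_norm_le hm (norm_momL_le (phasePt x.1 x.2))
      gcongr)
  simpa only [add_zero] using h1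

lemma continuous_weylKernel (h : ℝ) {s : Phase d → ℂ} (hs : SchwartzB (fun _ : Unit => s)) :
    Continuous (Function.uncurry (weylKernel h s)) := by
  have h1 := pft_symB (Y := Position d) 0 0 (w := fun _ : Position d => (1 : ℝ)) continuous_const
    (fun _ => zero_le_one) (m := ((d + 1 : ℕ) : ℤ)) (by simp)
    (((hs (-((d + 1 : ℕ) : ℤ)) 0).comp_phaseL (Int.natCast_nonneg _)).mono' fun x => by
      simp only [one_mul]
      exact jb_mono (by simp) _)
  have h2 : Continuous (pft fun x => s (phaseL d x)) := (h1.1 ()).continuous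
  unfold weylKernel Function.uncurry
  fun_prop

lemma memLp_jb_mid {R : ℕ} (hR : d < R) (q : Position d) :
    MemLp (fun y => jb (-(R : ℤ)) ((1 / 2 : ℝ) • (q + y))) 2 := by
  have hc : Continuous fun y => jb (-(R : ℤ)) ((1 / 2 : ℝ) • (q + y)) :=
    (continuous_jb _).comp (by fun_prop)
  rw [memLp_two_iff_integrable_sq_norm hc.aestronglyMeasurable]
  have h1 : Integrable (fun y : Position d => jb (-(R : ℤ)) y) volume :=
    integrable_jb (by simpa using hR)
  have h2 : Integrable (fun y : Position d => jb (-(R : ℤ)) ((1 / 2 : ℝ) • (q + y))) :=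
    ((integrable_comp_smul_iff volume _ (by norm_num : (1 / 2 : ℝ) ≠ 0)).2 h1).comp_add_left q
  refine h2.mono' (hc.norm.pow 2).aestronglyMeasurable (Filter.Eventually.of_forall fun y => ?_)
  have h3 : jb (-(R : ℤ)) ((1 / 2 : ℝ) • (q + y)) ≤ 1 := by
    rw [← jb_zero ((1 / 2 : ℝ) • (q + y))]; exact jb_mono (by simp) _
  have h4 := jb_nonneg (-(R : ℤ)) ((1 / 2 : ℝ) • (q + y))
  simp only [norm_pow, Real.norm_eq_abs, abs_of_nonneg h4]
  nlinarith

lemma jb_phasePt_neg_le (R : ℕ) (q p : Position d) :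
    jb (-((R + R : ℕ) : ℤ)) (phasePt q p) ≤ jb (-(R : ℤ)) q * jb (-(R : ℤ)) p := by
  have h1 : jb (R : ℤ) q ≤ jb (R : ℤ) (phasePt q p) :=
    jb_le_of_norm_le (by positivity) (norm_posL_le (phasePt q p))
  have h2 : jb (R : ℤ) p ≤ jb (R : ℤ) (phasePt q p) :=
    jb_le_of_norm_le (by positivity) (norm_momL_le (phasePt q p))
  push_cast
  rw [neg_add, jb_add, jb_neg, jb_neg, jb_neg]
  have := jb_pos (R : ℤ) q
  have := jb_pos (R : ℤ) p
  have := jb_pos (R : ℤ) (phasePt q p)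
  gcongr

/-- Decay in the midpoint makes each row square integrable, so the kernel integral converges for
every `q` and every L² function. -/
lemma memLp_weylKernel (h : ℝ) {s : Phase d → ℂ} (hs : SchwartzB (fun _ : Unit => s))
    (q : Position d) : MemLp (weylKernel h s q) 2 := by
  obtain ⟨R, hR⟩ : ∃ R, d < R := ⟨d + 1, Nat.lt_succ_self d⟩
  obtain ⟨C, hC, h1⟩ := (hs (-((R + R : ℕ) : ℤ)) 0).bound
  have hc : Continuous (weylKernel h s q) := (continuous_weylKernel h hs).uncurry_left q
  have hJ : Integrable (fun y : Position d => jb (-(R : ℤ)) y) volume :=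
    integrable_jb (by simpa using hR)
  have key : ∀ y, ‖weylKernel h s q y‖ ≤
      (|(h ^ d)⁻¹| * (C * ∫ p : Position d, jb (-(R : ℤ)) p)) *
        ‖jb (-(R : ℤ)) ((1 / 2 : ℝ) • (q + y))‖ := by
    intro y
    have h2 : ‖∫ p, s (phasePt ((1 / 2 : ℝ) • (q + y)) p) * ech (h⁻¹ * ⟪q - y, p⟫_ℝ)‖ ≤
        ∫ p : Position d, C * (jb (-(R : ℤ)) p * jb (-(R : ℤ)) ((1 / 2 : ℝ) • (q + y))) := by
      refine norm_integral_le_of_norm_le ((hJ.mul_const _).const_mul C)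
        (Filter.Eventually.of_forall fun p => ?_)
      rw [norm_mul, norm_ech, mul_one]
      refine (h1 () _).trans (mul_le_mul_of_nonneg_left ?_ hC)
      rw [mul_comm]
      exact jb_phasePt_neg_le R _ _
    rw [integral_const_mul, integral_mul_const] at h2
    rw [weylKernel_eq, norm_mul, Complex.norm_real, Real.norm_eq_abs, Real.norm_eq_abs,
      abs_of_nonneg (jb_nonneg (-(R : ℤ)) ((1 / 2 : ℝ) • (q + y)))]
    calc _ ≤ |(h ^ d)⁻¹| * _ := mul_le_mul_of_nonneg_left h2 (abs_nonneg _)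
      _ = _ := by ring
  exact MemLp.of_le_mul (memLp_jb_mid hR q) hc.aestronglyMeasurable
    (Filter.Eventually.of_forall key)

lemma opC_eq_kernel (h : ℝ) {s : Phase d → ℂ} (hs : SchwartzB (fun _ : Unit => s))
    {ψ : Position d → ℂ} (hψ : MemLp ψ 2) (q : Position d) :
    opC h s ψ q = ∫ y, weylKernel h s q y * ψ y := by
  obtain ⟨R, hR⟩ : ∃ R, d < R := ⟨d + 1, Nat.lt_succ_self d⟩
  obtain ⟨C, hC, h1⟩ := (hs (-((R + R : ℕ) : ℤ)) 0).bound
  have hsc : Continuous s := ((hs 0 0).1 ()).continuous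
  have hph := (phaseL d).continuous
  have hJ : Integrable (fun y : Position d => jb (-(R : ℤ)) y) volume :=
    integrable_jb (by simpa using hR)
  have hcont : Continuous fun x : Position d × Position d =>
      s (phasePt ((1 / 2 : ℝ) • (q + x.2)) x.1) * ech (h⁻¹ * ⟪q - x.2, x.1⟫_ℝ) := by
    have : Continuous fun x : Position d × Position d =>
      s (phaseL d ((1 / 2 : ℝ) • (q + x.2), x.1)) := by fun_prop
    exact this.mul (by fun_prop)
  have hint : Integrable (Function.uncurry fun p y =>
      s (phasePt ((1 / 2 : ℝ) • (q + y)) p) * ech (h⁻¹ * ⟪q - y, p⟫_ℝ) * ψ y)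
      (volume.prod volume) := by
    have hprod := (memLp_jb_mid hR q).integrable_mul hψ.norm
    refine ((hJ.mul_prod hprod).const_mul C).mono' ?_ (Filter.Eventually.of_forall fun x => ?_)
    · exact hcont.aestronglyMeasurable.mul (hψ.1.comp_quasiMeasurePreserving
            Measure.quasiMeasurePreserving_snd)
    · simp only [Function.uncurry_def, norm_mul, norm_ech, mul_one, Pi.mul_apply]
      have h2 := (h1 () (phasePt ((1 / 2 : ℝ) • (q + x.2)) x.1)).trans
        (mul_le_mul_of_nonneg_left (jb_phasePt_neg_le R _ _) hC)
      calc _ ≤ (C * (jb (-(R : ℤ)) ((1 / 2 : ℝ) • (q + x.2)) *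
            jb (-(R : ℤ)) x.1)) * ‖ψ x.2‖ := by gcongr
        _ = _ := by ring
  unfold opC
  rw [integral_integral_swap hint, ← integral_const_mul]
  refine integral_congr_ae (Filter.Eventually.of_forall fun y => ?_)
  simp only
  rw [integral_mul_const, weylKernel_eq, mul_assoc]

/-- Boundedness of Weyl quantization on `L²`, uniformly in the semiclassical parameter and
invariant under dilations of the symbol. -/
theorem weyl_L2_bound {ι : Type} {a : ι → Phase d → ℂ}
    (ha : SymB (d + 1) (jb (-((d + 1 : ℕ) : ℤ))) a) :
    ∃ M, 0 ≤ M ∧ ∀ i (l h : ℝ), 0 < l → 0 < h → ∀ s : Phase d → ℂ, SchwartzB (fun _ : Unit => s) →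
      (∀ z, s (l • z) = a i z) →
      ∃ T : L2 d →L[ℂ] L2 d, (∀ ψ : L2 d, (T ψ : Position d → ℂ) =ᵐ[volume] opC h s ψ) ∧ ‖T‖ ≤ M ∧
        ((∀ z, (starRingEnd ℂ) (s z) = s z) → IsSelfAdjoint T) := by
  -- The number `d + 1` enters twice: as decay in `p` making the transform converge, and as
  -- derivatives in `p` giving the kernel integrable decay.
  have h1 := pft_symB (Y := Position d) 0 (d + 1) (w := fun _ : Position d => (1 : ℝ))
    continuous_const (fun _ => zero_le_one) (m := ((d + 1 : ℕ) : ℤ)) (by simp)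
    (f := fun i x => a i (phaseL d x))
    (by simpa using ha.comp_phaseL (Int.natCast_nonneg _))
  obtain ⟨C, hC, h2⟩ := h1.bound
  have hJ : Integrable (fun y : Position d => jb (-((d + 1 : ℕ) : ℤ)) y) volume :=
    integrable_jb (by simp)
  set I := ∫ y : Position d, jb (-((d + 1 : ℕ) : ℤ)) y with hI
  have hI0 : 0 ≤ I := integral_nonneg fun y => jb_nonneg _ _
  refine ⟨C * I, by positivity, fun i l h hl hh s hs hsa => ?_⟩
  have hscale : ∀ x η, pft (fun x => s (phaseL d x)) (x, η) =
      (l ^ d : ℝ) * pft (fun x => a i (phaseL d x)) (l⁻¹ • x, l • η) := by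
    intro x η
    rw [pft_eq_integral, pft_eq_integral]
    have e := Measure.integral_comp_smul (volume : Measure (Position d))
      (fun p => ech (-⟪p, η⟫_ℝ) • s (phaseL d (x, p))) l
    have e2 : ∀ p : Position d, phaseL d (x, l • p) = l • phaseL d (l⁻¹ • x, p) := fun p => by
      rw [← map_smul]
      simp [smul_smul, hl.ne']
    simp only [e2, hsa, inner_smul_left, RCLike.conj_to_real] at e
    simp only [inner_smul_right, e]
    rw [abs_of_pos (by positivity), Complex.real_smul, ← mul_assoc, ← Complex.ofReal_mul]
    simp [hl.ne']
  -- The prefactors of the kernel combine to the Jacobian of dilation by l/h, so the integral of `g`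
  -- depends on neither parameter. This is the dilation invariance of the bound.
  set g : Position d → ℝ := fun y =>
    C * ((l * h⁻¹) ^ d * jb (-((d + 1 : ℕ) : ℤ)) ((l * h⁻¹) • y)) with hg
  have hgc : Continuous g := by
    have := continuous_jb (X := Position d) (-((d + 1 : ℕ) : ℤ))
    simp only [hg]
    fun_prop
  have hlh : 0 < l * h⁻¹ := by positivity
  have hgi : Integrable g :=
    (((integrable_comp_smul_iff volume _ hlh.ne').2 hJ).const_mul _).const_mul _
  have hgI : ∫ y, g y = C * I := by
    simp only [hg]
    rw [integral_const_mul, integral_const_mul, Measure.integral_comp_smul, finrank_euclideanSpace,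
      Fintype.card_fin, abs_of_pos (by positivity), smul_eq_mul, ← mul_assoc ((l * h⁻¹) ^ d),
      mul_inv_cancel₀ (by positivity), one_mul]
  have hkg : ∀ q y, ‖weylKernel h s q y‖ ≤ g (y - q) := by
    intro q y
    rw [weylKernel, hscale, norm_mul, norm_mul, Complex.norm_real, Complex.norm_real,
      Real.norm_of_nonneg (by positivity), Real.norm_of_nonneg (by positivity)]
    have h3 := h2 i (l⁻¹ • (1 / 2 : ℝ) • (q + y), l • h⁻¹ • (y - q))
    rw [one_mul, smul_smul l] at h3
    calc _ ≤ (h ^ d)⁻¹ * (l ^ d * (C * jb (-((d + 1 : ℕ) : ℤ)) ((l * h⁻¹) • (y - q)))) := by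
          rw [smul_smul l]
          gcongr
      _ = _ := by
          simp only [hg, mul_pow, inv_pow]
          ring
  obtain ⟨T, hT, hTn⟩ := exists_clm_of_kernel (continuous_weylKernel h hs)
    (memLp_weylKernel h hs) hgc hgi hkg
  refine ⟨T, fun ψ => ?_, by rwa [hgI] at hTn, fun hreal => ?_⟩
  · refine (hT ψ).trans (Filter.Eventually.of_forall fun q => ?_)
    exact (opC_eq_kernel h hs (Lp.memLp ψ) q).symm
  · refine isSelfAdjoint_of_kernel (continuous_weylKernel h hs) (B := C * (l * h⁻¹) ^ d)
      (fun q y => (hkg q y).trans ?_) (fun q y => ?_) hT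
    · simp only [hg]
      rw [← mul_assoc]
      refine mul_le_of_le_one_right (by positivity) ?_
      rw [← jb_zero ((l * h⁻¹) • (y - q))]
      exact jb_mono (by simp) _
    · rw [weylKernel_eq, weylKernel_eq, map_mul, Complex.conj_ofReal, ← integral_conj]
      congr 1
      refine integral_congr_ae (Filter.Eventually.of_forall fun p => ?_)
      simp only [map_mul, hreal, conj_ech]
      rw [add_comm y q]
      congr 2
      rw [← neg_sub q y, inner_neg_left]
      ring

end WeylL2

/-! ### Closure properties of the symbol classes -/

section SymbolOperations

variable {ι : Type} {X Y E F G : Type}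
  [NormedAddCommGroup X] [NormedSpace ℝ X] [NormedAddCommGroup Y] [NormedSpace ℝ Y]
  [NormedAddCommGroup E] [NormedSpace ℝ E] [NormedAddCommGroup F] [NormedSpace ℝ F]
  [NormedAddCommGroup G] [NormedSpace ℝ G]

lemma OfOrder.fderiv {m : ℤ} {f : ι → X → E} (hf : OfOrder m f) :
    OfOrder m (fun i => _root_.fderiv ℝ (f i)) := fun n => (hf (n + 1)).fderiv

lemma OfOrder.clm {m : ℤ} {f : ι → X → E} (hf : OfOrder m f) (L : E →L[ℝ] F) :
    OfOrder m (fun i x => L (f i x)) := fun n => (hf n).clm_const L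

lemma OfOrder.sum {κ : Type} (s : Finset κ) {m : ℤ} {f : κ → ι → X → E}
    (hf : ∀ j, OfOrder m (f j)) : OfOrder m (fun i x => ∑ j ∈ s, f j i x) := fun n =>
  SymB.sum s fun j _ => hf j n

lemma OfOrder.contDiff {m : ℤ} {f : ι → X → E} (hf : OfOrder m f) (i : ι) : ContDiff ℝ ∞ (f i) :=
  contDiff_infty.2 fun n => (hf n).1 i

namespace SchwartzB

variable {f g : ι → X → E}

lemma contDiff (hf : SchwartzB f) (i : ι) : ContDiff ℝ ∞ (f i) := (hf 0).contDiff i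

lemma fderiv (hf : SchwartzB f) : SchwartzB (fun i => _root_.fderiv ℝ (f i)) := fun m =>
  (hf m).fderiv

lemma clm (hf : SchwartzB f) (L : E →L[ℝ] F) : SchwartzB (fun i x => L (f i x)) := fun m =>
  (hf m).clm L

lemma add (hf : SchwartzB f) (hg : SchwartzB g) : SchwartzB (fun i x => f i x + g i x) :=
  fun m n => (hf m n).add (hg m n)

lemma sub (hf : SchwartzB f) (hg : SchwartzB g) : SchwartzB (fun i x => f i x - g i x) :=
  fun m n => (hf m n).sub (hg m n)

lemma const_smul (hf : SchwartzB f) (c : ι → ℝ) {K : ℝ} (hK : 0 ≤ K) (hc : ∀ i, |c i| ≤ K) :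
    SchwartzB (fun i x => c i • f i x) := fun m n => (hf m n).const_smul c hK hc

lemma sum {κ : Type} (s : Finset κ) {f : κ → ι → X → E}
    (hf : ∀ j, SchwartzB (f j)) : SchwartzB (fun i x => ∑ j ∈ s, f j i x) := fun m =>
  OfOrder.sum s fun j => hf j m

end SchwartzB

/-- Mean value inequality on the ball of radius ‖x‖: integrating a derivative of order `m` raises
the order by one. -/
lemma OfOrder.of_fderiv {m : ℤ} (hm : 0 ≤ m) {f : ι → X → E} (hd : ∀ i, Differentiable ℝ (f i))
    {K : ℝ} (hK : ∀ i, ‖f i 0‖ ≤ K) (hf : OfOrder m (fun i => _root_.fderiv ℝ (f i))) :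
    OfOrder (m + 1) f := by
  have h0 : SymB 0 (jb (m + 1)) f := by
    obtain ⟨C, hC, h⟩ := (hf 0).bound
    refine SymB.of_bound (fun i => (hd i).continuous) (C + |K|) (by positivity) fun i x => ?_
    have h1 : ‖f i x - f i 0‖ ≤ C * jb m x * ‖x - 0‖ := by
      refine Convex.norm_image_sub_le_of_norm_fderiv_le (s := Metric.closedBall 0 ‖x‖)
        (fun y _ => (hd i) y) (fun y hy => (h i y).trans ?_) (convex_closedBall _ _)
        (by simp) (by simp)
      gcongr
      exact jb_le_of_norm_le hm (by simpa using hy)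
    rw [sub_zero] at h1
    have h2 : ‖f i x‖ ≤ ‖f i x - f i 0‖ + ‖f i 0‖ := by
      simpa using norm_add_le (f i x - f i 0) (f i 0)
    have h3 : ‖x‖ ≤ jb 1 x := by simpa using norm_pow_le_jb 1 x
    have h4 := one_le_jb (m := m + 1) (by omega) x
    have h5 : C * jb m x * ‖x‖ ≤ C * jb (m + 1) x := by
      rw [jb_add, mul_assoc]
      have := jb_nonneg m x
      gcongr
    have h6 := (hK i).trans (le_abs_self K)
    nlinarith [abs_nonneg K]
  intro n
  cases n with
  | zero => exact h0
  | succ n => exact SymB.of_fderiv h0 hd ((hf n).mono' fun x => jb_mono (by omega) x)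

end SymbolOperations

/-! ### Partial derivatives and the Laplacian -/

section PartialDerivatives

variable {ι κ : Type} [Fintype κ] [DecidableEq κ] {E F G : Type}
  [NormedAddCommGroup E] [NormedSpace ℝ E] [NormedAddCommGroup F] [NormedSpace ℝ F]
  [NormedAddCommGroup G] [NormedSpace ℝ G]

/-- The partial derivative in the `j`-th coordinate direction. -/
def pd (j : κ) (f : EuclideanSpace ℝ κ → E) (z : EuclideanSpace ℝ κ) : E :=
  fderiv ℝ f z (EuclideanSpace.single j 1)

lemma OfOrder.pd {m : ℤ} {f : ι → EuclideanSpace ℝ κ → E} (hf : OfOrder m f) (j : κ) :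
    OfOrder m (fun i => pd j (f i)) :=
  hf.fderiv.clm (ContinuousLinearMap.apply ℝ E (EuclideanSpace.single j (1 : ℝ)))

lemma SchwartzB.pd {f : ι → EuclideanSpace ℝ κ → E} (hf : SchwartzB f) (j : κ) :
    SchwartzB (fun i => pd j (f i)) := fun m => (hf m).pd j

variable {f g : EuclideanSpace ℝ κ → E}

lemma contDiff_pd (hf : ContDiff ℝ ∞ f) (j : κ) : ContDiff ℝ ∞ (pd j f) :=
  (hf.fderiv_right (m := ∞) (by simp)).clm_apply contDiff_const

lemma fderiv_pd (hf : ContDiff ℝ ∞ f) (j : κ) (z v : EuclideanSpace ℝ κ) :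
    fderiv ℝ (pd j f) z v = fderiv ℝ (fderiv ℝ f) z v (EuclideanSpace.single j 1) := by
  have h1 : DifferentiableAt ℝ (fderiv ℝ f) z :=
    (hf.fderiv_right (m := ∞) (by simp)).differentiable (by simp) z
  have h2 : HasFDerivAt (pd j f)
      ((ContinuousLinearMap.apply ℝ E (EuclideanSpace.single j (1 : ℝ))).comp
        (fderiv ℝ (fderiv ℝ f) z)) z :=
    (ContinuousLinearMap.apply ℝ E (EuclideanSpace.single j (1 : ℝ))).hasFDerivAt.comp z
      h1.hasFDerivAt
  rw [h2.fderiv]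
  rfl

lemma pd_pd (hf : ContDiff ℝ ∞ f) (j k : κ) (z : EuclideanSpace ℝ κ) :
    pd j (pd k f) z = fderiv ℝ (fderiv ℝ f) z (EuclideanSpace.single j 1)
      (EuclideanSpace.single k 1) := fderiv_pd hf k z _

lemma isSymmSndFDerivAt (hf : ContDiff ℝ ∞ f) (z : EuclideanSpace ℝ κ) :
    IsSymmSndFDerivAt ℝ f z :=
  hf.contDiffAt.isSymmSndFDerivAt (by
    rw [minSmoothness_of_isRCLikeNormedField]; exact WithTop.coe_le_coe.2 le_top)

lemma pd_comm (hf : ContDiff ℝ ∞ f) (j k : κ) : pd j (pd k f) = pd k (pd j f) := by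
  ext z
  rw [pd_pd hf, pd_pd hf]
  exact (isSymmSndFDerivAt hf z).eq _ _

lemma fderiv_pd_comm (hf : ContDiff ℝ ∞ f) (j : κ) :
    fderiv ℝ (pd j f) = pd j (fderiv ℝ f) := by
  ext z v
  rw [fderiv_pd hf]
  exact (isSymmSndFDerivAt hf z).eq _ _

lemma pd_add (hf : ContDiff ℝ ∞ f) (hg : ContDiff ℝ ∞ g) (j : κ) :
    pd j (fun z => f z + g z) = fun z => pd j f z + pd j g z := by
  ext z
  simp only [pd]
  rw [fderiv_fun_add (hf.differentiable (by simp) z) (hg.differentiable (by simp) z)]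
  rfl

lemma pd_const_mul {f : EuclideanSpace ℝ κ → ℝ} (hf : ContDiff ℝ ∞ f) (c : ℝ) (j : κ) :
    pd j (fun z => c * f z) = fun z => c * pd j f z := by
  ext z
  simp only [pd]
  rw [fderiv_const_mul (hf.differentiable (by simp) z)]
  rfl

lemma pd_mul {f g : EuclideanSpace ℝ κ → ℝ} (hf : ContDiff ℝ ∞ f) (hg : ContDiff ℝ ∞ g) (j : κ) :
    pd j (fun z => f z * g z) = fun z => pd j f z * g z + f z * pd j g z := by
  ext z
  simp only [pd]
  rw [fderiv_fun_mul (hf.differentiable (by simp) z) (hg.differentiable (by simp) z)]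
  simp
  ring

lemma pd_sum {α : Type} (s : Finset α) {f : α → EuclideanSpace ℝ κ → E}
    (hf : ∀ a, ContDiff ℝ ∞ (f a)) (j : κ) :
    pd j (fun z => ∑ a ∈ s, f a z) = fun z => ∑ a ∈ s, pd j (f a) z := by
  ext z
  simp only [pd]
  rw [fderiv_fun_sum fun a _ => (hf a).differentiable (by simp) z]
  simp

/-- The Laplacian, as the sum of the second partial derivatives. -/
def lap (f : EuclideanSpace ℝ κ → E) (z : EuclideanSpace ℝ κ) : E := ∑ j, pd j (pd j f) z

lemma SchwartzB.lap {f : ι → EuclideanSpace ℝ κ → E} (hf : SchwartzB f) :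
    SchwartzB (fun i => lap (f i)) :=
  SchwartzB.sum _ fun j => (hf.pd j).pd j

lemma contDiff_lap (hf : ContDiff ℝ ∞ f) : ContDiff ℝ ∞ (lap f) :=
  ContDiff.sum fun j _ => contDiff_pd (contDiff_pd hf j) j

/-- By symmetry of second derivatives. It makes the derivative of a heat remainder the heat
remainder of the derivative. -/
lemma fderiv_lap (hf : ContDiff ℝ ∞ f) : fderiv ℝ (lap f) = lap (fderiv ℝ f) := by
  ext1 z
  have : lap f = fun z => ∑ j, pd j (pd j f) z := rfl
  rw [this, fderiv_fun_sum fun j _ =>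
    (contDiff_pd (contDiff_pd hf j) j).differentiable (by simp) z]
  refine Finset.sum_congr rfl fun j _ => ?_
  rw [fderiv_pd_comm (contDiff_pd hf j), fderiv_pd_comm hf]

lemma laplacian_eq_lap (hf : ContDiff ℝ ∞ f) : Laplacian.laplacian f = lap f := by
  ext z
  rw [InnerProductSpace.laplacian_eq_iteratedFDeriv_orthonormalBasis f
    (EuclideanSpace.basisFun κ ℝ)]
  refine Finset.sum_congr rfl fun j _ => ?_
  rw [iteratedFDeriv_two_apply, pd_pd hf]
  simp

end PartialDerivatives

/-! ### Poisson bracket, Hessian trace and the Leibniz rule -/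

section PoissonBracket

variable {d : ℕ} {ι : Type}

lemma hessian_apply {f : Phase d → ℝ} (hf : ContDiff ℝ ∞ f) (z : Phase d) (j k : Fin d ⊕ Fin d) :
    hessian f z j k = pd j (pd k f) z := by
  rw [pd_pd hf]
  simp [hessian, iteratedFDeriv_two_apply]

lemma gradient_apply (f : Phase d → ℝ) (z : Phase d) (k : Fin d ⊕ Fin d) :
    (∇ f z).ofLp k = pd k f z := by
  have : ⟪∇ f z, EuclideanSpace.single k (1 : ℝ)⟫_ℝ = pd k f z := by
    simp [gradient, pd]
  rw [← this, EuclideanSpace.inner_single_right]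
  simp

lemma poisson_eq_sum (f g : Phase d → ℝ) (z : Phase d) :
    poisson f g z = ∑ j, ∑ k, symplJ d j k * (pd k f z * pd j g z) := by
  simp only [poisson, dotProduct, Matrix.mulVec, gradient_apply, Finset.sum_mul]
  exact Finset.sum_congr rfl fun j _ => Finset.sum_congr rfl fun k _ => by ring

lemma symplJ_mulVec (v : Phase d) : (symplJ d).mulVec v.ofLp = (symJ d v).ofLp := by
  have : v.ofLp = Sum.elim (posL d v).ofLp (momL d v).ofLp := by
    ext i; rcases i with i | i <;> rfl
  rw [this, symplJ, Matrix.fromBlocks_mulVec]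
  ext i; rcases i with i | i <;> simp [symJ_apply, phasePt, Matrix.neg_mulVec]

lemma inner_symJ (v w : Phase d) : ⟪symJ d v, w⟫_ℝ = -⟪v, symJ d w⟫_ℝ := by
  simp only [inner_phase, symJ_apply, posL_phasePt, momL_phasePt, inner_neg_left, inner_neg_right]
  ring

/-- The Riesz isomorphism from the dual. -/
def rieszL (d : ℕ) : (Phase d →L[ℝ] ℝ) →L[ℝ] Phase d :=
  LinearMap.toContinuousLinearMap
    { toFun := fun φ => (InnerProductSpace.toDual ℝ (Phase d)).symm φ
      map_add' := fun φ ψ => map_add _ _ _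
      map_smul' := fun c φ => by simp }

/-- The Poisson bracket as a bilinear function of the two derivatives. -/
def poissonB (d : ℕ) : (Phase d →L[ℝ] ℝ) →L[ℝ] (Phase d →L[ℝ] ℝ) →L[ℝ] ℝ :=
  (ContinuousLinearMap.id ℝ (Phase d →L[ℝ] ℝ)).flip.comp ((symJ d).comp (rieszL d))

lemma poissonB_apply (f g : Phase d → ℝ) (z : Phase d) :
    poissonB d (fderiv ℝ f z) (fderiv ℝ g z) = fderiv ℝ g z (symJ d (∇ f z)) := rfl

lemma poisson_eq_fderiv (f g : Phase d → ℝ) (z : Phase d) :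
    poisson f g z = poissonB d (fderiv ℝ f z) (fderiv ℝ g z) := by
  have h : fderiv ℝ g z (symJ d (∇ f z)) = ⟪∇ g z, symJ d (∇ f z)⟫_ℝ := by
    simp [gradient]
  rw [poissonB_apply, h, poisson, symplJ_mulVec]
  rw [EuclideanSpace.inner_eq_star_dotProduct]
  simp

lemma contDiff_poisson {f g : Phase d → ℝ} (hf : ContDiff ℝ ∞ f) (hg : ContDiff ℝ ∞ g) :
    ContDiff ℝ ∞ (poisson f g) := by
  have : poisson f g = fun z => poissonB d (fderiv ℝ f z) (fderiv ℝ g z) :=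
    funext fun z => poisson_eq_fderiv f g z
  rw [this]
  exact ((poissonB d).contDiff.comp (hf.fderiv_right (m := ∞) (by simp))).clm_apply
    (hg.fderiv_right (m := ∞) (by simp))

lemma SchwartzB.poisson {m : ℤ} {f g : ι → Phase d → ℝ} (hf : OfOrder m fun i => _root_.fderiv ℝ (f i))
    (hg : SchwartzB g) : SchwartzB (fun i => poisson (f i) (g i)) := by
  have h := SchwartzB.bilin (poissonB d) (f := fun i => _root_.fderiv ℝ (f i))
    (g := fun i => _root_.fderiv ℝ (g i)) hf hg.fderiv
  have e : (fun i => _root_.poisson (f i) (g i)) =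
      fun i z => poissonB d (_root_.fderiv ℝ (f i) z) (_root_.fderiv ℝ (g i) z) :=
    funext fun i => funext fun z => poisson_eq_fderiv (f i) (g i) z
  rw [e]
  exact h

lemma pd_poisson {f g : Phase d → ℝ} (hf : ContDiff ℝ ∞ f) (hg : ContDiff ℝ ∞ g)
    (l : Fin d ⊕ Fin d) :
    pd l (poisson f g) = fun z => poisson (pd l f) g z + poisson f (pd l g) z := by
  have h1 : poisson f g = fun z => ∑ j, ∑ k, symplJ d j k * (pd k f z * pd j g z) :=
    funext fun z => poisson_eq_sum f g z
  have hc : ∀ j k, ContDiff ℝ ∞ fun z => pd k f z * pd j g z := fun j k =>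
    (contDiff_pd hf k).mul (contDiff_pd hg j)
  have hs : ∀ j k, ContDiff ℝ ∞ fun z => symplJ d j k * (pd k f z * pd j g z) := fun j k =>
    contDiff_const.mul (hc j k)
  rw [h1, pd_sum (f := fun j z => ∑ k, symplJ d j k * (pd k f z * pd j g z)) _
    fun j => ContDiff.sum fun k _ => hs j k]
  ext z
  rw [poisson_eq_sum, poisson_eq_sum, ← Finset.sum_add_distrib]
  refine Finset.sum_congr rfl fun j _ => ?_
  rw [pd_sum (f := fun k z => symplJ d j k * (pd k f z * pd j g z)) _ (hs j), ← Finset.sum_add_distrib]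
  refine Finset.sum_congr rfl fun k _ => ?_
  rw [pd_const_mul (hc j k), pd_mul (contDiff_pd hf k) (contDiff_pd hg j)]
  simp only
  rw [pd_comm hf l k, pd_comm hg l j]
  ring

lemma poisson_lap_left {f g : Phase d → ℝ} (hf : ContDiff ℝ ∞ f) (z : Phase d) :
    poisson (lap f) g z = ∑ l, poisson (pd l (pd l f)) g z := by
  simp only [poisson_eq_fderiv]
  rw [show lap f = fun z => ∑ l, pd l (pd l f) z from rfl, fderiv_fun_sum fun l _ =>
    (contDiff_pd (contDiff_pd hf l) l).differentiable (by simp) z, map_sum]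
  simp

lemma poisson_lap_right {f g : Phase d → ℝ} (hg : ContDiff ℝ ∞ g) (z : Phase d) :
    poisson f (lap g) z = ∑ l, poisson f (pd l (pd l g)) z := by
  simp only [poisson_eq_fderiv]
  rw [show lap g = fun z => ∑ l, pd l (pd l g) z from rfl, fderiv_fun_sum fun l _ =>
    (contDiff_pd (contDiff_pd hg l) l).differentiable (by simp) z, map_sum]

/-- Expanding the matrix product and using symmetry of the Hessian of `g` turns the trace into the
cross term of the Leibniz rule. -/
lemma trace_hessian {f g : Phase d → ℝ} (hf : ContDiff ℝ ∞ f) (hg : ContDiff ℝ ∞ g) (z : Phase d) :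
    (symplJ d * hessian f z * hessian g z).trace = ∑ l, poisson (pd l f) (pd l g) z := by
  simp only [Matrix.trace, Matrix.diag, Matrix.mul_apply, hessian_apply hf, hessian_apply hg,
    poisson_eq_sum]
  rw [Finset.sum_comm]
  refine Finset.sum_congr rfl fun l _ => Finset.sum_congr rfl fun j _ => ?_
  rw [Finset.sum_mul]
  refine Finset.sum_congr rfl fun k _ => ?_
  rw [pd_comm hg l j]
  ring

/-- Two applications of the Leibniz rule; the brackets of first partial derivatives arise twice. -/
lemma lap_poisson {f g : Phase d → ℝ} (hf : ContDiff ℝ ∞ f) (hg : ContDiff ℝ ∞ g) (z : Phase d) :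
    lap (poisson f g) z = poisson (lap f) g z + poisson f (lap g) z +
      2 * (symplJ d * hessian f z * hessian g z).trace := by
  rw [trace_hessian hf hg, poisson_lap_left hf, poisson_lap_right hg, Finset.mul_sum,
    ← Finset.sum_add_distrib, ← Finset.sum_add_distrib]
  refine Finset.sum_congr rfl fun l _ => ?_
  rw [pd_poisson hf hg l, pd_add (contDiff_poisson (contDiff_pd hf l) hg)
    (contDiff_poisson hf (contDiff_pd hg l)), pd_poisson (contDiff_pd hf l) hg,
    pd_poisson hf (contDiff_pd hg l)]
  simp only
  ring

/-- The coefficient of `-ε` in the corrected bracket. -/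
def bracketCorr (b c : Phase d → ℝ) (z : Phase d) : ℝ :=
  (1 / 4 : ℝ) * (lap (poisson b c) z - poisson b (lap c) z)

/-- The correction measures the failure of the Laplacian to commute with the bracket {b, ·}; in this
form it cancels against the heat expansion. -/
lemma correctedBracket_eq {b c : Phase d → ℝ} (hb : ContDiff ℝ ∞ b) (hc : ContDiff ℝ ∞ c) (ε : ℝ)
    (z : Phase d) : correctedBracket ε b c z = poisson b c z - ε * bracketCorr b c z := by
  have h1 : (fun w => b w - ε / 4 * Laplacian.laplacian b w) =
      fun w => b w - ε / 4 * lap b w := by rw [laplacian_eq_lap hb]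
  have h2 : fderiv ℝ (fun w => b w - ε / 4 * lap b w) z =
      fderiv ℝ b z - (ε / 4) • fderiv ℝ (lap b) z := by
    have h3 := (contDiff_lap hb).differentiable (by simp) z
    rw [fderiv_fun_sub (hb.differentiable (by simp) z) (h3.const_mul _), fderiv_const_mul h3]
  rw [correctedBracket, bracketCorr, h1, poisson_eq_fderiv, h2, lap_poisson hb hc]
  simp only [poisson_eq_fderiv, map_sub, map_smul, sub_apply, smul_apply, smul_eq_mul]
  ring

end PoissonBracket

/-! ### Symbols of subquadratic growth -/

section Subquadratic

variable {d : ℕ} {ι : Type} {b : Phase d → ℝ}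

lemma IsSmoothSubquadratic.ofOrder_fderiv_fderiv (hb : IsSmoothSubquadratic b) :
    OfOrder 0 (fun _ : ι => fderiv ℝ (fderiv ℝ b)) := by
  intro n
  have h1 : ContDiff ℝ ∞ (fderiv ℝ (fderiv ℝ b)) :=
    (hb.smooth.fderiv_right (m := ∞) (by simp)).fderiv_right (m := ∞) (by simp)
  choose C hC using fun k : ℕ => hb.bounded (k + 2) (by omega)
  refine ⟨fun _ => h1.of_le (by exact_mod_cast le_top), ∑ k ∈ Finset.range (n + 1), |C k|,
    by positivity, fun _ k hk x => ?_⟩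
  rw [norm_iteratedFDeriv_fderiv, norm_iteratedFDeriv_fderiv, jb_zero, mul_one]
  refine ((hC k x).trans (le_abs_self _)).trans ?_
  exact Finset.single_le_sum (f := fun k => |C k|) (fun _ _ => abs_nonneg _)
    (Finset.mem_range.2 (by omega))

lemma IsSmoothSubquadratic.ofOrder_fderiv (hb : IsSmoothSubquadratic b) :
    OfOrder 1 (fun _ : ι => fderiv ℝ b) := by
  have := OfOrder.of_fderiv (ι := ι) (f := fun _ => fderiv ℝ b) le_rfl
    (fun _ => (hb.smooth.fderiv_right (m := ∞) (by simp)).differentiable (by simp))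
    (K := ‖fderiv ℝ b 0‖) (fun _ => le_rfl) hb.ofOrder_fderiv_fderiv
  simpa using this

lemma IsSmoothSubquadratic.ofOrder (hb : IsSmoothSubquadratic b) : OfOrder 2 (fun _ : ι => b) := by
  have := OfOrder.of_fderiv (ι := ι) (f := fun _ => b) zero_le_one
    (fun _ => hb.smooth.differentiable (by simp))
    (K := ‖b 0‖) (fun _ => le_rfl) hb.ofOrder_fderiv
  simpa [one_add_one_eq_two] using this

/-- The bracket sees only the gradient of `b`, of order one, and the decay of `c` absorbs it. -/
lemma IsSmoothSubquadratic.schwartzB_poisson (hb : IsSmoothSubquadratic b) {c : ι → Phase d → ℝ}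
    (hc : SchwartzB c) : SchwartzB (fun i => poisson b (c i)) :=
  SchwartzB.poisson (f := fun _ => b) hb.ofOrder_fderiv hc

lemma IsSmoothSubquadratic.schwartzB_bracketCorr (hb : IsSmoothSubquadratic b)
    {c : ι → Phase d → ℝ} (hc : SchwartzB c) : SchwartzB (fun i => bracketCorr b (c i)) :=
  ((hb.schwartzB_poisson hc).lap.sub (hb.schwartzB_poisson hc.lap)).const_smul
    (fun _ => 1 / 4) (K := 1 / 4) (by norm_num) (fun _ => by norm_num)

lemma IsSmoothSubquadratic.schwartzB_correctedBracket (hb : IsSmoothSubquadratic b)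
    {c : Phase d → ℝ} (hc : SchwartzB fun _ : Unit => c) (ε : ℝ) :
    SchwartzB (fun _ : Unit => correctedBracket ε b c) := by
  have : (fun _ : Unit => correctedBracket ε b c) =
      fun _ z => poisson b c z - ε • bracketCorr b c z :=
    funext fun _ => funext fun z => correctedBracket_eq hb.smooth (hc.contDiff ()) ε z
  rw [this]
  exact (hb.schwartzB_poisson hc).sub
    ((hb.schwartzB_bracketCorr hc).const_smul (fun _ => ε) (abs_nonneg ε) fun _ => le_rfl)

end Subquadratic

/-! ### The normalised phase space Gaussian -/

section Gaussian

variable {d : ℕ}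

/-- The normalised Gaussian `π^{-d} e^{-|z|²}` on phase space. -/
def gauss (d : ℕ) (z : Phase d) : ℝ := (Real.pi ^ d)⁻¹ * Real.exp (-‖z‖ ^ 2)

lemma gauss_nonneg (z : Phase d) : 0 ≤ gauss d z := by unfold gauss; positivity

lemma hasFDerivAt_gauss (z : Phase d) :
    HasFDerivAt (gauss d) (gauss d z • ((-2 : ℝ) • innerSL ℝ z)) z := by
  have h1 : HasFDerivAt (fun z : Phase d => -‖z‖ ^ 2) (-((2 : ℝ) • innerSL ℝ z)) z := by
    have h := (hasStrictFDerivAt_norm_sq z).hasFDerivAt.neg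
    refine HasFDerivAt.congr_fderiv (f := fun z : Phase d => -‖z‖ ^ 2) h ?_
    ext v
    simp [two_smul]
  refine HasFDerivAt.congr_fderiv (f := gauss d) (h1.exp.const_mul ((Real.pi ^ d)⁻¹)) ?_
  ext v
  simp only [gauss, smul_apply, neg_apply, smul_eq_mul]
  ring

/-- The derivative is the Gaussian times a linear map, so each derivative costs one power of decay.
All powers are available since 1 + t ≤ 2 + t² bounds them by a multiple of exp(t²). -/
lemma schwartzB_gauss {ι : Type} : SchwartzB (fun _ : ι => gauss d) := by
  have hd : Differentiable ℝ (gauss d) := fun z => (hasFDerivAt_gauss z).differentiableAt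
  refine SchwartzB.of_neg fun m n => ?_
  induction n generalizing m with
  | zero =>
    refine SymB.of_bound (fun _ => hd.continuous)
      ((Real.pi ^ d)⁻¹ * (m.factorial * Real.exp 2)) (by positivity) fun _ z => ?_
    rw [Real.norm_of_nonneg (gauss_nonneg z), gauss, mul_assoc]
    refine mul_le_mul_of_nonneg_left ?_ (by positivity)
    have h1 := Real.pow_div_factorial_le_exp (1 + ‖z‖) (by positivity) m
    rw [div_le_iff₀ (by positivity)] at h1
    have h2 : Real.exp (1 + ‖z‖) ≤ Real.exp 2 * Real.exp (‖z‖ ^ 2) := by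
      rw [← Real.exp_add]
      exact Real.exp_le_exp.2 (by nlinarith [sq_nonneg (‖z‖ - 1)])
    rw [jb_neg, ← div_eq_mul_inv, le_div_iff₀ (jb_pos _ _), jb_natCast, Real.exp_neg,
      inv_mul_le_iff₀ (Real.exp_pos _)]
    have := Real.exp_pos (‖z‖ ^ 2)
    calc _ ≤ Real.exp (1 + ‖z‖) * m.factorial := h1
      _ ≤ (Real.exp 2 * Real.exp (‖z‖ ^ 2)) * m.factorial := by gcongr
      _ = _ := by ring
  | succ n ih =>
    refine SymB.of_fderiv ((ih m).of_le (Nat.zero_le n)) (fun _ => hd) ?_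
    have e : (fun _ : ι => fderiv ℝ (gauss d)) =
        fun _ z => ContinuousLinearMap.lsmul ℝ ℝ (gauss d z)
          (((-2 : ℝ) • (innerSL ℝ : Phase d →L[ℝ] Phase d →L[ℝ] ℝ)) z) :=
      funext fun _ => funext fun z => (hasFDerivAt_gauss z).fderiv
    rw [e]
    have hl := SymB.linear (n := n) (fun _ : ι =>
      (-2 : ℝ) • (innerSL ℝ : Phase d →L[ℝ] Phase d →L[ℝ] ℝ)) (norm_nonneg _) fun _ => le_rfl
    refine ((ih (m + 1)).bilin (ContinuousLinearMap.lsmul ℝ ℝ) hl).mono' fun z => ?_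
    rw [← jb_add]
    exact jb_mono (by push_cast; omega) z

lemma integral_gauss : ∫ z, gauss d z = 1 := by
  have := GaussianFourier.integral_rexp_neg_mul_sq_norm (V := Phase d) (b := 1) one_pos
  simp only [gauss]
  rw [integral_const_mul]
  simp only [neg_mul, one_mul, div_one] at this
  rw [this, finrank_phase]
  rw [show (((2 * d : ℕ) : ℝ) / 2) = (d : ℕ) by push_cast; ring, Real.rpow_natCast]
  exact inv_mul_cancel₀ (by positivity)

lemma pd_gauss (j : Fin d ⊕ Fin d) (z : Phase d) : pd j (gauss d) z = -2 * (z j * gauss d z) := by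
  rw [pd, (hasFDerivAt_gauss z).fderiv]
  simp [EuclideanSpace.inner_single_right]
  ring

end Gaussian

lemma clm_eq_sum {κ E : Type} [Fintype κ] [DecidableEq κ] [NormedAddCommGroup E] [NormedSpace ℝ E]
    (L : EuclideanSpace ℝ κ →L[ℝ] E) (x : EuclideanSpace ℝ κ) :
    L x = ∑ j, x j • L (EuclideanSpace.single j 1) := by
  have hx : x = ∑ j, (x j : ℝ) • (EuclideanSpace.single j (1 : ℝ) : EuclideanSpace ℝ κ) := by
    simpa using ((EuclideanSpace.basisFun κ ℝ).sum_repr x).symm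
  conv_lhs => rw [hx, map_sum]
  simp only [map_smul]

/-! ### Gaussian averages: heat expansion and rescaling -/

section Convolution

variable {d : ℕ} {ι : Type} {E F G : Type} [NormedAddCommGroup E] [NormedSpace ℝ E]
  [NormedAddCommGroup F] [NormedSpace ℝ F] [NormedAddCommGroup G] [NormedSpace ℝ G]

/-- Derivatives fall only on `f`; `g` supplies decay for Peetre's inequality. It is used with `g`
Gaussian at small scales, and with the roles exchanged at large scales. -/
lemma schwartzB_dilConv (B : E →L[ℝ] F →L[ℝ] G) {g : ι → Phase d → E} {f : ι → Phase d → F}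
    (hg : SchwartzB g) (hf : SchwartzB f) {l : ι → ℝ} (hl : ∀ i, |l i| ≤ 1) :
    SchwartzB (fun i z => ∫ x, B (g i x) (f i (z - l i • x))) := by
  refine SchwartzB.of_neg fun m n => ?_
  obtain ⟨Cf, hCf, hf'⟩ := (hf (-(m : ℤ)) n).2
  obtain ⟨Cg, hCg, hg'⟩ := (hg (-((m : ℤ) + (2 * d + 1 : ℕ))) 0).bound
  refine symB_integral (S := Set.univ) (μ := fun x => jb (-((2 * d + 1 : ℕ) : ℤ)) x) (by simp)
    (integrable_jb (by rw [finrank_phase]; push_cast; omega)) (fun _ => jb_nonneg _ _)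
    (continuous_jb _) (f := fun i x z => B (g i x) (f i (z - l i • x)))
    (fun i => ?_) (C := ‖B‖ * Cg * Cf) (by positivity) fun i x _ k hk z => ?_
  · have h1 : ContDiff ℝ n (g i) := (hg 0 n).1 i
    have h2 : ContDiff ℝ n (f i) := (hf 0 n).1 i
    exact (B.contDiff.comp (h1.comp contDiff_fst)).clm_apply
      (h2.comp (contDiff_snd.sub (contDiff_fst.const_smul (l i))))
  · have h2 : ContDiff ℝ n (f i) := (hf 0 n).1 i
    have h3 := (B (g i x)).norm_iteratedFDeriv_comp_left (x := z)
      (f := fun z => f i (z - l i • x)) (N := n) (n := k)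
      (h2.comp (contDiff_id.sub contDiff_const)).contDiffAt (by exact_mod_cast hk)
    have h4 : iteratedFDeriv ℝ k (fun z => f i (z - l i • x)) z =
        iteratedFDeriv ℝ k (f i) (z - l i • x) := iteratedFDeriv_comp_sub _ _ _
    rw [h4] at h3
    refine h3.trans ?_
    have h5 : jb (-(m : ℤ)) (z - l i • x) ≤ jb (-(m : ℤ)) z * jb m x := by
      rw [sub_eq_add_neg]
      refine (jb_neg_add_le (by omega) _ _).trans ?_
      refine mul_le_mul_of_nonneg_left (jb_le_of_norm_le (by omega) ?_) (jb_nonneg _ _)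
      rw [norm_neg, norm_smul]
      exact mul_le_of_le_one_left (norm_nonneg _) (hl i)
    have h6 : jb (-((m : ℤ) + (2 * d + 1 : ℕ))) x * jb m x = jb (-((2 * d + 1 : ℕ) : ℤ)) x := by
      rw [← jb_add]; congr 1; ring
    calc _ ≤ (‖B‖ * (Cg * jb (-((m : ℤ) + (2 * d + 1 : ℕ))) x)) *
          (Cf * (jb (-(m : ℤ)) z * jb m x)) := by
          have h7 := (B.le_opNorm (g i x)).trans
            (mul_le_mul_of_nonneg_left (hg' i x) (norm_nonneg B))
          have h8 := (hf' i k hk (z - l i • x)).trans (mul_le_mul_of_nonneg_left h5 hCf)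
          exact mul_le_mul h7 h8 (norm_nonneg _) ((norm_nonneg _).trans h7)
      _ = ‖B‖ * Cg * Cf * jb (-(m : ℤ)) z *
          (jb (-((m : ℤ) + (2 * d + 1 : ℕ))) x * jb m x) := by ring
      _ = _ := by rw [h6]

/-- The convolution of `f` with the Gaussian `l^{-2d} gauss(z / l)`. -/
def heat (l : ℝ) (f : Phase d → E) (z : Phase d) : E := ∫ x, gauss d x • f (z - l • x)

lemma SchwartzB.heat {f : ι → Phase d → E} (hf : SchwartzB f) {l : ι → ℝ} (hl : ∀ i, |l i| ≤ 1) :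
    SchwartzB (fun i => heat (l i) (f i)) :=
  schwartzB_dilConv (ContinuousLinearMap.lsmul ℝ ℝ) schwartzB_gauss hf hl

variable {f : Phase d → E}

lemma integrable_gauss_mul_jb (m : ℤ) : Integrable fun x => gauss d x * jb m x := by
  obtain ⟨C, hC, h⟩ := (schwartzB_gauss (d := d) (ι := Unit) (-(m + (2 * d + 1 : ℕ))) 0).bound
  have hc : Continuous (gauss d) := (schwartzB_gauss (d := d) (ι := Unit)).contDiff () |>.continuous
  refine ((integrable_jb (X := Phase d) (μ := volume) (m := (2 * d + 1 : ℕ))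
    (by rw [finrank_phase]; push_cast; omega)).const_mul C).mono'
    (hc.mul (continuous_jb m)).aestronglyMeasurable (Filter.Eventually.of_forall fun x => ?_)
  have h1 := h () x
  rw [Real.norm_of_nonneg (mul_nonneg (gauss_nonneg x) (jb_nonneg _ _))]
  rw [Real.norm_of_nonneg (gauss_nonneg x)] at h1
  calc _ ≤ C * jb (-(m + (2 * d + 1 : ℕ))) x * jb m x :=
        mul_le_mul_of_nonneg_right h1 (jb_nonneg _ _)
    _ = C * jb (-((2 * d + 1 : ℕ) : ℤ)) x := by rw [mul_assoc, ← jb_add]; congr 2; ring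

lemma integrable_gauss_mul_jb_smul (hc : Continuous f) {C : ℝ} {m : ℤ}
    (h : ∀ x, ‖f x‖ ≤ C * jb m x) : Integrable fun x => gauss d x • f x := by
  have hg : Continuous (gauss d) := (schwartzB_gauss (d := d) (ι := Unit)).contDiff () |>.continuous
  refine ((integrable_gauss_mul_jb m).const_mul C).mono' (hg.smul hc).aestronglyMeasurable
    (Filter.Eventually.of_forall fun x => ?_)
  rw [norm_smul, Real.norm_of_nonneg (gauss_nonneg x)]
  calc _ ≤ gauss d x * (C * jb m x) := mul_le_mul_of_nonneg_left (h x) (gauss_nonneg x)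
    _ = _ := by ring

lemma integrable_heat (hf : SchwartzB fun _ : Unit => f) (l : ℝ) (z : Phase d) :
    Integrable fun x => gauss d x • f (z - l • x) := by
  obtain ⟨C, hC, h⟩ := (hf 0 0).bound
  have := (hf.contDiff ()).continuous
  refine integrable_gauss_mul_jb_smul (by fun_prop) (C := C) (m := 0) fun x => ?_
  simpa [jb_zero] using h () (z - l • x)

lemma fderiv_heat (hf : SchwartzB fun _ : Unit => f) (l : ℝ) :
    fderiv ℝ (heat l f) = heat l (fderiv ℝ f) := by
  obtain ⟨C, hC, h⟩ := (hf 0 0).bound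
  obtain ⟨C', hC', h'⟩ := (hf.fderiv 0 0).bound
  simp only [jb_zero, mul_one] at h h'
  have hd : ∀ x z, HasFDerivAt (fun z => gauss d x • f (z - l • x))
      (gauss d x • fderiv ℝ f (z - l • x)) z := fun x z => by
    have h1 := ((hf.contDiff ()).differentiable (by simp) (z - l • x)).hasFDerivAt
    exact (h1.comp z ((hasFDerivAt_id z).sub_const _)).const_smul _
  have hfc := (hf.contDiff ()).of_le (show (1 : WithTop ℕ∞) ≤ (⊤ : ℕ∞) by simp)
  have hgc := ((schwartzB_gauss (d := d) (ι := Unit)).contDiff ()).of_le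
    (show (1 : WithTop ℕ∞) ≤ (⊤ : ℕ∞) by simp)
  ext1 z
  have := hasFDerivAt_integral_param (S := Set.univ) (ν := volume) (by simp)
    (μ := fun x => gauss d x * jb 0 x) (integrable_gauss_mul_jb 0)
    (w := fun _ : Phase d => max C C') continuous_const
    (f := fun x z => gauss d x • f (z - l • x))
    ((hgc.comp contDiff_fst).smul
      (hfc.comp (contDiff_snd.sub (contDiff_fst.const_smul l))))
    (fun x _ z => ?_) (fun x _ z => ?_) z
  · have e : ∀ x, fderiv ℝ (fun z => gauss d x • f (z - l • x)) z =
        gauss d x • fderiv ℝ f (z - l • x) := fun x => (hd x z).fderiv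
    simp only [e] at this
    exact this.fderiv
  · rw [norm_smul, Real.norm_of_nonneg (gauss_nonneg x), jb_zero, mul_one, mul_comm]
    exact mul_le_mul_of_nonneg_right ((h () _).trans (le_max_left _ _)) (gauss_nonneg x)
  · rw [(hd x z).fderiv, norm_smul, Real.norm_of_nonneg (gauss_nonneg x), jb_zero, mul_one,
      mul_comm]
    exact mul_le_mul_of_nonneg_right ((h' () _).trans (le_max_right _ _)) (gauss_nonneg x)

variable [CompleteSpace E]

lemma heat_zero (z : Phase d) : heat 0 f z = f z := by
  simp only [heat, zero_smul, sub_zero]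
  rw [integral_smul_const, integral_gauss, one_smul]

lemma integrable_coord_gauss_smul (hf : SchwartzB fun _ : Unit => f) (j : Fin d ⊕ Fin d) (r : ℝ)
    (z : Phase d) : Integrable fun x : Phase d => (x j * gauss d x) • f (z - r • x) := by
  have hfc := (hf.contDiff ()).continuous
  obtain ⟨C, hC, h⟩ := (hf 0 0).bound
  simp only [jb_zero, mul_one] at h
  have : Integrable fun x : Phase d => gauss d x • (x j • f (z - r • x)) := by
    refine integrable_gauss_mul_jb_smul (by fun_prop) (C := C) (m := 1) fun x => ?_
    rw [norm_smul, mul_comm]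
    have h1 : ‖x j‖ ≤ jb 1 x := (PiLp.norm_apply_le x j).trans (by simpa using norm_pow_le_jb 1 x)
    exact mul_le_mul (h () _) h1 (norm_nonneg _) hC
  refine this.congr (Filter.Eventually.of_forall fun x => ?_)
  simp only
  rw [smul_smul, mul_comm]

/-- Integration by parts: a coordinate times the Gaussian is -1/2 times its partial derivative. -/
lemma integral_coord_gauss_smul (hf : SchwartzB fun _ : Unit => f) (j : Fin d ⊕ Fin d) (r : ℝ)
    (z : Phase d) : ∫ x, (x j * gauss d x) • f (z - r • x) = -(r / 2) • heat r (pd j f) z := by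
  have hfd : ∀ x, HasFDerivAt (fun x => f (z - r • x))
      ((fderiv ℝ f (z - r • x)).comp (-(r • ContinuousLinearMap.id ℝ (Phase d)))) x := fun x => by
    have h1 := ((hf.contDiff ()).differentiable (by simp) (z - r • x)).hasFDerivAt
    exact h1.comp x (((hasFDerivAt_id x).const_smul r).const_sub z)
  have e1 : ∀ x, fderiv ℝ (fun x => f (z - r • x)) x (EuclideanSpace.single j 1) =
      -(r • pd j f (z - r • x)) := fun x => by
    rw [(hfd x).fderiv]
    simp [pd]
  have e2 : ∀ x, fderiv ℝ (gauss d) x (EuclideanSpace.single j 1) =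
      -2 * (x j * gauss d x) := pd_gauss j
  have hfc := (hf.contDiff ()).continuous
  obtain ⟨C, hC, h⟩ := (hf 0 0).bound
  simp only [jb_zero, mul_one] at h
  have hi := integrable_coord_gauss_smul hf j r z
  have key := integral_smul_fderiv_eq_neg_fderiv_smul_of_integrable (μ := volume)
    (f := gauss d) (g := fun x => f (z - r • x)) (v := EuclideanSpace.single j 1)
    (by
      simp only [e2, mul_smul (-2 : ℝ)]
      exact hi.smul (-2 : ℝ))
    (by
      simp only [e1, smul_neg, smul_comm _ r]
      exact ((integrable_heat (hf.pd j) r z).smul r).neg)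
    (integrable_heat hf r z)
    (fun x _ => (hasFDerivAt_gauss x).differentiableAt)
    (fun x _ => (hfd x).differentiableAt)
  simp only [e1, e2, smul_neg, smul_comm _ r, mul_smul (-2 : ℝ)] at key
  rw [integral_neg, integral_smul, integral_smul, neg_smul, neg_neg] at key
  have e3 : ∫ x, gauss d x • pd j f (z - r • x) = heat r (pd j f) z := rfl
  rw [e3] at key
  rw [neg_smul, div_eq_inv_mul, mul_smul, ← smul_neg, key, smul_smul]
  norm_num

/-- The heat equation with time r²/4: differentiating in `r` brings down the coordinates, which
integration by parts converts into a second derivative. -/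
lemma hasDerivAt_heat (hf : SchwartzB fun _ : Unit => f) (r : ℝ) (z : Phase d) :
    HasDerivAt (fun r => heat r f z) ((r / 2) • heat r (lap f) z) r := by
  have hfc := (hf.contDiff ()).continuous
  have hgc := ((schwartzB_gauss (d := d) (ι := Unit)).contDiff ()).continuous
  have hfdc := (hf.fderiv.contDiff ()).continuous
  obtain ⟨C, hC, h⟩ := (hf.fderiv 0 0).bound
  simp only [jb_zero, mul_one] at h
  have hb : ∀ (r : ℝ) x, ‖gauss d x • fderiv ℝ f (z - r • x) (-x)‖ ≤ C * (gauss d x * jb 1 x) := by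
    intro r x
    rw [norm_smul, Real.norm_of_nonneg (gauss_nonneg x)]
    have h1 : ‖-x‖ ≤ jb 1 x := by simpa using norm_pow_le_jb 1 x
    have h2 : ‖fderiv ℝ f (z - r • x) (-x)‖ ≤ C * jb 1 x :=
      (ContinuousLinearMap.le_opNorm _ _).trans (mul_le_mul (h () _) h1 (norm_nonneg _) hC)
    calc _ ≤ gauss d x * (C * jb 1 x) := mul_le_mul_of_nonneg_left h2 (gauss_nonneg x)
      _ = _ := by ring
  have key := (hasDerivAt_integral_of_dominated_loc_of_deriv_le (μ := volume)
    (F := fun (r : ℝ) x => gauss d x • f (z - r • x))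
    (F' := fun (r : ℝ) x => gauss d x • fderiv ℝ f (z - r • x) (-x)) (x₀ := r) (s := Set.univ)
    (bound := fun x => C * (gauss d x * jb 1 x)) Filter.univ_mem
    (Filter.Eventually.of_forall fun r => (integrable_heat hf r z).aestronglyMeasurable)
    (integrable_heat hf r z)
    (Continuous.aestronglyMeasurable (by fun_prop))
    (Filter.Eventually.of_forall fun x r _ => hb r x)
    ((integrable_gauss_mul_jb 1).const_mul C)
    (Filter.Eventually.of_forall fun x r _ => ?_)).2
  · have e : ∫ x, gauss d x • fderiv ℝ f (z - r • x) (-x) = (r / 2) • heat r (lap f) z := by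
      have e1 : ∀ x, gauss d x • fderiv ℝ f (z - r • x) (-x) =
          ∑ j, -((x j * gauss d x) • pd j f (z - r • x)) := by
        intro x
        rw [map_neg, smul_neg, clm_eq_sum, Finset.smul_sum, ← Finset.sum_neg_distrib]
        refine Finset.sum_congr rfl fun j _ => ?_
        rw [smul_smul, mul_comm]
        rfl
      simp only [e1]
      rw [integral_finsetSum _ fun j _ => ?_]
      · simp only [integral_neg, integral_coord_gauss_smul (hf.pd _)]
        simp only [neg_smul, neg_neg, ← Finset.smul_sum]
        congr 1
        simp only [heat, lap, Finset.smul_sum]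
        rw [integral_finsetSum _ fun j _ => integrable_heat ((hf.pd j).pd j) r z]
      · exact (integrable_coord_gauss_smul (hf.pd j) j r z).neg
    rw [← e]
    exact key
  · have h1 := ((hf.contDiff ()).differentiable (by simp) (z - r • x)).hasFDerivAt
    have h2 : HasDerivAt (fun r : ℝ => z - r • x) (-x) r := by
      simpa using ((hasDerivAt_id r).smul_const x).const_sub z
    exact (h1.comp_hasDerivAt r h2).const_smul _

/-- The first order remainder of the Gaussian convolution, scaled by `l^{-2}`. -/
def heatR1 (l : ℝ) (f : Phase d → E) (z : Phase d) : E := (l ^ 2)⁻¹ • (heat l f z - f z)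

/-- The second order remainder of the Gaussian convolution, scaled by `l^{-4}`. -/
def heatR2 (l : ℝ) (f : Phase d → E) (z : Phase d) : E :=
  (l ^ 4)⁻¹ • (heat l f z - f z - (l ^ 2 / 4) • lap f z)

lemma heat_bound {f : ι → Phase d → E} (hf : SchwartzB f) (m : ℤ) :
    ∃ C, 0 ≤ C ∧ ∀ i l z, |l| ≤ 1 → ‖heat l (f i) z‖ ≤ C * jb m z := by
  obtain ⟨C, hC, h⟩ := ((SchwartzB.reindex hf (fun j : ι × {l : ℝ // |l| ≤ 1} => j.1)).heat
    (l := fun j => j.2) (fun j => j.2.2) m 0).bound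
  exact ⟨C, hC, fun i l z hl => h (i, ⟨l, hl⟩) z⟩

lemma norm_sub_le_of_hasDerivAt {φ φ' : ℝ → E} {l C : ℝ} (hl : 0 ≤ l)
    (h : ∀ r, HasDerivAt φ (φ' r) r) (hC : ∀ r ∈ Set.Icc 0 l, ‖φ' r‖ ≤ C) :
    ‖φ l - φ 0‖ ≤ C * l := by
  have := Convex.norm_image_sub_le_of_norm_hasDerivWithin_le (s := Set.Icc 0 l)
    (fun r _ => (h r).hasDerivWithinAt) hC (convex_Icc 0 l)
    (Set.left_mem_Icc.2 hl) (Set.right_mem_Icc.2 hl)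
  simpa [abs_of_nonneg hl] using this

lemma heatR1_bound {f : ι → Phase d → E} (hf : SchwartzB f) (m : ℤ) :
    ∃ C, 0 ≤ C ∧ ∀ i l z, 0 < l → l ≤ 1 → ‖heatR1 l (f i) z‖ ≤ C * jb m z := by
  obtain ⟨C, hC, h⟩ := heat_bound hf.lap m
  refine ⟨C, hC, fun i l z hl hl1 => ?_⟩
  have h1 := norm_sub_le_of_hasDerivAt (φ := fun r => heat r (f i) z) (C := l * (C * jb m z)) hl.le
    (fun r => hasDerivAt_heat (hf.reindex fun _ : Unit => i) r z) fun r hr => by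
      rw [norm_smul, Real.norm_of_nonneg (by linarith [hr.1])]
      have := h i r z (by rw [abs_of_nonneg hr.1]; exact hr.2.trans hl1)
      have h0 := mul_nonneg hC (jb_nonneg m z)
      exact mul_le_mul (by linarith [hr.1, hr.2]) this (norm_nonneg _) hl.le
  simp only [heat_zero] at h1
  rw [heatR1, norm_smul, norm_inv, Real.norm_of_nonneg (by positivity),
    inv_mul_le_iff₀ (by positivity)]
  calc _ ≤ _ := h1
    _ = _ := by ring

/-- By the heat equation, the unscaled second order remainder has `r`-derivative (r³/2) times the
first order remainder of the Laplacian. The mean value inequality on [0, l] then yields l⁴. -/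
lemma heatR2_bound {f : ι → Phase d → E} (hf : SchwartzB f) (m : ℤ) :
    ∃ C, 0 ≤ C ∧ ∀ i l z, 0 < l → l ≤ 1 → ‖heatR2 l (f i) z‖ ≤ C * jb m z := by
  obtain ⟨C, hC, h⟩ := heatR1_bound hf.lap m
  refine ⟨C, hC, fun i l z hl hl1 => ?_⟩
  have h0 := mul_nonneg hC (jb_nonneg m z)
  have h1 := norm_sub_le_of_hasDerivAt
    (φ := fun r => heat r (f i) z - f i z - (r ^ 2 / 4) • lap (f i) z)
    (φ' := fun r => (r / 2) • heat r (lap (f i)) z - (r / 2) • lap (f i) z)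
    (C := l ^ 3 * (C * jb m z)) hl.le
    (fun r => by
      have e : HasDerivAt (fun r : ℝ => r ^ 2 / 4) (r / 2) r := by
        refine ((hasDerivAt_pow 2 r).div_const 4).congr_deriv ?_
        push_cast; ring
      exact ((hasDerivAt_heat (hf.reindex fun _ : Unit => i) r z).sub_const _).sub
        (e.smul_const _)) fun r hr => by
      -- At `r = 0` the scaled remainder `heatR1` does not describe the derivative, which vanishes
      -- directly.
      rcases hr.1.eq_or_lt with h2 | h2
      · subst h2
        simp; positivity
      · have e : (r / 2) • heat r (lap (f i)) z - (r / 2) • lap (f i) z =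
            (r ^ 3 / 2) • heatR1 r (lap (f i)) z := by
          rw [heatR1, smul_smul, ← smul_sub]
          congr 1
          field_simp
        rw [e, norm_smul, Real.norm_of_nonneg (by positivity)]
        have h3 := h i r z h2 (hr.2.trans hl1)
        refine mul_le_mul ?_ h3 (norm_nonneg _) (by positivity)
        have : r ^ 3 ≤ l ^ 3 := by gcongr; exact hr.2
        have : 0 ≤ r ^ 3 := by positivity
        linarith
  simp only [heat_zero, sub_self, ne_eq, OfNat.ofNat_ne_zero, not_false_eq_true, zero_pow,
    zero_div, zero_smul, sub_zero] at h1
  rw [heatR2, norm_smul, norm_inv, Real.norm_of_nonneg (by positivity),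
    inv_mul_le_iff₀ (by positivity)]
  calc _ ≤ _ := h1
    _ = _ := by ring

lemma contDiff_heat (hf : SchwartzB fun _ : Unit => f) {l : ℝ} (hl : |l| ≤ 1) :
    ContDiff ℝ ∞ (heat l f) :=
  (hf.heat (l := fun _ => l) fun _ => hl).contDiff ()

lemma contDiff_heatR1 (hf : SchwartzB fun _ : Unit => f) {l : ℝ} (hl : |l| ≤ 1) :
    ContDiff ℝ ∞ (heatR1 l f) :=
  ((contDiff_heat hf hl).sub (hf.contDiff ())).const_smul _

lemma contDiff_heatR2 (hf : SchwartzB fun _ : Unit => f) {l : ℝ} (hl : |l| ≤ 1) :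
    ContDiff ℝ ∞ (heatR2 l f) :=
  (((contDiff_heat hf hl).sub (hf.contDiff ())).sub
    ((contDiff_lap (hf.contDiff ())).const_smul _)).const_smul _

lemma fderiv_heatR1 (hf : SchwartzB fun _ : Unit => f) {l : ℝ} (hl : |l| ≤ 1) :
    fderiv ℝ (heatR1 l f) = heatR1 l (fderiv ℝ f) := by
  ext1 z
  have h1 := (contDiff_heat hf hl).differentiable (by simp) z
  have h2 := (hf.contDiff ()).differentiable (by simp) z
  have h := (h1.hasFDerivAt.sub h2.hasFDerivAt).const_smul ((l ^ 2)⁻¹)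
  rw [fderiv_heat hf] at h
  exact HasFDerivAt.fderiv (f := heatR1 l f) h

lemma fderiv_heatR2 (hf : SchwartzB fun _ : Unit => f) {l : ℝ} (hl : |l| ≤ 1) :
    fderiv ℝ (heatR2 l f) = heatR2 l (fderiv ℝ f) := by
  ext1 z
  have h1 := (contDiff_heat hf hl).differentiable (by simp) z
  have h2 := (hf.contDiff ()).differentiable (by simp) z
  have h3 := (contDiff_lap (hf.contDiff ())).differentiable (by simp) z
  have h := ((h1.hasFDerivAt.sub h2.hasFDerivAt).sub
    (h3.hasFDerivAt.const_smul (l ^ 2 / 4))).const_smul ((l ^ 4)⁻¹)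
  rw [fderiv_heat hf, fderiv_lap (hf.contDiff ())] at h
  exact HasFDerivAt.fderiv (f := heatR2 l f) h

/-- Remainders commute with differentiation, so the pointwise bound applied to successive
derivatives of `f` suffices; the target space varies in the induction. -/
lemma SchwartzB.heatR1 {f : ι → Phase d → E} (hf : SchwartzB f) {l : ι → ℝ}
    (hl : ∀ i, 0 < l i) (hl1 : ∀ i, l i ≤ 1) : SchwartzB (fun i => heatR1 (l i) (f i)) := by
  have ha : ∀ i, |l i| ≤ 1 := fun i => by rw [abs_of_pos (hl i)]; exact hl1 i
  intro m n
  have h0 : SymB 0 (jb m) (fun i => _root_.heatR1 (l i) (f i)) := by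
    obtain ⟨C, hC, h⟩ := heatR1_bound hf m
    exact SymB.of_bound (fun i => (contDiff_heatR1 (hf.reindex fun _ => i) (ha i)).continuous) C hC
      fun i z => h i (l i) z (hl i) (hl1 i)
  induction n generalizing E with
  | zero => exact h0
  | succ n ih =>
    refine SymB.of_fderiv h0 (fun i => (contDiff_heatR1 (hf.reindex fun _ => i) (ha i)).differentiable
      (by simp)) ?_
    simp only [fun i => fderiv_heatR1 (hf.reindex fun _ : Unit => i) (ha i)]
    refine ih hf.fderiv ?_
    obtain ⟨C, hC, h⟩ := heatR1_bound hf.fderiv m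
    exact SymB.of_bound
      (fun i => (contDiff_heatR1 (hf.fderiv.reindex fun _ => i) (ha i)).continuous) C hC
      fun i z => h i (l i) z (hl i) (hl1 i)

lemma SchwartzB.heatR2 {f : ι → Phase d → E} (hf : SchwartzB f) {l : ι → ℝ}
    (hl : ∀ i, 0 < l i) (hl1 : ∀ i, l i ≤ 1) : SchwartzB (fun i => heatR2 (l i) (f i)) := by
  have ha : ∀ i, |l i| ≤ 1 := fun i => by rw [abs_of_pos (hl i)]; exact hl1 i
  intro m n
  have h0 : SymB 0 (jb m) (fun i => _root_.heatR2 (l i) (f i)) := by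
    obtain ⟨C, hC, h⟩ := heatR2_bound hf m
    exact SymB.of_bound (fun i => (contDiff_heatR2 (hf.reindex fun _ => i) (ha i)).continuous) C hC
      fun i z => h i (l i) z (hl i) (hl1 i)
  induction n generalizing E with
  | zero => exact h0
  | succ n ih =>
    refine SymB.of_fderiv h0 (fun i => (contDiff_heatR2 (hf.reindex fun _ => i) (ha i)).differentiable
      (by simp)) ?_
    simp only [fun i => fderiv_heatR2 (hf.reindex fun _ : Unit => i) (ha i)]
    refine ih hf.fderiv ?_
    obtain ⟨C, hC, h⟩ := heatR2_bound hf.fderiv m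
    exact SymB.of_bound
      (fun i => (contDiff_heatR2 (hf.fderiv.reindex fun _ => i) (ha i)).continuous) C hC
      fun i z => h i (l i) z (hl i) (hl1 i)

lemma integral_comp_sub_smul {l : ℝ} (hl : 0 < l) (F : Phase d → E) (z : Phase d) :
    ∫ x, F (z - l • x) = (l ^ (2 * d))⁻¹ • ∫ x, F x := by
  rw [Measure.integral_comp_smul volume (fun y => F (z - y)) l, finrank_phase,
    integral_sub_left_eq_self F volume z, abs_of_pos (by positivity)]

/-- Substituting t = z - √ε x turns the Gaussian of covariance ε/2 into the fixed profile. Hence the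
scale is l = √ε. -/
lemma convolution_phaseGaussian {ε : ℝ} (hε : 0 < ε) (a : Phase d → ℝ) :
    MeasureTheory.convolution a (phaseGaussian ε) (ContinuousLinearMap.mul ℝ ℝ) volume =
      heat (√ε) a := by
  ext z
  have hl : 0 < √ε := Real.sqrt_pos.2 hε
  have h := integral_comp_sub_smul hl (fun t => a t * gauss d ((√ε)⁻¹ • (z - t))) z
  simp only [sub_sub_cancel, smul_smul, inv_mul_cancel₀ hl.ne', one_smul] at h
  rw [heat]
  simp only [smul_eq_mul, mul_comm (gauss d _)]
  rw [h, smul_eq_mul, ← integral_const_mul, MeasureTheory.convolution]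
  refine integral_congr_ae (Filter.Eventually.of_forall fun t => ?_)
  simp only [ContinuousLinearMap.mul_apply', phaseGaussian, gauss, norm_smul, norm_inv,
    Real.norm_of_nonneg hl.le, mul_pow, inv_pow, Real.sq_sqrt hε.le, pow_mul]
  rw [show -‖z - t‖ ^ 2 / ε = -(ε⁻¹ * ‖z - t‖ ^ 2) by ring, mul_inv]
  ring

/-- The Gaussian convolution at scale `l`, seen in the variables rescaled by `l`. -/
lemma heat_smul {l : ℝ} (hl : 0 < l) (v : Phase d) :
    heat l f (l • v) = (l ^ (2 * d))⁻¹ • ∫ w, gauss d (v - l⁻¹ • w) • f w := by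
  have h := integral_comp_sub_smul hl (fun w => gauss d (v - l⁻¹ • w) • f w) (l • v)
  simp only [smul_sub, smul_smul, inv_mul_cancel₀ hl.ne', one_smul, sub_sub_cancel] at h
  exact h

/-- At scale l ≥ 1 the average spreads over distance l with height of order l to the power -2d. In
the rescaled variable it is a fixed Gaussian convolved with a concentrated copy of `f`, so the
bounds are uniform. -/
lemma schwartzB_heat_smul {f : ι → Phase d → E} (hf : SchwartzB f) {l : ι → ℝ}
    (hl : ∀ i, 1 ≤ l i) : SchwartzB (fun i v => (l i ^ (2 * d)) • heat (l i) (f i) (l i • v)) := by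
  have hl0 : ∀ i, 0 < l i := fun i => one_pos.trans_le (hl i)
  have h := schwartzB_dilConv (ContinuousLinearMap.lsmul ℝ ℝ : ℝ →L[ℝ] E →L[ℝ] E).flip hf
    (schwartzB_gauss (d := d)) (l := fun i => (l i)⁻¹) fun i => by
      rw [abs_of_pos (inv_pos.2 (hl0 i))]; exact inv_le_one_of_one_le₀ (hl i)
  have e : (fun i v => (l i ^ (2 * d)) • heat (l i) (f i) (l i • v)) =
      fun i v => ∫ x, (ContinuousLinearMap.lsmul ℝ ℝ : ℝ →L[ℝ] E →L[ℝ] E).flip (f i x)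
        (gauss d (v - (l i)⁻¹ • x)) := by
    funext i v
    rw [heat_smul (hl0 i), smul_smul, mul_inv_cancel₀ (pow_pos (hl0 i) _).ne', one_smul]
    rfl
  rw [e]
  exact h

end Convolution

/-! ### Second order Taylor formula with integral remainder -/

section TaylorRemainder

set_option maxSynthPendingDepth 3

variable {X : Type} [NormedAddCommGroup X] [NormedSpace ℝ X]

/-- The third derivative. -/
def d3 (b : X → ℝ) : X → X →L[ℝ] X →L[ℝ] X →L[ℝ] ℝ := fderiv ℝ (fderiv ℝ (fderiv ℝ b))

/-- The integral remainder of the second order Taylor expansion of `c ↦ b (z + c • w)`, divided by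
`c ^ 3`. -/
def taylorRem (b : X → ℝ) (c : ℝ) (z w : X) : ℝ :=
  ∫ s in Set.Ioc (0 : ℝ) 1, (1 / 2 * (1 - s) ^ 2) * d3 b (z + (s * c) • w) w w w

lemma contDiff_d3 {b : X → ℝ} (hb : ContDiff ℝ ∞ b) : ContDiff ℝ ∞ (d3 b) :=
  ((hb.fderiv_right (m := ∞) (by simp)).fderiv_right (m := ∞) (by simp)).fderiv_right
    (m := ∞) (by simp)

lemma hasDerivAt_comp_line {E : Type} [NormedAddCommGroup E] [NormedSpace ℝ E] {g : X → E}
    (hg : Differentiable ℝ g) (c : ℝ) (z w : X) (s : ℝ) :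
    HasDerivAt (fun s : ℝ => g (z + (s * c) • w)) (c • fderiv ℝ g (z + (s * c) • w) w) s := by
  have h1 : HasDerivAt (fun s : ℝ => z + (s * c) • w) (c • w) s := by
    simpa using (((hasDerivAt_id s).mul_const c).smul_const w).const_add z
  have h2 := (hg (z + (s * c) • w)).hasFDerivAt.comp_hasDerivAt s h1
  rw [map_smul] at h2
  exact h2

lemma taylor_line {b : X → ℝ} (hb : ContDiff ℝ ∞ b) (c : ℝ) (z w : X) :
    b (z + c • w) = b z + c * fderiv ℝ b z w + c ^ 2 / 2 * fderiv ℝ (fderiv ℝ b) z w w +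
      c ^ 3 * taylorRem b c z w := by
  have hb1 : ContDiff ℝ ∞ (fderiv ℝ b) := hb.fderiv_right (m := ∞) (by simp)
  have hb2 : ContDiff ℝ ∞ (fderiv ℝ (fderiv ℝ b)) := hb1.fderiv_right (m := ∞) (by simp)
  have hb3 := contDiff_d3 hb
  have e0 := fun s => hasDerivAt_comp_line (hb.differentiable (by simp)) c z w s
  have e1 : ∀ s, HasDerivAt (fun s : ℝ => fderiv ℝ b (z + (s * c) • w) w)
      (c * fderiv ℝ (fderiv ℝ b) (z + (s * c) • w) w w) s := fun s => by
    simpa using (hasDerivAt_comp_line (hb1.differentiable (by simp)) c z w s).clm_apply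
      (hasDerivAt_const s w)
  have e2 : ∀ s, HasDerivAt (fun s : ℝ => fderiv ℝ (fderiv ℝ b) (z + (s * c) • w) w w)
      (c * d3 b (z + (s * c) • w) w w w) s := fun s => by
    simpa [d3] using ((hasDerivAt_comp_line (hb2.differentiable (by simp)) c z w s).clm_apply
      (hasDerivAt_const s w)).clm_apply (hasDerivAt_const s w)
  -- The Taylor polynomial based at parameter `s` and evaluated at the endpoint 1: its derivative
  -- telescopes to the third order term alone.
  have e3 : ∀ s ∈ Set.uIcc (0 : ℝ) 1, HasDerivAt (fun s : ℝ => b (z + (s * c) • w) +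
      (1 - s) * (c * fderiv ℝ b (z + (s * c) • w) w) +
      1 / 2 * (1 - s) ^ 2 * (c ^ 2 * fderiv ℝ (fderiv ℝ b) (z + (s * c) • w) w w))
      (c ^ 3 * ((1 / 2 * (1 - s) ^ 2) * d3 b (z + (s * c) • w) w w w)) s := fun s _ => by
    have h1 : HasDerivAt (fun s : ℝ => 1 - s) (-1) s := by
      simpa using (hasDerivAt_id s).const_sub 1
    have h2 : HasDerivAt (fun s : ℝ => 1 / 2 * (1 - s) ^ 2) (-(1 - s)) s := by
      refine ((h1.pow 2).const_mul (1 / 2)).congr_deriv ?_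
      push_cast; ring
    refine (((e0 s).add (h1.mul ((e1 s).const_mul c))).add
      (h2.mul ((e2 s).const_mul (c ^ 2)))).congr_deriv ?_
    simp only [smul_eq_mul]
    ring
  have h := intervalIntegral.integral_eq_sub_of_hasDerivAt e3
    (Continuous.intervalIntegrable (by
      have := hb3.continuous
      fun_prop) 0 1)
  rw [intervalIntegral.integral_const_mul, intervalIntegral.integral_of_le zero_le_one] at h
  simp only [zero_mul, zero_smul, add_zero, one_mul, sub_self, sub_zero, ne_eq,
    OfNat.ofNat_ne_zero, not_false_eq_true, zero_pow, mul_zero, one_pow, mul_one] at h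
  rw [taylorRem]
  linarith

end TaylorRemainder

/-! ### The Taylor remainder as an amplitude -/

section TaylorAmplitude

set_option maxSynthPendingDepth 3

variable {d : ℕ} {ι : Type}

lemma taylorRem_symB {b : Phase d → ℝ} (hb : ∀ {ι : Type}, OfOrder 0 (fun _ : ι => d3 b))
    {c : ι → ℝ} {K : ℝ} (hc : ∀ i, |c i| ≤ K) (n : ℕ) :
    SymB n (fun x : Phase d × Phase d => jb 3 x.2)
      (fun i (x : Phase d × Phase d) => taylorRem b (c i) x.1 (symJ d x.2)) := by
  -- The integration parameter joins the index set, which makes the bounds uniform in it.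
  set κ := ι × Set.Ioc (0 : ℝ) 1
  set P := Phase d × Phase d
  have h1 : SymB n (fun _ : P => (1 : ℝ)) (fun (i : κ) (x : P) =>
      d3 b ((ContinuousLinearMap.fst ℝ (Phase d) (Phase d) +
        ((i.2 : ℝ) * c i.1) • (symJ d).comp (ContinuousLinearMap.snd ℝ (Phase d) (Phase d))) x + 0)) := by
    refine (hb n).comp_affine (fun i : κ => ContinuousLinearMap.fst ℝ (Phase d) (Phase d) +
        ((i.2 : ℝ) * c i.1) • (symJ d).comp (ContinuousLinearMap.snd ℝ (Phase d) (Phase d)))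
        (fun _ => 0) (K := ‖ContinuousLinearMap.fst ℝ (Phase d) (Phase d)‖ + K *
          ‖(symJ d).comp (ContinuousLinearMap.snd ℝ (Phase d) (Phase d))‖) (fun i => ?_)
        zero_le_one (fun _ _ => by simp [jb_zero])
    refine (norm_add_le _ _).trans (add_le_add le_rfl ?_)
    rw [norm_smul]
    refine mul_le_mul_of_nonneg_right ?_ (norm_nonneg _)
    rw [norm_mul, Real.norm_of_nonneg i.2.2.1.le]
    exact (mul_le_of_le_one_left (norm_nonneg _) i.2.2.2).trans (hc i.1)
  obtain ⟨D, hD, hD'⟩ := jb_clm_le (X := Phase d) (Y := Phase d) (symJ d) zero_le_one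
  have h2 : SymB n (fun x : P => jb 1 x.2) (fun (_ : κ) (x : P) =>
      symJ d (ContinuousLinearMap.snd ℝ (Phase d) (Phase d) x + 0)) := by
    refine SymB.comp_affine (f := fun _ x => symJ d x)
      (SymB.linear (fun _ => symJ d) (norm_nonneg (symJ d)) (fun _ => le_rfl))
      (fun _ => ContinuousLinearMap.snd ℝ (Phase d) (Phase d)) (fun _ => 0) (fun _ => le_rfl)
      zero_le_one (fun _ x => by simp)
  simp only [add_zero] at h1 h2
  have h3 := ((h1.bilin (ContinuousLinearMap.id ℝ _) h2).bilin
    (ContinuousLinearMap.id ℝ _) h2).bilin (ContinuousLinearMap.id ℝ _) h2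
  have h4 := h3.const_smul (fun i : κ => 1 / 2 * (1 - (i.2 : ℝ)) ^ 2) (K := 1 / 2) (by norm_num)
    fun i => by
      rw [abs_of_nonneg (by positivity)]
      have h5 : (1 - (i.2 : ℝ)) ^ 2 ≤ 1 := by
        have := i.2.2.1; have := i.2.2.2
        nlinarith
      linarith
  obtain ⟨C, hC, h5⟩ := h4.2
  have hw : ∀ x : P, 1 * jb 1 x.2 * jb 1 x.2 * jb 1 x.2 = jb 3 x.2 := fun x => by
    rw [one_mul, ← jb_add, ← jb_add]; rfl
  simp only [hw] at h5
  refine symB_integral (S := Set.Ioc (0 : ℝ) 1)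
    (ae_restrict_mem measurableSet_Ioc) (μ := fun _ => 1) (integrable_const 1)
    (fun _ => zero_le_one) ((continuous_jb 3).comp continuous_snd)
    (f := fun i s (x : P) => (1 / 2 * (1 - s) ^ 2) *
      d3 b (x.1 + (s * c i) • symJ d x.2) (symJ d x.2) (symJ d x.2) (symJ d x.2))
    (fun i => ?_) hC fun i s hs k hk x => ?_
  · have hd : ContDiff ℝ n (d3 b) := (hb n).1 ()
    have hJ : ContDiff ℝ n fun p : ℝ × P => symJ d p.2.2 :=
      (symJ d).contDiff.comp (contDiff_snd.comp contDiff_snd)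
    have hs : ContDiff ℝ n fun p : ℝ × P => p.2.1 + (p.1 * c i) • symJ d p.2.2 :=
      (contDiff_fst.comp contDiff_snd).add ((contDiff_fst.mul contDiff_const).smul hJ)
    exact (contDiff_const.mul ((contDiff_const.sub contDiff_fst).pow 2)).mul
      ((((hd.comp hs).clm_apply hJ).clm_apply hJ).clm_apply hJ)
  · rw [mul_one]
    exact h5 (i, ⟨s, hs⟩) k hk x

/-- Bounded third derivatives leave no growth in `z`. The cubic growth in `ζ`, one power for each
slot of the third derivative, is absorbed by `a`. -/
lemma amp_taylorRem {b : Phase d → ℝ} (hb : ∀ {ι : Type}, OfOrder 0 (fun _ : ι => d3 b))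
    {a : ι → Phase d → ℂ} (ha : SchwartzB a) {c : ι → ℝ} {K : ℝ} (hc : ∀ i, |c i| ≤ K) :
    Amp 0 (fun i (x : Phase d × Phase d) =>
      a i x.2 * (taylorRem b (c i) x.1 (symJ d x.2) : ℂ)) := by
  intro n k
  have h1 : SymB n (fun x : Phase d × Phase d => jb (k - 3) x.2)
      (fun i (x : Phase d × Phase d) => a i (ContinuousLinearMap.snd ℝ (Phase d) (Phase d) x + 0)) :=
    (ha (k - 3) n).comp_affine (fun _ => ContinuousLinearMap.snd ℝ (Phase d) (Phase d))
      (fun _ => 0) (fun _ => le_rfl) zero_le_one (fun _ x => by simp)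
  have h2 := (taylorRem_symB hb hc n).clm_const Complex.ofRealCLM
  have h3 := h1.bilin (ContinuousLinearMap.mul ℝ ℂ) h2
  simp only [add_zero] at h3
  refine SymB.mono' (f := fun i (x : Phase d × Phase d) =>
      a i x.2 * (taylorRem b (c i) x.1 (symJ d x.2) : ℂ)) h3 fun x => le_of_eq ?_
  rw [jb_zero, one_mul, ← jb_add, sub_add_cancel]

lemma IsSmoothSubquadratic.ofOrder_d3 {b : Phase d → ℝ} (hb : IsSmoothSubquadratic b) {ι : Type} :
    OfOrder 0 (fun _ : ι => d3 b) := hb.ofOrder_fderiv_fderiv.fderiv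

end TaylorAmplitude

/-! ### The symbol of the commutator and its expansion -/

section MoyalCommutator

open scoped FourierTransform

variable {d : ℕ} {ι : Type}

lemma integrable_symInt {m : ℤ} {σ : Phase d × Phase d → ℂ} (hσ : Amp m fun _ : Unit => σ)
    (z : Phase d) : Integrable fun ζ => ech ⟪ζ, z⟫_ℝ * σ (z, ζ) := by
  obtain ⟨C, hC, h⟩ := (hσ 0 (-((2 * d + 1 : ℕ) : ℤ))).bound
  have hc : Continuous σ := ((hσ 0 0).1 ()).continuous
  refine ((integrable_jb (X := Phase d) (μ := volume) (m := (2 * d + 1 : ℕ))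
    (by rw [finrank_phase]; push_cast; omega)).const_mul (C * jb m z)).mono'
    (Continuous.aestronglyMeasurable (by fun_prop)) (Filter.Eventually.of_forall fun ζ => ?_)
  rw [norm_mul, norm_ech, one_mul, mul_assoc]
  exact h () (z, ζ)

/-- The partial transform of a function independent of its first variable; this yields continuity of
the Fourier transform uniformly over families. -/
lemma schwartzB_fourier {f : ι → Phase d → ℂ} (hf : SchwartzB f) :
    SchwartzB (fun i => 𝓕 (f i)) := by
  refine SchwartzB.of_neg fun N k => ?_
  have h1 : SymB (k + N) (fun p : Phase d × Phase d => 1 * jb (-((2 * d + 1 : ℕ) + k)) p.2)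
      (fun i (x : Phase d × Phase d) => f i (ContinuousLinearMap.snd ℝ (Phase d) (Phase d) x + 0)) :=
    (hf (-((2 * d + 1 : ℕ) + k)) (k + N)).comp_affine (fun _ => ContinuousLinearMap.snd ℝ (Phase d) (Phase d))
      (fun _ => 0) (fun _ => le_rfl) zero_le_one (fun _ x => by simp)
  have h2 := pft_symB (Y := Phase d) k N (w := fun _ : Phase d => 1) continuous_const
    (fun _ => zero_le_one) (m := (2 * d + 1 : ℕ)) (by rw [finrank_phase]; push_cast; omega) h1
  have h3 := h2.comp_affine (fun _ => ContinuousLinearMap.inr ℝ (Phase d) (Phase d)) (fun _ => 0)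
    (w' := jb (-(N : ℤ))) (fun _ => le_rfl) zero_le_one (fun _ x => by simp)
  have e : (fun i => 𝓕 (f i)) = fun i (y : Phase d) =>
      pft (fun x : Phase d × Phase d => f i (ContinuousLinearMap.snd ℝ (Phase d) (Phase d) x + 0))
        (ContinuousLinearMap.inr ℝ (Phase d) (Phase d) y + 0) := by
    funext i y
    simp [pft]
  rw [e]
  exact h3

/-- The symbol of `(i/ε)[op(b), op(f)]`. -/
def commSymbol (ε : ℝ) (b f : Phase d → ℂ) (z : Phase d) : ℂ :=
  (Complex.I / ε) *
    (symInt (fun x => 𝓕 f x.2 * b (x.1 + (-(2 * Real.pi * ε / 2)) • symJ d x.2)) z -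
      symInt (fun x => 𝓕 f x.2 * b (x.1 + (2 * Real.pi * ε / 2) • symJ d x.2)) z)

lemma amp_fourier_shift {m : ℤ} (hm : 0 ≤ m) {b : Phase d → ℂ}
    (hb : OfOrder m (fun _ : Unit => b)) {f : Phase d → ℂ} (hf : SchwartzB fun _ : Unit => f)
    (c : ℝ) : Amp m (fun (_ : Unit) (x : Phase d × Phase d) => 𝓕 f x.2 * b (x.1 + c • symJ d x.2)) :=
  amp_mul_shift hm (schwartzB_fourier hf) hb (fun _ => c) (abs_nonneg c) fun _ => le_rfl

lemma schwartzB_const_mul {f : ι → Phase d → ℂ} (hf : SchwartzB f) (c : ℂ) :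
    SchwartzB (fun i z => c * f i z) :=
  hf.clm (c • ContinuousLinearMap.id ℝ ℂ)

lemma schwartzB_commSymbol (ε : ℝ) {m : ℤ} (hm : 0 ≤ m) {b : Phase d → ℂ}
    (hb : OfOrder m (fun _ : Unit => b)) {f : Phase d → ℂ} (hf : SchwartzB fun _ : Unit => f) :
    SchwartzB fun _ : Unit => commSymbol ε b f :=
  schwartzB_const_mul ((amp_fourier_shift hm hb hf _).schwartzB.sub
    (amp_fourier_shift hm hb hf _).schwartzB) _

lemma opC_commSymbol {ε : ℝ} (hε : 0 < ε) {m : ℤ} (hm : 0 ≤ m) {b : Phase d → ℂ}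
    (hb : OfOrder m (fun _ : Unit => b)) {f : Phase d → ℂ} (hf : SchwartzB fun _ : Unit => f)
    {ψ : Position d → ℂ} (hψ : SchwartzB fun _ : Unit => ψ) (q : Position d) :
    opC (2 * Real.pi * ε) (commSymbol ε b f) ψ q = (Complex.I / ε) *
      (opC (2 * Real.pi * ε) b (opC (2 * Real.pi * ε) f ψ) q -
        opC (2 * Real.pi * ε) f (opC (2 * Real.pi * ε) b ψ) q) := by
  have hh : 0 < 2 * Real.pi * ε := by positivity
  rw [opC_comp_left hh hm hb hf hψ, opC_comp_right hh hm hb hf hψ]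
  unfold commSymbol
  rw [opC_const_mul]
  congr 1
  have h1 := (amp_fourier_shift hm hb hf (-(2 * Real.pi * ε / 2))).schwartzB 0
  have h2 := schwartzB_const_mul (amp_fourier_shift hm hb hf (2 * Real.pi * ε / 2)).schwartzB (-1) 0
  have h3 := opC_add hh.ne' le_rfl le_rfl h1 h2 hψ q
  rw [opC_const_mul] at h3
  simp only [neg_one_mul, ← sub_eq_add_neg] at h3
  exact h3

/-- The complexification of a real symbol. -/
abbrev cplx (f : Phase d → ℝ) (z : Phase d) : ℂ := (f z : ℂ)

lemma SchwartzB.cplx {f : ι → Phase d → ℝ} (hf : SchwartzB f) : SchwartzB (fun i => cplx (f i)) :=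
  hf.clm Complex.ofRealCLM

lemma OfOrder.cplx {m : ℤ} {f : ι → Phase d → ℝ} (hf : OfOrder m f) :
    OfOrder m (fun i => cplx (f i)) :=
  hf.clm Complex.ofRealCLM

lemma conj_fourier (f : Phase d → ℝ) (ζ : Phase d) :
    (starRingEnd ℂ) (𝓕 (cplx f) ζ) = 𝓕 (cplx f) (-ζ) := by
  rw [Real.fourier_eq, Real.fourier_eq, ← integral_conj]
  refine integral_congr_ae (Filter.Eventually.of_forall fun z => ?_)
  have h := conj_ech (-⟪z, ζ⟫_ℝ)
  simp only [inner_neg_right]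
  change (starRingEnd ℂ) (ech (-⟪z, ζ⟫_ℝ) * (f z : ℂ)) = ech (- -⟪z, ζ⟫_ℝ) * (f z : ℂ)
  rw [map_mul, h, Complex.conj_ofReal]

/-- Conjugation followed by ζ ↦ -ζ exchanges the two opposite shifts; the resulting sign cancels
that of the conjugated factor i. -/
lemma conj_commSymbol (ε : ℝ) (b f : Phase d → ℝ) (z : Phase d) :
    (starRingEnd ℂ) (commSymbol ε (cplx b) (cplx f) z) = commSymbol ε (cplx b) (cplx f) z := by
  have h : ∀ c : ℝ, (starRingEnd ℂ)
      (symInt (fun x => 𝓕 (cplx f) x.2 * cplx b (x.1 + c • symJ d x.2)) z) =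
      symInt (fun x => 𝓕 (cplx f) x.2 * cplx b (x.1 + (-c) • symJ d x.2)) z := fun c => by
    rw [symInt, ← integral_conj, symInt, ← integral_neg_eq_self]
    refine integral_congr_ae (Filter.Eventually.of_forall fun ζ => ?_)
    simp only [map_mul, conj_ech, conj_fourier, Complex.conj_ofReal, inner_neg_left, neg_neg,
      map_neg, smul_neg, neg_smul]
  rw [commSymbol, map_mul, map_sub, h, h]
  simp only [neg_neg, map_div₀, Complex.conj_I, Complex.conj_ofReal]
  ring

lemma fourier_fderiv_apply {f : Phase d → ℂ} (hf : SchwartzB fun _ : Unit => f) (v ζ : Phase d) :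
    𝓕 (fun z => fderiv ℝ f z v) ζ = 2 * Real.pi * Complex.I * (⟪ζ, v⟫_ℝ : ℂ) * 𝓕 f ζ := by
  have h := congrFun (congrArg (fun f : 𝓢(Phase d, ℂ) => (f : Phase d → ℂ))
    (SchwartzMap.fourier_lineDerivOp_eq hf.toSchwartz v)) ζ
  have ht : (inner ℝ · v : Phase d → ℝ).HasTemperateGrowth :=
    ((innerSL ℝ).flip v).hasTemperateGrowth
  rw [smul_apply, SchwartzMap.smulLeftCLM_apply_apply ht] at h
  simp only [SchwartzMap.fourier_coe] at h
  refine Eq.trans h ?_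
  rw [Complex.real_smul, smul_eq_mul, ← mul_assoc]
  rfl

/-- At a fixed `z` the bracket is the derivative of `f` in the frozen direction J∇b(z). Apply
Fourier inversion to that directional derivative and move J across the inner product, which changes
the sign. -/
lemma poisson_eq_symInt {b f : Phase d → ℝ} (hf : SchwartzB fun _ : Unit => f) (z : Phase d) :
    (poisson b f z : ℂ) = symInt (fun x => 𝓕 (cplx f) x.2 *
      (-(2 * Real.pi * Complex.I) * (fderiv ℝ b x.1 (symJ d x.2) : ℂ))) z := by
  set v := symJ d (∇ b z)
  have hv : SchwartzB fun _ : Unit => fun y => fderiv ℝ (cplx f) y v :=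
    hf.cplx.fderiv.clm (ContinuousLinearMap.apply ℝ ℂ v)
  have h1 : (poisson b f z : ℂ) = fderiv ℝ (cplx f) z v := by
    have : HasFDerivAt (cplx f) (Complex.ofRealCLM.comp (fderiv ℝ f z)) z :=
      Complex.ofRealCLM.hasFDerivAt.comp z ((hf.contDiff ()).differentiable (by simp) z).hasFDerivAt
    rw [this.fderiv, poisson_eq_fderiv, poissonB_apply]
    rfl
  have h2 := congrFun (symInt_fourier hv) z
  rw [h1, ← h2, symInt, symInt]
  refine integral_congr_ae (Filter.Eventually.of_forall fun ζ => ?_)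
  simp only
  rw [fourier_fderiv_apply hf.cplx]
  have h3 : (fderiv ℝ b z (symJ d ζ)) = -⟪ζ, v⟫_ℝ := by
    have : fderiv ℝ b z (symJ d ζ) = ⟪∇ b z, symJ d ζ⟫_ℝ := by simp [gradient]
    rw [this, real_inner_comm, inner_symJ]
  rw [h3]
  push_cast
  ring

/-- The amplitude of the remainder in the expansion of the commutator symbol. -/
def remAmp (ε : ℝ) (b f : Phase d → ℝ) (x : Phase d × Phase d) : ℂ :=
  𝓕 (cplx f) x.2 * (taylorRem b (-(Real.pi * ε)) x.1 (symJ d x.2) : ℂ) +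
    𝓕 (cplx f) x.2 * (taylorRem b (Real.pi * ε) x.1 (symJ d x.2) : ℂ)

lemma amp_remAmp {b : Phase d → ℝ} (hb : IsSmoothSubquadratic b) {f : ι → Phase d → ℝ}
    (hf : SchwartzB f) {ε : ι → ℝ} {K : ℝ} (hε : ∀ i, |ε i| ≤ K) :
    Amp 0 (fun i => remAmp (ε i) b (f i)) := by
  have h1 := amp_taylorRem hb.ofOrder_d3 (schwartzB_fourier hf.cplx)
    (c := fun i => Real.pi * ε i) (K := Real.pi * K) fun i => by
      rw [abs_mul, abs_of_pos Real.pi_pos]; exact mul_le_mul_of_nonneg_left (hε i) Real.pi_pos.le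
  have h2 := amp_taylorRem hb.ofOrder_d3 (schwartzB_fourier hf.cplx)
    (c := fun i => -(Real.pi * ε i)) (K := Real.pi * K) fun i => by
      rw [abs_neg, abs_mul, abs_of_pos Real.pi_pos]
      exact mul_le_mul_of_nonneg_left (hε i) Real.pi_pos.le
  exact fun n k => (h2 n k).add (h1 n k)

/-- The difference of the two shifts keeps only the odd part of the Taylor polynomial. The cubic
remainders carry the factor -(πε)³, and the prefactor i/ε leaves -iπ³ε². -/
lemma commSymbol_eq {b : Phase d → ℝ} (hb : IsSmoothSubquadratic b) {f : Phase d → ℝ}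
    (hf : SchwartzB fun _ : Unit => f) {ε : ℝ} (hε : 0 < ε) (z : Phase d) :
    commSymbol ε (cplx b) (cplx f) z = poisson b f z -
      Complex.I * Real.pi ^ 3 * ε ^ 2 * symInt (remAmp ε b f) z := by
  have i1 := integrable_symInt (amp_fourier_shift (by norm_num) hb.ofOrder.cplx hf.cplx
    (-(2 * Real.pi * ε / 2))) z
  have i2 := integrable_symInt (amp_fourier_shift (by norm_num) hb.ofOrder.cplx hf.cplx
    (2 * Real.pi * ε / 2)) z
  have i3 := integrable_symInt (amp_remAmp (ε := fun _ : Unit => ε) hb hf fun _ => le_rfl) z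
  rw [poisson_eq_symInt hf, commSymbol, symInt, symInt, symInt, symInt, ← integral_sub i1 i2,
    ← integral_const_mul, ← integral_const_mul, eq_sub_iff_add_eq]
  refine (integral_add ((i1.sub i2).const_mul _) (i3.const_mul _)).symm.trans ?_
  refine integral_congr_ae (Filter.Eventually.of_forall fun ζ => ?_)
  have t1 := taylor_line hb.smooth (-(Real.pi * ε)) z (symJ d ζ)
  have t2 := taylor_line hb.smooth (Real.pi * ε) z (symJ d ζ)
  have e : 2 * Real.pi * ε / 2 = Real.pi * ε := by ring
  simp only [e, remAmp, cplx, t1, t2, Pi.sub_apply]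
  push_cast
  have : (ε : ℂ) ≠ 0 := by exact_mod_cast hε.ne'
  field_simp
  ring

end MoyalCommutator

lemma SymB.congr {ι X E : Type} [NormedAddCommGroup X] [NormedSpace ℝ X] [NormedAddCommGroup E]
    [NormedSpace ℝ E] {n : ℕ} {w : X → ℝ} {f g : ι → X → E} (hf : SymB n w f)
    (h : ∀ i x, g i x = f i x) : SymB n w g := by
  have : g = f := funext fun i => funext (h i)
  rwa [this]

/-! ### Uniform estimates of the remainder for small and large ε -/

section Remainder

open scoped FourierTransform

variable {d : ℕ} {b c : Phase d → ℝ}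

lemma heat_correctedBracket (hb : IsSmoothSubquadratic b) (hc : SchwartzB fun _ : Unit => c)
    (ε l : ℝ) (z : Phase d) :
    heat l (correctedBracket ε b c) z =
      heat l (poisson b c) z - ε * heat l (bracketCorr b c) z := by
  have h1 := integrable_heat (hb.schwartzB_poisson hc) l z
  have h2 := integrable_heat (hb.schwartzB_bracketCorr hc) l z
  unfold heat
  rw [← integral_const_mul, ← integral_sub h1 (h2.const_mul ε)]
  refine integral_congr_ae (Filter.Eventually.of_forall fun x => ?_)
  simp only [correctedBracket_eq hb.smooth (hc.contDiff ()), smul_eq_mul]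
  ring

/-- The difference between the Weyl symbol of the commutator and of the first order approximation,
divided by `ε ^ 2`, where `ε = l ^ 2`. -/
def commRem (l : ℝ) (b c : Phase d → ℝ) (z : Phase d) : ℂ :=
  ((l ^ 4)⁻¹ : ℝ) * (commSymbol (l ^ 2) (cplx b) (cplx (heat l c)) z -
    cplx (heat l (correctedBracket (l ^ 2) b c)) z)

/-- The l² terms are {b,Δc}/4 on one side and Δ{b,c}/4 minus the correction on the other. They
coincide, so only remainders of size l⁴ survive. -/
lemma poisson_heat (hb : IsSmoothSubquadratic b) (hc : SchwartzB fun _ : Unit => c) {l : ℝ}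
    (hl : 0 < l) (hl1 : l ≤ 1) (z : Phase d) :
    poisson b (heat l c) z - heat l (correctedBracket (l ^ 2) b c) z =
      l ^ 4 * (poisson b (heatR2 l c) z - heatR2 l (poisson b c) z +
        heatR1 l (bracketCorr b c) z) := by
  have ha : |l| ≤ 1 := by rw [abs_of_pos hl]; exact hl1
  have e1 : fderiv ℝ (heat l c) z = fderiv ℝ c z + (l ^ 2 / 4) • fderiv ℝ (lap c) z +
      l ^ 4 • fderiv ℝ (heatR2 l c) z := by
    rw [fderiv_heatR2 hc ha, fderiv_heat hc, fderiv_lap (hc.contDiff ()), heatR2, smul_smul,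
      mul_inv_cancel₀ (by positivity), one_smul]
    abel
  have e2 : poisson b (heat l c) z = poisson b c z + l ^ 2 / 4 * poisson b (lap c) z +
      l ^ 4 * poisson b (heatR2 l c) z := by
    simp only [poisson_eq_fderiv, e1, map_add, map_smul, smul_eq_mul]
  rw [heat_correctedBracket hb hc, e2, heatR2, heatR1, bracketCorr]
  simp only [smul_eq_mul]
  field_simp
  ring

lemma commRem_eq (hb : IsSmoothSubquadratic b) (hc : SchwartzB fun _ : Unit => c) {l : ℝ}
    (hl : 0 < l) (hl1 : l ≤ 1) (z : Phase d) :
    commRem l b c z = cplx (fun z => poisson b (heatR2 l c) z - heatR2 l (poisson b c) z +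
        heatR1 l (bracketCorr b c) z) z -
      Complex.I * Real.pi ^ 3 * symInt (remAmp (l ^ 2) b (heat l c)) z := by
  have ha : |l| ≤ 1 := by rw [abs_of_pos hl]; exact hl1
  have h := poisson_heat hb hc hl hl1 z
  rw [commRem, commSymbol_eq hb (hc.heat (l := fun _ => l) fun _ => ha) (by positivity)]
  have h' : (poisson b (heat l c) z : ℂ) - cplx (heat l (correctedBracket (l ^ 2) b c)) z =
      (l ^ 4 : ℝ) * cplx (fun z => poisson b (heatR2 l c) z - heatR2 l (poisson b c) z +
        heatR1 l (bracketCorr b c) z) z := by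
    simp only [cplx]
    exact_mod_cast h
  have hl' : (l : ℂ) ≠ 0 := by exact_mod_cast hl.ne'
  rw [sub_right_comm, h']
  push_cast
  field_simp

/-- Uniform bounds for the remainder in the semiclassical regime. -/
lemma schwartzB_commRem (hb : IsSmoothSubquadratic b) (hc : SchwartzB fun _ : Unit => c) :
    SchwartzB (fun l : {l : ℝ // 0 < l ∧ l ≤ 1} => commRem l b c) := by
  set κ := {l : ℝ // 0 < l ∧ l ≤ 1}
  have hc' : SchwartzB fun _ : κ => c := hc.reindex fun _ => ()
  have h1 := ((hb.schwartzB_poisson (hc'.heatR2 (l := Subtype.val) (fun l => l.2.1)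
    fun l => l.2.2)).sub ((hb.schwartzB_poisson hc').heatR2 (l := Subtype.val) (fun l => l.2.1)
    fun l => l.2.2)).add ((hb.schwartzB_bracketCorr hc').heatR1 (l := Subtype.val)
    (fun l => l.2.1) fun l => l.2.2)
  have h2 := (amp_remAmp (ε := fun l : κ => (l : ℝ) ^ 2) (K := 1) hb
    (hc'.heat (l := Subtype.val) fun l => by rw [abs_of_pos l.2.1]; exact l.2.2)
    fun l => by
      rw [abs_of_nonneg (by positivity)]
      exact pow_le_one₀ l.2.1.le l.2.2).schwartzB
  have h3 := h1.cplx.sub (schwartzB_const_mul h2 (Complex.I * Real.pi ^ 3))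
  have e : (fun l : κ => commRem l b c) = _ :=
    funext fun l => funext fun z => commRem_eq hb hc l.2.1 l.2.2 z
  rw [e]
  exact h3

lemma fourier_smul {l : ℝ} (hl : 0 < l) (f : Phase d → ℂ) (ξ : Phase d) :
    𝓕 (fun v => ((l ^ (2 * d) : ℝ) : ℂ) * f (l • v)) ξ = 𝓕 f (l⁻¹ • ξ) := by
  have h := Measure.integral_comp_smul (volume : Measure (Phase d))
    (fun w => ech (-⟪w, l⁻¹ • ξ⟫_ℝ) * f w) l
  simp only [finrank_phase, inner_smul_left, inner_smul_right, RCLike.conj_to_real] at h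
  rw [Real.fourier_eq, Real.fourier_eq]
  change ∫ v, ech (-⟪v, ξ⟫_ℝ) * (((l ^ (2 * d) : ℝ) : ℂ) * f (l • v)) =
    ∫ w, ech (-⟪w, l⁻¹ • ξ⟫_ℝ) * f w
  have hl' : (l : ℂ) ≠ 0 := by exact_mod_cast hl.ne'
  simp only [mul_left_comm _ ((l ^ (2 * d) : ℝ) : ℂ)]
  rw [integral_const_mul]
  simp only [inner_smul_right, ← mul_assoc, inv_mul_cancel₀ hl.ne', one_mul] at h ⊢
  rw [h, abs_of_pos (by positivity), Complex.real_smul, ← mul_assoc, ← Complex.ofReal_mul,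
    mul_inv_cancel₀ (by positivity), Complex.ofReal_one, one_mul]

/-- Rescaling `z` by l and `ζ` by its inverse turns a shift proportional to ε = l² into one
independent of l inside the dilated `b`. -/
lemma symInt_smul {l : ℝ} (hl : 0 < l) (f b : Phase d → ℂ) (κ : ℝ) (v : Phase d) :
    symInt (fun x => 𝓕 f x.2 * b (x.1 + (κ * l ^ 2) • symJ d x.2)) (l • v) =
      ((l ^ (2 * d))⁻¹ : ℝ) * symInt (fun x =>
        𝓕 (fun v => ((l ^ (2 * d) : ℝ) : ℂ) * f (l • v)) x.2 *
          b (l • (x.1 + κ • symJ d x.2))) v := by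
  have h := Measure.integral_comp_smul (volume : Measure (Phase d))
    (fun ξ => ech ⟪ξ, v⟫_ℝ * (𝓕 f (l⁻¹ • ξ) * b (l • (v + κ • symJ d ξ)))) l
  rw [finrank_phase, abs_of_pos (by positivity), Complex.real_smul] at h
  simp only [symInt, fourier_smul hl]
  rw [← h]
  refine integral_congr_ae (Filter.Eventually.of_forall fun ζ => ?_)
  simp only [inner_smul_left, inner_smul_right, RCLike.conj_to_real, smul_smul, map_smul, smul_add,
    inv_mul_cancel₀ hl.ne', one_smul]
  rw [show l * (κ * l) = κ * l ^ 2 by ring]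

/-- For l ≥ 1 each derivative costs one factor l and the growth of order `m` costs `m` more; the
normalisation pays for exactly `n` derivatives. -/
lemma symB_dilate {m : ℕ} {f : Phase d → ℂ} (hf : OfOrder m fun _ : Unit => f) (n : ℕ) :
    SymB n (jb m) (fun (l : {l : ℝ // 1 ≤ l}) v => ((l : ℝ) ^ (n + m))⁻¹ • f ((l : ℝ) • v)) := by
  obtain ⟨h1, C, hC, h2⟩ := hf n
  refine ⟨fun l => ((h1 ()).comp (contDiff_const_smul _)).const_smul _, C, hC, fun l k hk v => ?_⟩
  have hl := l.2
  have h0 : (0 : ℝ) < l := one_pos.trans_le hl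
  have hk' : ((k : ℕ) : WithTop ℕ∞) ≤ n := by exact_mod_cast hk
  have hf' : ContDiff ℝ k f := (h1 ()).of_le hk'
  have e : iteratedFDeriv ℝ k (fun v => ((l : ℝ) ^ (n + m))⁻¹ • f ((l : ℝ) • v)) v =
      ((l : ℝ) ^ (n + m))⁻¹ • (l : ℝ) ^ k • iteratedFDeriv ℝ k f ((l : ℝ) • v) := by
    have h3 := iteratedFDeriv_const_smul_apply' (𝕜 := ℝ) (i := k) (a := ((l : ℝ) ^ (n + m))⁻¹)
      (f := fun v => f ((l : ℝ) • v)) (x := v) (hf'.comp (contDiff_const_smul _)).contDiffAt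
    rw [h3, iteratedFDeriv_comp_const_smul _ hf']
  have h4 : jb m ((l : ℝ) • v) ≤ (l : ℝ) ^ m * jb m v := by
    rw [jb_natCast, jb_natCast, ← mul_pow, norm_smul, Real.norm_of_nonneg h0.le]
    gcongr
    linarith
  rw [e, norm_smul, norm_smul, norm_inv, norm_pow, norm_pow, Real.norm_of_nonneg h0.le,
    inv_mul_le_iff₀ (by positivity)]
  calc _ ≤ (l : ℝ) ^ n * (C * ((l : ℝ) ^ m * jb m v)) := by
        have := (h2 () k hk ((l : ℝ) • v)).trans (mul_le_mul_of_nonneg_left h4 hC)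
        gcongr
    _ = _ := by ring

/-- Uniform bounds for the dilated remainder away from the semiclassical regime. -/
lemma symB_commRem_dilated (hb : IsSmoothSubquadratic b) (hc : SchwartzB fun _ : Unit => c) :
    SymB (d + 1) (jb (-((d + 1 : ℕ) : ℤ)))
      (fun (l : {l : ℝ // 1 ≤ l}) v => commRem l b c ((l : ℝ) • v)) := by
  set κ := {l : ℝ // 1 ≤ l}
  have hc' : SchwartzB fun _ : κ => c := hc.reindex fun _ => ()
  have h0 : ∀ l : κ, 0 < (l : ℝ) := fun l => one_pos.trans_le l.2
  have hi : ∀ (l : κ) (n : ℕ), |((l : ℝ) ^ n)⁻¹| ≤ 1 := fun l n => by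
    rw [abs_of_pos (inv_pos.2 (pow_pos (h0 l) n))]
    exact inv_le_one_of_one_le₀ (one_le_pow₀ l.2)
  have hA : SchwartzB fun (l : κ) v => ((((l : ℝ) ^ (2 * d) : ℝ) : ℂ)) * cplx (heat l c) ((l : ℝ) • v) := by
    have h := (schwartzB_heat_smul hc' (l := fun l : κ => (l : ℝ)) fun l => l.2).cplx
    refine fun m n => (h m n).congr fun l v => ?_
    simp [cplx]
  -- The count is exact. The L² bound wants `d + 1` derivatives, and lowering the quadratic order of
  -- `b` to -(d + 1) takes `d + 3` more. Their cost, with the growth of `b`, is the power 2d + 6 of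
  -- l: four from ε⁻², two from i/ε, and 2d from rescaling the Gaussian average.
  have hB := symB_dilate (m := 2) (f := cplx b) hb.ofOrder.cplx (d + 1 + (d + 3))
  have hS : ∀ t : ℝ, SymB (d + 1) (jb (-((d + 1 : ℕ) : ℤ))) (fun l : κ =>
      symInt fun x => 𝓕 (fun v => ((((l : ℝ) ^ (2 * d) : ℝ) : ℂ)) * cplx (heat l c) ((l : ℝ) • v)) x.2 *
        (((l : ℝ) ^ (d + 1 + (d + 3) + 2))⁻¹ • cplx b ((l : ℝ) • (x.1 + t • symJ d x.2)))) := by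
    intro t
    have h1 := symB_mul_shift (k := -((2 * d + 1 : ℕ) + (d + 1 : ℕ))) (m := 2) (by norm_num)
      (schwartzB_fourier hA _ (d + 1 + (d + 3))) hB (fun _ => t) (abs_nonneg t) fun _ => le_rfl
    refine (symInt_symB (k := d + 1) (N := d + 3) h1).mono' fun x => jb_mono ?_ x
    push_cast
    omega
  have hP : SchwartzB fun (l : κ) v => ((l : ℝ) ^ (2 * d)) • heat l (poisson b c) ((l : ℝ) • v) :=
    schwartzB_heat_smul (hb.schwartzB_poisson hc') fun l => l.2
  have hE : SchwartzB fun (l : κ) v => ((l : ℝ) ^ (2 * d)) • heat l (bracketCorr b c) ((l : ℝ) • v) :=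
    schwartzB_heat_smul (hb.schwartzB_bracketCorr hc') fun l => l.2
  have hH := (hP.const_smul (fun l : κ => ((l : ℝ) ^ (2 * d + 4))⁻¹) zero_le_one fun l => hi l _).sub
    (hE.const_smul (fun l : κ => ((l : ℝ) ^ (2 * d + 2))⁻¹) zero_le_one fun l => hi l _)
  have h3 := (((hS (-Real.pi)).sub (hS Real.pi)).clm_const
    (Complex.I • ContinuousLinearMap.id ℝ ℂ)).sub (hH.cplx _ _)
  refine h3.congr fun l v => ?_
  have hl : ((l : ℝ) : ℂ) ≠ 0 := by exact_mod_cast (h0 l).ne'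
  have hs : ∀ t : ℝ, symInt (fun x => 𝓕 (fun v => ((((l : ℝ) ^ (2 * d) : ℝ) : ℂ)) *
        cplx (heat l c) ((l : ℝ) • v)) x.2 * (((l : ℝ) ^ (d + 1 + (d + 3) + 2))⁻¹ •
          cplx b ((l : ℝ) • (x.1 + t • symJ d x.2)))) v =
      (((l : ℝ) : ℂ) ^ (2 * d + 6))⁻¹ * ((l : ℝ) ^ (2 * d) *
        symInt (fun x => 𝓕 (cplx (heat l c)) x.2 * cplx b (x.1 + (t * (l : ℝ) ^ 2) • symJ d x.2))
          ((l : ℝ) • v)) := fun t => by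
    rw [symInt_smul (h0 l), ← mul_assoc ((_ : ℂ) ^ (2 * d)), ← Complex.ofReal_pow _ (2 * d),
      ← Complex.ofReal_mul, mul_inv_cancel₀ (pow_ne_zero _ (h0 l).ne'), Complex.ofReal_one, one_mul,
      symInt, symInt, ← integral_const_mul]
    refine integral_congr_ae (Filter.Eventually.of_forall fun ζ => ?_)
    simp only [Complex.real_smul]
    push_cast
    ring
  rw [hs, hs, commRem, commSymbol, show -(2 * Real.pi * (l : ℝ) ^ 2 / 2) = -Real.pi * (l : ℝ) ^ 2 by
    ring, show 2 * Real.pi * (l : ℝ) ^ 2 / 2 = Real.pi * (l : ℝ) ^ 2 by ring]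
  simp only [cplx, heat_correctedBracket hb hc, smul_apply, ContinuousLinearMap.id_apply,
    smul_eq_mul]
  push_cast
  field_simp
  ring

end Remainder

/-! ### Assembling the theorem -/

section CommutatorAssembly

variable {d : ℕ} {b c : Phase d → ℝ}

lemma SchwartzB.comp_smul {ι E : Type} [NormedAddCommGroup E] [NormedSpace ℝ E]
    {f : ι → Phase d → E} (hf : SchwartzB f) {κ : ℝ} (hκ : κ ≠ 0) :
    SchwartzB (fun i z => f i (κ • z)) := by
  refine SchwartzB.of_neg fun m n => ?_
  obtain ⟨K, hK, h⟩ := jb_neg_smul_le (X := Phase d) hκ (m := m) (Int.natCast_nonneg m)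
  have := (hf (-(m : ℤ)) n).comp_affine (fun _ => κ • ContinuousLinearMap.id ℝ (Phase d))
    (fun _ => 0) (w' := jb (-(m : ℤ))) (fun _ => le_rfl) hK fun _ z => by simpa using h z
  simpa using this

/-- The large-scale case undoes the dilation of `schwartzB_heat_smul`, which costs nothing at a
single fixed scale. -/
lemma schwartzB_heat_single {f : Phase d → ℝ} (hf : SchwartzB fun _ : Unit => f) {l : ℝ}
    (hl : 0 < l) : SchwartzB fun _ : Unit => heat l f := by
  rcases le_total l 1 with h | h
  · exact hf.heat (l := fun _ => l) fun _ => by rw [abs_of_pos hl]; exact h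
  · have h1 := ((schwartzB_heat_smul hf (l := fun _ => l) fun _ => h).comp_smul
      (inv_ne_zero hl.ne')).const_smul (fun _ => (l ^ (2 * d))⁻¹) (abs_nonneg _) fun _ => le_rfl
    refine fun m n => (h1 m n).congr fun _ z => ?_
    rw [smul_smul, smul_smul, inv_mul_cancel₀ (by positivity), mul_inv_cancel₀ hl.ne', one_smul,
      one_smul]

lemma opAntiWick_eq_opC {ε : ℝ} (hε : 0 < ε) (a : Phase d → ℝ) (ψ : Position d → ℂ) :
    opAntiWick ε a ψ = opC (2 * Real.pi * ε) (cplx (heat (√ε) a)) ψ := by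
  rw [opAntiWick, convolution_phaseGaussian hε, opWeyl_eq_opC]

lemma mapsSchwartz_opC {h : ℝ} (hh : h ≠ 0) {m : ℤ} (hm : 0 ≤ m) {a : Phase d → ℂ}
    (ha : OfOrder m (fun _ : Unit => a)) : MapsSchwartz (opC h a) := fun ψ =>
  ⟨(opC_schwartz hh hm ha (schwartzB_coe ψ)).toSchwartz, fun _ => rfl⟩

lemma opC_congr_ae (h : ℝ) (a : Phase d → ℂ) {f g : Position d → ℂ} (hfg : f =ᵐ[volume] g) :
    opC h a f = opC h a g := by
  ext q
  unfold opC
  congr 1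
  refine integral_congr_ae (Filter.Eventually.of_forall fun p => integral_congr_ae ?_)
  filter_upwards [hfg] with y hy
  rw [hy]

lemma dense_schwartzInL2 (d : ℕ) : Dense (schwartzInL2 d : Set (L2 d)) := by
  have h := SchwartzMap.denseRange_toLpCLM (E := Position d) (F := ℂ) (p := 2)
    ENNReal.ofNat_ne_top (μ := volume)
  exact h

/-- A real Schwartz symbol quantizes to a bounded self-adjoint operator, and the Schwartz space is
dense. -/
lemma isEssSelfAdjointOnSchwartz_of_opC {h : ℝ} (hh : 0 < h) {s : Phase d → ℂ}
    (hs : SchwartzB fun _ : Unit => s) (hr : ∀ z, (starRingEnd ℂ) (s z) = s z)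
    {Q : (Position d → ℂ) → Position d → ℂ} (hQ : ∀ ψ : 𝓢(Position d, ℂ), Q ψ = opC h s ψ) :
    IsEssSelfAdjointOnSchwartz Q := by
  obtain ⟨M, _, hM⟩ := weyl_L2_bound (hs (-((d + 1 : ℕ) : ℤ)) (d + 1))
  obtain ⟨B, hB, _, hsa⟩ := hM () 1 h one_pos hh s hs fun z => by rw [one_smul]
  refine ⟨B.toLinearMap.toPMap (schwartzInL2 d), rfl, fun ψ hψ => ?_,
    isEssentiallySelfAdjoint_toPMap (hsa hr) (dense_schwartzInL2 d)⟩
  have h1 := hB (ψ.toLp 2 volume)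
  rw [opC_congr_ae h s (ψ.coeFn_toLp 2 volume), ← hQ ψ] at h1
  exact h1

lemma schwartzB_commSymbol_heat (hb : IsSmoothSubquadratic b) (hc : SchwartzB fun _ : Unit => c)
    {ε : ℝ} (hε : 0 < ε) :
    SchwartzB fun _ : Unit => commSymbol ε (cplx b) (cplx (heat (√ε) c)) :=
  schwartzB_commSymbol ε (by norm_num) hb.ofOrder.cplx
    (schwartzB_heat_single hc (Real.sqrt_pos.2 hε)).cplx

lemma scaledCommutator_eq_opC (hb : IsSmoothSubquadratic b) (hc : SchwartzB fun _ : Unit => c)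
    {ε : ℝ} (hε : 0 < ε) (ψ : 𝓢(Position d, ℂ)) :
    scaledCommutator ε (opWeyl ε b) (opAntiWick ε c) ψ =
      opC (2 * Real.pi * ε) (commSymbol ε (cplx b) (cplx (heat (√ε) c))) ψ := by
  ext q
  rw [opC_commSymbol hε (by norm_num) hb.ofOrder.cplx
    (schwartzB_heat_single hc (Real.sqrt_pos.2 hε)).cplx (schwartzB_coe ψ)]
  simp only [scaledCommutator, opWeyl_eq_opC, opAntiWick_eq_opC hε]

lemma schwartzB_commRem_single (hb : IsSmoothSubquadratic b) (hc : SchwartzB fun _ : Unit => c)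
    {ε : ℝ} (hε : 0 < ε) : SchwartzB fun _ : Unit => commRem (√ε) b c := by
  have h1 := schwartzB_commSymbol_heat hb hc hε
  have h2 := schwartzB_heat_single (hb.schwartzB_correctedBracket hc ε) (Real.sqrt_pos.2 hε)
  have h3 := schwartzB_const_mul (h1.sub h2.cplx) (((√ε ^ 4)⁻¹ : ℝ) : ℂ)
  refine fun m n => (h3 m n).congr fun _ z => ?_
  rw [commRem, Real.sq_sqrt hε.le]

lemma conj_commRem (l : ℝ) (z : Phase d) :
    (starRingEnd ℂ) (commRem l b c z) = commRem l b c z := by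
  rw [commRem, map_mul, map_sub, conj_commSymbol]
  simp only [Complex.conj_ofReal]

/-- The second order remainder symbol. -/
def remSymbol (ε : ℝ) (b c : Phase d → ℝ) (z : Phase d) : ℝ := (commRem (√ε) b c z).re

lemma cplx_remSymbol (ε : ℝ) (b c : Phase d → ℝ) : cplx (remSymbol ε b c) = commRem (√ε) b c :=
  funext fun z => Complex.conj_eq_iff_re.1 (conj_commRem (√ε) z)

lemma schwartzB_remSymbol (hb : IsSmoothSubquadratic b) (hc : SchwartzB fun _ : Unit => c)
    {ε : ℝ} (hε : 0 < ε) : SchwartzB fun _ : Unit => remSymbol ε b c :=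
  (schwartzB_commRem_single hb hc hε).clm Complex.reCLM

/-- Two applications of `weyl_L2_bound`, split at √ε = 1: without dilation below, with dilation by
√ε above. -/
lemma exists_bound_remSymbol (hb : IsSmoothSubquadratic b) (hc : SchwartzB fun _ : Unit => c) :
    ∃ M : ℝ, ∀ ε : ℝ, 0 < ε → IsL2BoundedBy (opWeyl ε (remSymbol ε b c)) M := by
  obtain ⟨M₁, _, h₁⟩ := weyl_L2_bound (schwartzB_commRem hb hc (-((d + 1 : ℕ) : ℤ)) (d + 1))
  obtain ⟨M₂, _, h₂⟩ := weyl_L2_bound (symB_commRem_dilated hb hc)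
  refine ⟨max M₁ M₂, fun ε hε => ?_⟩
  have hl := Real.sqrt_pos.2 hε
  have hs := schwartzB_commRem_single hb hc hε
  have hh : 0 < 2 * Real.pi * ε := by positivity
  have e : opWeyl ε (remSymbol ε b c) = opC (2 * Real.pi * ε) (commRem (√ε) b c) := by
    ext1 ψ
    rw [opWeyl_eq_opC, ← cplx_remSymbol]
  rw [e]
  rcases le_total (√ε) 1 with h | h
  · obtain ⟨T, hT, hn, _⟩ := h₁ ⟨√ε, hl, h⟩ 1 _ one_pos hh _ hs fun z => by rw [one_smul]
    exact ⟨T, hT, hn.trans (le_max_left _ _)⟩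
  · obtain ⟨T, hT, hn, _⟩ := h₂ ⟨√ε, h⟩ (√ε) _ hl hh _ hs fun z => rfl
    exact ⟨T, hT, hn.trans (le_max_right _ _)⟩

lemma scaledCommutator_expansion (hb : IsSmoothSubquadratic b) (hc : SchwartzB fun _ : Unit => c)
    {ε : ℝ} (hε : 0 < ε) (ψ : 𝓢(Position d, ℂ)) (q : Position d) :
    scaledCommutator ε (opWeyl ε b) (opAntiWick ε c) ψ q =
      opAntiWick ε (correctedBracket ε b c) ψ q +
        (ε : ℂ) ^ 2 * opWeyl ε (remSymbol ε b c) ψ q := by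
  have hh : 0 < 2 * Real.pi * ε := by positivity
  have h2 := schwartzB_heat_single (hb.schwartzB_correctedBracket hc ε) (Real.sqrt_pos.2 hε)
  have h3 := schwartzB_const_mul (schwartzB_commRem_single hb hc hε) ((ε : ℂ) ^ 2)
  rw [scaledCommutator_eq_opC hb hc hε, opAntiWick_eq_opC hε, opWeyl_eq_opC,
    show (fun z => (remSymbol ε b c z : ℂ)) = commRem (√ε) b c from cplx_remSymbol ε b c,
    ← opC_const_mul, ← opC_add hh.ne' le_rfl le_rfl (h2.cplx 0) (h3 0) (schwartzB_coe ψ)]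
  congr 1
  ext z
  have hε' : (ε : ℂ) ≠ 0 := by exact_mod_cast hε.ne'
  rw [commRem, Real.sq_sqrt hε.le, show √ε ^ 4 = ε ^ 2 by
    rw [show (4 : ℕ) = 2 * 2 from rfl, pow_mul, Real.sq_sqrt hε.le]]
  push_cast
  field_simp
  ring

end CommutatorAssembly

end


theorem mainTheorem4 (d : ℕ) (b : Phase d → ℝ) (hb : IsSmoothSubquadratic b)
    (c : SchwartzMap (Phase d) ℝ) :
    (∀ ε : ℝ, 0 < ε →
      MapsSchwartz (opWeyl ε b) ∧
      MapsSchwartz (opAntiWick ε c) ∧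
      IsEssSelfAdjointOnSchwartz (scaledCommutator ε (opWeyl ε b) (opAntiWick ε c)) ∧
      ∃ a : SchwartzMap (Phase d) ℝ, ∀ z, a z = correctedBracket ε b c z) ∧
    ∃ χ : ℝ → SchwartzMap (Phase d) ℝ,
      (∃ M : ℝ, ∀ ε : ℝ, 0 < ε → IsL2BoundedBy (opWeyl ε (χ ε)) M) ∧
      ∀ ε : ℝ, 0 < ε → ∀ (ψ : SchwartzMap (Position d) ℂ) (q : Position d),
        scaledCommutator ε (opWeyl ε b) (opAntiWick ε c) ψ q =
          opAntiWick ε (correctedBracket ε b c) ψ q + (ε : ℂ) ^ 2 * opWeyl ε (χ ε) ψ q := by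
  have hc : SchwartzB fun _ : Unit => (c : Phase d → ℝ) := schwartzB_coe c
  refine ⟨fun ε hε => ?_, ?_⟩
  · have hh : 0 < 2 * Real.pi * ε := by positivity
    refine ⟨?_, ?_, ?_, (hb.schwartzB_correctedBracket hc ε).toSchwartz, fun _ => rfl⟩
    · rw [show opWeyl ε b = opC (2 * Real.pi * ε) (cplx b) from funext (opWeyl_eq_opC b)]
      exact mapsSchwartz_opC hh.ne' (by norm_num) hb.ofOrder.cplx
    · rw [show opAntiWick ε c = _ from funext (opAntiWick_eq_opC hε c)]
      exact mapsSchwartz_opC hh.ne' le_rfl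
        ((schwartzB_heat_single hc (Real.sqrt_pos.2 hε)).cplx 0)
    · exact isEssSelfAdjointOnSchwartz_of_opC hh (schwartzB_commSymbol_heat hb hc hε)
        (conj_commSymbol ε b _) (scaledCommutator_eq_opC hb hc hε)
  · classical
    -- The value 0 for nonpositive ε is arbitrary; nothing is claimed there.
    refine ⟨fun ε => if hε : 0 < ε then (schwartzB_remSymbol hb hc hε).toSchwartz else 0, ?_,
      fun ε hε ψ q => ?_⟩
    · obtain ⟨M, hM⟩ := exists_bound_remSymbol hb hc
      refine ⟨M, fun ε hε => ?_⟩
      simp only [dif_pos hε]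
      exact hM ε hε
    · simp only [dif_pos hε]
      exact scaledCommutator_expansion hb hc hε ψ q
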